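/- **Model.** For integers $n,p\ge 1$ one observes $n$ i.i.d. copies of $(Y,X)\in\mathbb R\times\mathbb R^p$, where $X\sim\mathcal N(0,\Sigma)$, $Y=X^\top\beta+\varepsilon$ and $\varepsilon\sim\mathcal N(0,\sigma^2)$ is independent of $X$. All of $\theta=(\beta,\Sigma,\sigma)$ is unknown. Fix constants $M_1>1$, $M_2>0$ and $\alpha,\eta>0$ with $\alpha+\eta<1$. For a loading vector $\xi\in\mathbb R^p$, $t_0\in\mathbb R$ and $\tau>0$ let $$\Theta(k)=\{\theta:\ \|\beta\|_0\le k,\ M_1^{-1}\le\lambda_{\min}(\Sigma)\le\lambda_{\max}(\Sigma)\le M_1,\ 0<\sigma\le M_2\},$$ $$\Theta(k;\xi,t_0)=\{\theta\in\Theta(k):\xi^\top\beta=t_0\},\qquad \Theta_{\pm\tau}(k;\xi,t_0)=\{\theta\in\Theta(k):|\xi^\top\beta-t_0|\ge\tau\}.$$ Let $\Psi_\alpha(\Theta)$ be the set of measurable functions $\psi$ of the data with values in $[0,1]$ such that $\sup_{\theta\in\Theta}\mathbb E_\theta\psi\le\alpha$. The adaptive separation distance is $$\tau_{\rm adap}(k_u,k;\xi)=\inf\Big\{\tau>0:\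 \sup_{\psi\in\Psi_\alpha(\Theta(k_u;\xi,t_0))}\ \inf_{\theta\in\Theta_{\pm\tau}(k;\xi,t_0)}\mathbb E_\theta\psi\ \ge\ 1-\eta\Big\}.$$ **Loading quantities.** Let $\xi\ne0$ be ordered (without loss of generality) so that $|\xi_1|\ge\dots\ge|\xi_p|$; it is otherwise arbitrary. Let $k_\xi=\|\xi\|_0$ and, for $t>0$, $H(t;\xi)=\big(\sum_{j\le\lceil t\rceil\wedge p}\xi_j^2\big)^{1/2}$. Let $\zeta\in\mathbb R$ be the unique solution of $$\frac{\sum_{j\le k_\xi}|\xi_j|e^{-\zeta/\xi_j^2}}{\big(\sum_{j\le k_\xi}\xi_j^2e^{-\zeta/\xi_j^2}\big)^{1/2}}=\frac{k_u}{2},$$ and put $\lambda=\sqrt{\max(\zeta,0)}$, $$\nu_1=\lambda k_u+\Big(\sum_{j\le k_\xi}\xi_j^2e^{-\lambda^2/\xi_j^2}\Big)^{1/2},\qquad j_1=\max\{j\in[p]:|\xi_j|\ge\lambda\}\quad(j_1=0\text{ if there is no such }j).$$ **Statement.** Fix $\gamma\in[0,1/2)$ and constants $C_s,C_u$. Consider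 all $n,p,k_u$ that are sufficiently large (at least some $N$) and satisfy $k_u\le C_sp^\gamma$ and $k_u\le C_u\sqrt n/\log p$ (the ultra-sparse regime). 1. There are $C>0$, $r\ge0$ and $N$, depending only on $M_1,M_2,\alpha,\eta,\gamma,C_s,C_u$, such that for all such $n,p,k_u\ge N$, all $1\le k\le k_u$, all $t_0\in\mathbb R$ and all $\xi$ as above, with $L=C(\log p)^r$, $$L^{-1}\frac{\nu_1}{\sqrt n}\le\tau_{\rm adap}(k_u,k;\xi)\le L\,\frac{\nu_1}{\sqrt n},\qquad L^{-1}\frac{H(k_u^2\log p;\xi)}{\sqrt n}\le\frac{\nu_1}{\sqrt n}\le L\,\frac{H(k_u^2\log p;\xi)}{\sqrt n}.$$ 2. For every constant $C_j$ there are $C>0$ and $N$, depending only on $M_1,M_2,\alpha,\eta,\gamma,C_s,C_u,C_j$, such that if moreover $k_u^2\log p\le C_j\,j_1$, then for all $n,p,k_u\ge N$, $1\le k\le k_u$ and $t_0\in\mathbb R$, $$C^{-1}\frac{\nu_1}{\sqrt n}\le\tau_{\rm adap}(k_u,k;\xi)\le C\,\frac{\nu_1}{\sqrt n}.$$ -/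

import Mathlib

open MeasureTheory ProbabilityTheory

namespace LinTest

/-! ### The random-design Gaussian linear model -/

/-- A parameter `θ = (β, Σ, σ)`: signal, design covariance, noise level. -/
structure Param (p : ℕ) where
  beta : Fin p → ℝ
  Sig : Matrix (Fin p) (Fin p) ℝ
  sigma : ℝ

/-- One observation `Zᵢ = (Yᵢ, Xᵢ)`. -/
abbrev Obs (p : ℕ) : Type := ℝ × EuclideanSpace ℝ (Fin p)

/-- The whole data set `(Z₁, …, Zₙ)`. -/
abbrev Data (n p : ℕ) : Type := Fin n → Obs p

/-- The linear functional `v ↦ ∑ⱼ ξⱼ vⱼ`. -/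
def lin {p : ℕ} (ξ β : Fin p → ℝ) : ℝ := ∑ j, ξ j * β j

/-- Law of one observation: `X ∼ N(0, Σ)`, `ε ∼ N(0, σ²)` independent, `Y = Xᵀβ + ε`. -/
noncomputable def obsLaw {p : ℕ} (θ : Param p) : Measure (Obs p) :=
  ((multivariateGaussian (0 : EuclideanSpace ℝ (Fin p)) θ.Sig).prod
    (gaussianReal 0 (Real.toNNReal (θ.sigma ^ 2)))).map
      fun w => ((∑ j, w.1 j * θ.beta j) + w.2, w.1)

/-- Law of `n` i.i.d. observations. -/
noncomputable def dataLaw (n : ℕ) {p : ℕ} (θ : Param p) : Measure (Data n p) :=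
  Measure.pi fun _ => obsLaw θ

/-! ### Parameter spaces -/

/-- `Θ(k)`: at most `k` nonzero coefficients, symmetric `Σ` with all eigenvalues in
`[1/M₁, M₁]`, and `0 < σ ≤ M₂`. -/
def paramSpace (M₁ M₂ : ℝ) (p k : ℕ) : Set (Param p) :=
  {θ | (Function.support θ.beta).ncard ≤ k ∧
    (∃ h : θ.Sig.IsHermitian, ∀ i, 1 / M₁ ≤ h.eigenvalues i ∧ h.eigenvalues i ≤ M₁) ∧
    0 < θ.sigma ∧ θ.sigma ≤ M₂}

/-- Null space `Θ(k; ξ, t₀)`. -/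
def nullSpace (M₁ M₂ : ℝ) {p : ℕ} (k : ℕ) (ξ : Fin p → ℝ) (t₀ : ℝ) : Set (Param p) :=
  {θ | θ ∈ paramSpace M₁ M₂ p k ∧ lin ξ θ.beta = t₀}

/-- Local alternative `Θ_{±τ}(k; ξ, t₀)`. -/
def altSpace (M₁ M₂ : ℝ) {p : ℕ} (k : ℕ) (ξ : Fin p → ℝ) (t₀ τ : ℝ) : Set (Param p) :=
  {θ | θ ∈ paramSpace M₁ M₂ p k ∧ τ ≤ |lin ξ θ.beta - t₀|}

/-! ### Tests and the adaptive separation distance -/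

/-- `Ψ_α(Θ)`: (possibly randomized) tests, i.e. measurable `[0,1]`-valued functions of the data,
with `E_θ ψ ≤ α` for all `θ ∈ Θ`. -/
def levelTests (n : ℕ) {p : ℕ} (α : ℝ) (Θ : Set (Param p)) : Set (Data n p → ℝ) :=
  {ψ | Measurable ψ ∧ (∀ z, ψ z ∈ Set.Icc (0 : ℝ) 1) ∧ ∀ θ ∈ Θ, ∫ z, ψ z ∂(dataLaw n θ) ≤ α}

/-- The adaptive separation distance
`inf {τ > 0 : sup_{ψ ∈ Ψ_α(Θ(kᵤ;ξ,t₀))} inf_{θ ∈ Θ_{±τ}(k;ξ,t₀)} E_θ ψ ≥ 1 - η}`.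
Suprema and infima are taken in the complete lattice of extended reals, so that none of them
takes a default value. -/
noncomputable def tauAdap (M₁ M₂ α η : ℝ) (n : ℕ) {p : ℕ} (ku k : ℕ) (ξ : Fin p → ℝ) (t₀ : ℝ) :
    EReal :=
  ⨅ τ ∈ {τ : ℝ | 0 < τ ∧
    ((1 - η : ℝ) : EReal) ≤
      ⨆ ψ ∈ levelTests n α (nullSpace M₁ M₂ ku ξ t₀),
        ⨅ θ ∈ altSpace M₁ M₂ k ξ t₀ τ, ((∫ z, ψ z ∂(dataLaw n θ) : ℝ) : EReal)}, (τ : EReal)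

/-! ### Quantities of the loading vector -/

/-- `H(t; ξ) = √(∑_{j ≤ ⌈t⌉ ∧ p} ξⱼ²)`, coordinates being numbered from `1`
(for a loading ordered by decreasing magnitude). -/
noncomputable def topNorm {p : ℕ} (t : ℝ) (ξ : Fin p → ℝ) : ℝ :=
  √(∑ j ∈ Finset.univ.filter (fun j : Fin p => (j : ℕ) + 1 ≤ ⌈t⌉₊), ξ j ^ 2)

/-- `∑ⱼ |ξⱼ| exp(-ζ/ξⱼ²) / √(∑ⱼ ξⱼ² exp(-ζ/ξⱼ²))`; coordinates with `ξⱼ = 0` contribute `0` to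
both sums, so these are sums over the support of `ξ`. -/
noncomputable def tiltRatio {p : ℕ} (ξ : Fin p → ℝ) (ζ : ℝ) : ℝ :=
  (∑ j, |ξ j| * Real.exp (-ζ / ξ j ^ 2)) / √(∑ j, ξ j ^ 2 * Real.exp (-ζ / ξ j ^ 2))

/-- The solution `ζ` of `tiltRatio ξ ζ = kᵤ / 2`; it exists and is unique when `ξ ≠ 0` and
`kᵤ ≥ 1`, see `existsUnique_zeta`. -/
noncomputable def zeta {p : ℕ} (ku : ℕ) (ξ : Fin p → ℝ) : ℝ :=
  Classical.epsilon fun ζ : ℝ => tiltRatio ξ ζ = (ku : ℝ) / 2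

/-- `λ = √(ζ₊)`. -/
noncomputable def lam {p : ℕ} (ku : ℕ) (ξ : Fin p → ℝ) : ℝ := √(max (zeta ku ξ) 0)

/-- `ν₁ = λ kᵤ + √(∑ⱼ ξⱼ² exp(-λ²/ξⱼ²))`. -/
noncomputable def nu1 {p : ℕ} (ku : ℕ) (ξ : Fin p → ℝ) : ℝ :=
  lam ku ξ * ku + √(∑ j, ξ j ^ 2 * Real.exp (-(lam ku ξ) ^ 2 / ξ j ^ 2))

/-- `j₁ = max {j ∈ [p] : |ξⱼ| ≥ λ}`, coordinates being numbered from `1`, and `0` if there is no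
such `j`. -/
noncomputable def j1 {p : ℕ} (ku : ℕ) (ξ : Fin p → ℝ) : ℕ :=
  (Finset.univ.filter fun j : Fin p => lam ku ξ ≤ |ξ j|).sup fun j => (j : ℕ) + 1

/-- Two-sided comparison up to the factor `L`. -/
def EquivUpTo (L : ℝ) (a b : EReal) : Prop := a ≤ (L : EReal) * b ∧ b ≤ (L : EReal) * a

/-! ### Well-definedness of `ζ` -/

section zetaFacts

variable {p : ℕ} {ξ : Fin p → ℝ}

theorem den_pos (hξ : ξ ≠ 0) (ζ : ℝ) : 0 < ∑ j, ξ j ^ 2 * Real.exp (-ζ / ξ j ^ 2) := by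
  obtain ⟨j, hj⟩ := Function.ne_iff.mp hξ
  refine Finset.sum_pos' (fun i _ => by positivity) ⟨j, Finset.mem_univ _, ?_⟩
  have : ξ j ≠ 0 := hj
  positivity

theorem num_pos (hξ : ξ ≠ 0) (ζ : ℝ) : 0 < ∑ j, |ξ j| * Real.exp (-ζ / ξ j ^ 2) := by
  obtain ⟨j, hj⟩ := Function.ne_iff.mp hξ
  refine Finset.sum_pos' (fun i _ => by positivity) ⟨j, Finset.mem_univ _, ?_⟩
  have : ξ j ≠ 0 := hj
  positivity

theorem continuous_tiltRatio (hξ : ξ ≠ 0) : Continuous (tiltRatio ξ) := by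
  unfold tiltRatio
  refine Continuous.div (by fun_prop) (by fun_prop) fun ζ => ?_
  exact (Real.sqrt_pos.mpr (den_pos hξ ζ)).ne'

theorem tiltRatio_strictAnti (hξ : ξ ≠ 0) : StrictAnti (tiltRatio ξ) := by
  intro a b hab
  set h := b - a with hh
  have hpos : 0 < h := by linarith
  set w : Fin p → ℝ := fun j => |ξ j| * Real.exp (-a / ξ j ^ 2) with hw
  set r : Fin p → ℝ := fun j => Real.exp (-h / ξ j ^ 2) with hr
  have hw0 : ∀ j, 0 ≤ w j := fun j => by simp only [hw]; positivity
  have hr0 : ∀ j, 0 < r j := fun j => Real.exp_pos _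
  have hw' : ∀ j, |ξ j| * Real.exp (-b / ξ j ^ 2) = w j * r j := fun j => by
    simp only [hw, hr]
    rw [mul_assoc, ← Real.exp_add, ← add_div]
    congr 3; rw [hh]; ring
  have hsq : ∀ j, ξ j ^ 2 * Real.exp (-a / ξ j ^ 2) = |ξ j| * w j := fun j => by
    simp only [hw]; rw [← sq_abs]; ring
  have hsq' : ∀ j, ξ j ^ 2 * Real.exp (-b / ξ j ^ 2) = |ξ j| * (w j * r j) := fun j => by
    rw [← hw', ← sq_abs]; ring
  have hN := num_pos hξ a
  have hN' := num_pos hξ b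
  have hD := den_pos hξ a
  have hD' := den_pos hξ b
  unfold tiltRatio
  simp only [hw'] at hN' ⊢
  simp only [hsq] at hD ⊢
  simp only [hsq'] at hD' ⊢
  change 0 < ∑ j, w j at hN
  change _ < (∑ j, w j) / _
  set N := ∑ j, w j
  set N' := ∑ j, w j * r j
  set D := ∑ j, |ξ j| * w j
  set D' := ∑ j, |ξ j| * (w j * r j)
  have hlt : N' < N := by
    obtain ⟨j, hj⟩ := Function.ne_iff.mp hξ
    have hj' : ξ j ≠ 0 := hj
    refine Finset.sum_lt_sum (fun i _ => ?_) ⟨j, Finset.mem_univ _, ?_⟩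
    · refine mul_le_of_le_one_right (hw0 i) (Real.exp_le_one_iff.mpr ?_)
      exact div_nonpos_of_nonpos_of_nonneg (by linarith) (sq_nonneg _)
    · have : 0 < w j := by simp only [hw]; positivity
      refine mul_lt_of_lt_one_right this (Real.exp_lt_one_iff.mpr ?_)
      exact div_neg_of_neg_of_pos (by linarith) (by positivity)
  have hcheb : D * N' ≤ D' * N := by
    have key : 0 ≤ ∑ i, ∑ j, w i * w j * ((|ξ i| - |ξ j|) * (r i - r j)) := by
      refine Finset.sum_nonneg fun i _ => Finset.sum_nonneg fun j _ => ?_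
      by_cases hi : ξ i = 0
      · simp [hw, hi]
      by_cases hj : ξ j = 0
      · simp [hw, hj]
      refine mul_nonneg (mul_nonneg (hw0 i) (hw0 j)) ?_
      rcases le_total |ξ i| |ξ j| with hle | hle
      · refine mul_nonneg_of_nonpos_of_nonpos (by linarith) (sub_nonpos.mpr ?_)
        refine Real.exp_le_exp.mpr ?_
        rw [neg_div, neg_div, neg_le_neg_iff]
        exact div_le_div_of_nonneg_left hpos.le (by positivity) (sq_le_sq.mpr hle)
      · refine mul_nonneg (by linarith) (sub_nonneg.mpr ?_)
        refine Real.exp_le_exp.mpr ?_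
        rw [neg_div, neg_div, neg_le_neg_iff]
        exact div_le_div_of_nonneg_left hpos.le (by positivity) (sq_le_sq.mpr hle)
    have expand : ∑ i, ∑ j, w i * w j * ((|ξ i| - |ξ j|) * (r i - r j))
        = D' * N - D * N' - (N' * D - N * D') := by
      simp only [N, N', D, D', Finset.sum_mul_sum, ← Finset.sum_sub_distrib]
      refine Finset.sum_congr rfl fun i _ => Finset.sum_congr rfl fun j _ => ?_
      ring
    linarith
  rw [div_lt_div_iff₀ (Real.sqrt_pos.mpr hD') (Real.sqrt_pos.mpr hD)]
  refine lt_of_pow_lt_pow_left₀ 2 (by positivity) ?_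
  rw [mul_pow, mul_pow, Real.sq_sqrt hD.le, Real.sq_sqrt hD'.le]
  calc N' ^ 2 * D = N' * (D * N') := by ring
    _ ≤ N' * (D' * N) := by gcongr
    _ < N * (D' * N) := by
        have : 0 < D' * N := by positivity
        gcongr
    _ = N ^ 2 * D' := by ring

theorem existsUnique_tiltRatio (hξ : ξ ≠ 0) {s : ℝ} (hs : 0 < s) : ∃! ζ, tiltRatio ξ ζ = s := by
  set A := ∑ j, ξ j ^ 2 with hA
  have hle : ∀ j, ξ j ^ 2 ≤ A := fun j =>
    Finset.single_le_sum (f := fun j => ξ j ^ 2) (fun i _ => sq_nonneg _) (Finset.mem_univ j)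
  have hApos : 0 < A := by
    obtain ⟨j, hj⟩ := Function.ne_iff.mp hξ
    have : ξ j ≠ 0 := hj
    exact lt_of_lt_of_le (by positivity) (hle j)
  have hp : (0 : ℝ) < p := by
    obtain ⟨j, _⟩ := Function.ne_iff.mp hξ
    exact_mod_cast j.pos
  have low : ∃ ζ, s ≤ tiltRatio ξ ζ := by
    set L := |Real.log (s ^ 2)|
    refine ⟨-(A * L), ?_⟩
    unfold tiltRatio
    rw [le_div_iff₀ (Real.sqrt_pos.mpr (den_pos hξ _))]
    refine le_of_sq_le_sq ?_ (num_pos hξ _).le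
    rw [mul_pow, Real.sq_sqrt (den_pos hξ _).le, Finset.mul_sum]
    calc ∑ j, s ^ 2 * (ξ j ^ 2 * Real.exp (- -(A * L) / ξ j ^ 2))
        ≤ ∑ j, (|ξ j| * Real.exp (- -(A * L) / ξ j ^ 2)) ^ 2 := by
          refine Finset.sum_le_sum fun j _ => ?_
          by_cases hj : ξ j = 0
          · simp [hj]
          have hj2 : 0 < ξ j ^ 2 := by positivity
          have : s ^ 2 ≤ Real.exp (- -(A * L) / ξ j ^ 2) := by
            rw [← Real.log_le_iff_le_exp (by positivity), neg_neg, le_div_iff₀ hj2]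
            calc Real.log (s ^ 2) * ξ j ^ 2 ≤ L * ξ j ^ 2 := by
                  gcongr; exact le_abs_self _
              _ ≤ L * A := by gcongr; exact hle j
              _ = A * L := by ring
          rw [mul_pow, sq_abs, sq (Real.exp _)]
          calc _ = ξ j ^ 2 * (s ^ 2 * Real.exp (- -(A * L) / ξ j ^ 2)) := by ring
            _ ≤ _ := by gcongr
      _ ≤ _ := Finset.sum_sq_le_sq_sum_of_nonneg fun i _ => by positivity
  have high : ∃ ζ, tiltRatio ξ ζ ≤ s := by
    set L := |Real.log (s / p)|
    refine ⟨2 * A * L, ?_⟩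
    unfold tiltRatio
    have hterm : ∀ j, |ξ j| * Real.exp (-(2 * A * L) / ξ j ^ 2)
        ≤ s / p * √(∑ j, ξ j ^ 2 * Real.exp (-(2 * A * L) / ξ j ^ 2)) := fun j => by
      by_cases hj : ξ j = 0
      · simp only [hj, abs_zero, zero_mul]; positivity
      have hj2 : 0 < ξ j ^ 2 := by positivity
      have h1 : Real.exp (-(A * L) / ξ j ^ 2) ≤ s / p := by
        rw [← Real.le_log_iff_exp_le (by positivity), div_le_iff₀ hj2]
        have : -L ≤ Real.log (s / p) := neg_abs_le _
        have h3 : L * ξ j ^ 2 ≤ L * A := by gcongr; exact hle j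
        nlinarith
      have h2 : |ξ j| * Real.exp (-(A * L) / ξ j ^ 2)
          ≤ √(∑ j, ξ j ^ 2 * Real.exp (-(2 * A * L) / ξ j ^ 2)) := by
        refine Real.le_sqrt_of_sq_le ?_
        have : (|ξ j| * Real.exp (-(A * L) / ξ j ^ 2)) ^ 2
            = ξ j ^ 2 * Real.exp (-(2 * A * L) / ξ j ^ 2) := by
          rw [mul_pow, sq_abs, sq (Real.exp _), ← Real.exp_add]
          congr 2; ring
        rw [this]
        exact Finset.single_le_sum (f := fun j => ξ j ^ 2 * Real.exp (-(2 * A * L) / ξ j ^ 2))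
          (fun i _ => by positivity) (Finset.mem_univ j)
      have h4 : Real.exp (-(2 * A * L) / ξ j ^ 2)
          = Real.exp (-(A * L) / ξ j ^ 2) * Real.exp (-(A * L) / ξ j ^ 2) := by
        rw [← Real.exp_add]; congr 1; ring
      calc _ = Real.exp (-(A * L) / ξ j ^ 2) * (|ξ j| * Real.exp (-(A * L) / ξ j ^ 2)) := by
            rw [h4]; ring
        _ ≤ _ := by gcongr
    rw [div_le_iff₀ (Real.sqrt_pos.mpr (den_pos hξ _))]
    refine (Finset.sum_le_sum fun j _ => hterm j).trans (le_of_eq ?_)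
    rw [Finset.sum_const, Finset.card_univ, Fintype.card_fin, nsmul_eq_mul]
    field_simp
  obtain ⟨a, ha⟩ := low
  obtain ⟨b, hb⟩ := high
  obtain ⟨ζ, hζ⟩ := mem_range_of_exists_le_of_exists_ge (continuous_tiltRatio hξ) ⟨b, hb⟩ ⟨a, ha⟩
  exact ⟨ζ, hζ, fun y hy => (tiltRatio_strictAnti hξ).injective (hy.trans hζ.symm)⟩

/-- The equation defining `ζ` has exactly one solution. -/
theorem existsUnique_zeta {ku : ℕ} (hku : 1 ≤ ku) (hξ : ξ ≠ 0) :
    ∃! ζ, tiltRatio ξ ζ = (ku : ℝ) / 2 :=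
  existsUnique_tiltRatio hξ (by positivity)

theorem zeta_spec {ku : ℕ} (hku : 1 ≤ ku) (hξ : ξ ≠ 0) :
    tiltRatio ξ (zeta ku ξ) = (ku : ℝ) / 2 :=
  Classical.epsilon_spec (existsUnique_zeta hku hξ).exists

end zetaFacts

end LinTest

/-! Write H(t) for `topNorm t ξ`, k for k_u and λ for `lam`. The separation distance is trapped
between c·H(k²)/√n (`tauAdap_ge`) and C·H(k² log p)/√n (`tauAdap_le`). The rest is deterministic: it
compares these two norms with ν₁.

Lower bound. The alternative is one parameter, with identity covariance, noise level M₂ and a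
1-sparse signal whose functional is t₀+τ₀; hence the bound does not depend on the sparsity of the
alternative. It is hidden among null signals obtained by adding a perturbation on a random subset T
of the q ≈ k²/100 largest loadings. Coordinate j enters T with probability ρⱼ = |ξⱼ|/H(q), so ∑ρⱼ² =
1 and the expected size is at most √q ≤ k/10. The perturbation has entries of size at most a
constant over √n, and lowers the functional by exactly τ₀, of order H(q)/√n. The χ² distance is
governed by exp(a|T∩U|) for independent T and U. The overlap has mean ∑ρⱼ² = 1, so its exponential
moment stays bounded (`sum_subsetWeight_inter_le`) and the distance is small for small a;
`integral_le_of_mixture` then bounds the power of every test.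

Upper bound. The test accepts when some k-sparse b has residuals nearly uncorrelated with the design
and its one-step corrected value of ξᵀb is close to t₀. On a high-probability event such a b is
within order k√(log p/n) of β in ℓ¹ norm (`sum_abs_le_of_feasible`). The correction weights depend
on the design only and need to reproduce ξ only up to a sup-norm error a. Reproducing just the first
m ≈ k² log p loadings suffices: each dropped loading is at most H(m)/(k√log p), which multiplied by
the ℓ¹ error has order H(m)/√n. The ultra-sparse condition makes the sampling error of the weights
no larger. The noise term has standard deviation of order H(m)/√n, and Chebyshev's inequality
suffices for it.

Loadings. By definition of ζ the tilted ℓ¹ sum is at most k/2 times the tilted ℓ² norm, with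
equality when λ > 0. This bounds the tilted norm by 2H(k²) (`tiltSq_le`) and λk by a multiple of
√(log p)·H(k²) (`mul_lam_le`). Conversely H(k²) ≤ 2ν₁, and H(k² log p) exceeds H(k²) by at most a
factor 2√(log p), whence r = 1/2. If k² log p is at most a multiple of j₁, all relevant loadings
exceed λ and the logarithms disappear (`topNorm_mul_log_le_nu1`, `nu1_le_topNorm_of_j1`). -/

namespace LinTest

/-! ### Deterministic comparison of ν₁ with the norms of the largest loadings. -/

section Loading

variable {p : ℕ} {ξ : Fin p → ℝ}

/-- Sum of squares of the first `q` coordinates. -/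
noncomputable def topSq (q : ℕ) (ξ : Fin p → ℝ) : ℝ :=
  ∑ j ∈ Finset.univ.filter (fun j : Fin p => (j : ℕ) < q), ξ j ^ 2

/-- Tilted second moment `∑ ξⱼ² exp(-l²/ξⱼ²)`. -/
noncomputable def tiltSq (ξ : Fin p → ℝ) (l : ℝ) : ℝ :=
  ∑ j, ξ j ^ 2 * Real.exp (-l ^ 2 / ξ j ^ 2)

/-- Tilted first moment `∑ |ξⱼ| exp(-l²/ξⱼ²)`. -/
noncomputable def tiltAbs (ξ : Fin p → ℝ) (l : ℝ) : ℝ :=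
  ∑ j, |ξ j| * Real.exp (-l ^ 2 / ξ j ^ 2)

theorem topNorm_eq (t : ℝ) (ξ : Fin p → ℝ) : topNorm t ξ = √(topSq ⌈t⌉₊ ξ) := rfl

theorem topNorm_natCast_sq (k : ℕ) (ξ : Fin p → ℝ) :
    topNorm ((k : ℝ) ^ 2) ξ = √(topSq (k ^ 2) ξ) := by
  rw [topNorm_eq, ← Nat.cast_pow, Nat.ceil_natCast]

theorem topSq_nonneg (q : ℕ) (ξ : Fin p → ℝ) : 0 ≤ topSq q ξ :=
  Finset.sum_nonneg fun _ _ => sq_nonneg _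

theorem topSq_mono {q r : ℕ} (h : q ≤ r) (ξ : Fin p → ℝ) : topSq q ξ ≤ topSq r ξ := by
  refine Finset.sum_le_sum_of_subset_of_nonneg ?_ fun _ _ _ => sq_nonneg _
  intro j hj
  simp only [Finset.mem_filter, Finset.mem_univ, true_and] at hj ⊢
  omega

theorem sq_le_sq_of_antitone (ha : Antitone fun j => |ξ j|) {i j : Fin p} (h : i ≤ j) :
    ξ j ^ 2 ≤ ξ i ^ 2 := sq_le_sq.mpr (ha h)

/-- The first A·q squares split into A consecutive blocks of length q, and by monotonicity the first
block is the largest. Extending the squares by zero to all of ℕ removes boundary cases at p. -/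
theorem topSq_mul_le (ha : Antitone fun j => |ξ j|) (A q : ℕ) :
    topSq (A * q) ξ ≤ A * topSq q ξ := by
  set f : ℕ → ℝ := fun i => if h : i < p then ξ ⟨i, h⟩ ^ 2 else 0 with hf
  have hf0 : ∀ i, 0 ≤ f i := fun i => by
    simp only [hf]; split_ifs <;> positivity
  have hfa : Antitone f := by
    intro a b hab
    by_cases hb : b < p
    · have h1 : a < p := lt_of_le_of_lt hab hb
      simp only [hf, hb, h1, dif_pos]
      exact sq_le_sq_of_antitone ha (Fin.mk_le_mk.mpr hab)
    · simp only [hf, hb, dif_neg, not_false_eq_true]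
      exact hf0 a
  have key : ∀ r, topSq r ξ = ∑ i ∈ Finset.range r, f i := by
    intro r
    have h1 : topSq r ξ = ∑ j : Fin p, (fun i : ℕ => if i < r then f i else 0) j := by
      rw [topSq, Finset.sum_filter]
      refine Finset.sum_congr rfl fun j _ => ?_
      simp [hf]
    rw [h1, Fin.sum_univ_eq_sum_range (fun i => if i < r then f i else 0), ← Finset.sum_filter]
    refine Finset.sum_subset_zero_on_sdiff ?_ ?_ fun _ _ => rfl
    · intro i; simp
    · intro i hi
      simp only [Finset.mem_sdiff, Finset.mem_range, Finset.mem_filter, not_and] at hi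
      have : ¬ i < p := fun h => hi.2 h hi.1
      simp [hf, this]
  induction A with
  | zero => simp [topSq]
  | succ A ih =>
    rw [key] at ih ⊢
    rw [key] at ih ⊢
    rw [Nat.succ_mul, Finset.sum_range_add]
    have : ∑ x ∈ Finset.range q, f (A * q + x) ≤ ∑ x ∈ Finset.range q, f x :=
      Finset.sum_le_sum fun x _ => hfa (by omega)
    push_cast
    linarith

theorem card_filter_val_lt_le (q : ℕ) :
    (Finset.univ.filter (fun j : Fin p => (j : ℕ) < q)).card ≤ q := by
  rw [Fin.card_filter_val_lt]; exact min_le_right _ _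

/-- Each of the first q squares is at least ξⱼ². Coordinates are numbered from 0, so q = j + 1 is
allowed and j may itself be the last one counted. -/
theorem mul_sq_le_topSq (ha : Antitone fun j => |ξ j|) {q : ℕ} {j : Fin p} (hq : q ≤ j + 1) :
    q * ξ j ^ 2 ≤ topSq q ξ := by
  have hcard : (Finset.univ.filter (fun j : Fin p => (j : ℕ) < q)).card = q := by
    rw [Fin.card_filter_val_lt]; have := j.2; omega
  have := Finset.card_nsmul_le_sum (Finset.univ.filter (fun j : Fin p => (j : ℕ) < q))
    (fun i => ξ i ^ 2) (ξ j ^ 2) (fun i hi => by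
      simp only [Finset.mem_filter, Finset.mem_univ, true_and] at hi
      exact sq_le_sq_of_antitone ha (Fin.mk_le_mk.mpr (by omega)))
  rwa [hcard, nsmul_eq_mul] at this

theorem topSq_pos (hξ : ξ ≠ 0) (ha : Antitone fun j => |ξ j|) {q : ℕ} (hq : 1 ≤ q) :
    0 < topSq q ξ := by
  obtain ⟨j, hj⟩ := Function.ne_iff.mp hξ
  have hj' : ξ j ≠ 0 := hj
  have h1 := mul_sq_le_topSq (ξ := ξ) ha (q := 1) (j := j) (by omega)
  have h2 := topSq_mono hq ξ
  have : 0 < ξ j ^ 2 := by positivity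
  push_cast at h1
  linarith

theorem tiltSq_nonneg (ξ : Fin p → ℝ) (l : ℝ) : 0 ≤ tiltSq ξ l :=
  Finset.sum_nonneg fun _ _ => by positivity

/-- With H² the sum of the k² largest squares and s² the tilted one, coordinates below k² contribute
at most H² to s². Every later coordinate has |ξⱼ| ≤ H/k, so these contribute at most (H/k) times the
tilted ℓ¹ sum, hence at most Hs/2. Then s² ≤ H² + Hs/2 forces s ≤ 2H. -/
theorem tiltSq_le (ha : Antitone fun j => |ξ j|) {k : ℕ} (hk : 1 ≤ k) {l : ℝ}
    (h : tiltAbs ξ l ≤ k / 2 * √(tiltSq ξ l)) :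
    √(tiltSq ξ l) ≤ 2 * √(topSq (k ^ 2) ξ) := by
  have hk0 : (0 : ℝ) < k := by exact_mod_cast hk
  set H := √(topSq (k ^ 2) ξ) with hH
  set s := √(tiltSq ξ l) with hs
  have hs2 : s ^ 2 = tiltSq ξ l := Real.sq_sqrt (tiltSq_nonneg _ _)
  have hH2 : H ^ 2 = topSq (k ^ 2) ξ := Real.sq_sqrt (topSq_nonneg _ _)
  have hterm : ∀ j, ξ j ^ 2 * Real.exp (-l ^ 2 / ξ j ^ 2) ≤
      (if (j : ℕ) < k ^ 2 then ξ j ^ 2 else 0) +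
        H / k * (|ξ j| * Real.exp (-l ^ 2 / ξ j ^ 2)) := by
    intro j
    have he : Real.exp (-l ^ 2 / ξ j ^ 2) ≤ 1 :=
      Real.exp_le_one_iff.mpr (div_nonpos_of_nonpos_of_nonneg (by nlinarith) (sq_nonneg _))
    split_ifs with hj
    · have : ξ j ^ 2 * Real.exp (-l ^ 2 / ξ j ^ 2) ≤ ξ j ^ 2 :=
        mul_le_of_le_one_right (sq_nonneg _) he
      have : 0 ≤ H / k * (|ξ j| * Real.exp (-l ^ 2 / ξ j ^ 2)) := by positivity
      linarith
    · have h1 := mul_sq_le_topSq (ξ := ξ) ha (q := k ^ 2) (j := j) (by omega)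
      have h2 : |ξ j| ≤ H / k := by
        rw [le_div_iff₀ hk0, hH]
        refine Real.le_sqrt_of_sq_le ?_
        rw [mul_pow, sq_abs]
        push_cast at h1
        linarith
      have h3 : ξ j ^ 2 * Real.exp (-l ^ 2 / ξ j ^ 2) =
        |ξ j| * (|ξ j| * Real.exp (-l ^ 2 / ξ j ^ 2)) := by rw [← sq_abs]; ring
      rw [h3, zero_add]
      gcongr
  have hsum := Finset.sum_le_sum fun j (_ : j ∈ Finset.univ) => hterm j
  rw [Finset.sum_add_distrib, ← Finset.mul_sum, ← Finset.sum_filter] at hsum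
  change tiltSq ξ l ≤ topSq (k ^ 2) ξ + H / k * tiltAbs ξ l at hsum
  have h4 : H / k * tiltAbs ξ l ≤ H / k * (k / 2 * s) := by gcongr
  have h5 : H / k * (k / 2 * s) = H * s / 2 := by field_simp
  have hH0 : 0 ≤ H := Real.sqrt_nonneg _
  have hs0 : 0 ≤ s := Real.sqrt_nonneg _
  nlinarith

theorem sq_le_exp_one_mul {x l : ℝ} (hl : 0 ≤ l) (h : l ≤ |x|) :
    x ^ 2 ≤ Real.exp 1 * (x ^ 2 * Real.exp (-l ^ 2 / x ^ 2)) := by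
  by_cases hx : x = 0
  · simp [hx]
  have hx2 : 0 < x ^ 2 := by positivity
  have h1 : l ^ 2 ≤ x ^ 2 := by rw [← sq_abs x]; gcongr
  have h2 : 1 ≤ Real.exp 1 * Real.exp (-l ^ 2 / x ^ 2) := by
    rw [← Real.exp_add, Real.one_le_exp_iff, neg_div]
    have : l ^ 2 / x ^ 2 ≤ 1 := by rw [div_le_one hx2]; exact h1
    linarith
  nlinarith

/-- Tilting costs at most a factor e on coordinates of size at least l; each smaller coordinate adds
at most l². -/
theorem topSq_le_tiltSq_add (q : ℕ) {l : ℝ} (hl : 0 ≤ l) :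
    topSq q ξ ≤ Real.exp 1 * tiltSq ξ l + q * l ^ 2 := by
  have hterm : ∀ j ∈ Finset.univ.filter (fun j : Fin p => (j : ℕ) < q), ξ j ^ 2 ≤
      Real.exp 1 * (ξ j ^ 2 * Real.exp (-l ^ 2 / ξ j ^ 2)) + l ^ 2 := by
    intro j _
    rcases le_total l |ξ j| with h | h
    · have := sq_le_exp_one_mul hl h
      nlinarith
    · have : ξ j ^ 2 ≤ l ^ 2 := by rw [← sq_abs]; gcongr
      have : 0 ≤ Real.exp 1 * (ξ j ^ 2 * Real.exp (-l ^ 2 / ξ j ^ 2)) := by positivity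
      linarith
  refine (Finset.sum_le_sum hterm).trans ?_
  rw [Finset.sum_add_distrib, ← Finset.mul_sum, Finset.sum_const, nsmul_eq_mul]
  have h1 : ∑ j ∈ Finset.univ.filter (fun j : Fin p => (j : ℕ) < q),
      ξ j ^ 2 * Real.exp (-l ^ 2 / ξ j ^ 2) ≤ tiltSq ξ l :=
    Finset.sum_le_sum_of_subset_of_nonneg (Finset.filter_subset _ _) fun _ _ _ => by positivity
  have h2 : ((Finset.univ.filter (fun j : Fin p => (j : ℕ) < q)).card : ℝ) ≤ q := by
    exact_mod_cast card_filter_val_lt_le q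
  gcongr

/-- By Cauchy–Schwarz the first q ≈ k²/16 coordinates carry at most half of the tilted ℓ¹ sum ks/2.
The rest must come from at most p terms, each at most xE², where x is the last head loading and E²
its tilt, while s ≥ xE from that single coordinate. Hence 1 ≤ pE, that is l² ≤ 2x² log p, and qx² is
at most the sum of the top squares. -/
theorem mul_lam_le (hξ : ξ ≠ 0) (ha : Antitone fun j => |ξ j|) {k : ℕ} (hk : 8 ≤ k)
    {l : ℝ} (h : tiltAbs ξ l = k / 2 * √(tiltSq ξ l)) :
    l * k ≤ 8 * √(Real.log p) * √(topSq (k ^ 2) ξ) := by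
  have hk0 : (8 : ℝ) ≤ k := by exact_mod_cast hk
  have hp0 : (0 : ℝ) < p := by
    obtain ⟨j, _⟩ := Function.ne_iff.mp hξ
    exact_mod_cast j.pos
  set s := √(tiltSq ξ l) with hs
  have hs2 : s ^ 2 = tiltSq ξ l := Real.sq_sqrt (tiltSq_nonneg _ _)
  have hspos : 0 < s := Real.sqrt_pos.mpr (den_pos hξ (l ^ 2))
  set q := k ^ 2 / 16 with hq
  have hq16 : 16 * q ≤ k ^ 2 := Nat.mul_div_le _ _
  have hq32 : k ^ 2 ≤ 32 * q := by
    have : 64 ≤ k ^ 2 := by nlinarith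
    omega
  have hq1 : 1 ≤ q := by nlinarith
  have hq16' : 16 * (q : ℝ) ≤ (k : ℝ) ^ 2 := by exact_mod_cast hq16
  have hq32' : (k : ℝ) ^ 2 ≤ 32 * q := by exact_mod_cast hq32
  have hq1' : (1 : ℝ) ≤ q := by exact_mod_cast hq1
  set F := Finset.univ.filter (fun j : Fin p => (j : ℕ) < q) with hF
  have hcard : (F.card : ℝ) ≤ q := by exact_mod_cast card_filter_val_lt_le q
  set e : Fin p → ℝ := fun j => Real.exp (-l ^ 2 / ξ j ^ 2) with he
  have he0 : ∀ j, 0 < e j := fun j => Real.exp_pos _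
  have he1 : ∀ j, e j ≤ 1 := fun j =>
    Real.exp_le_one_iff.mpr (div_nonpos_of_nonpos_of_nonneg (by nlinarith) (sq_nonneg _))
  have hhead : ∑ j ∈ F, |ξ j| * e j ≤ k / 4 * s := by
    have h1 : (∑ j ∈ F, |ξ j| * e j) ^ 2 ≤ F.card * ∑ j ∈ F, (|ξ j| * e j) ^ 2 :=
      sq_sum_le_card_mul_sum_sq
    have h2 : ∑ j ∈ F, (|ξ j| * e j) ^ 2 ≤ s ^ 2 := by
      rw [hs2]
      calc ∑ j ∈ F, (|ξ j| * e j) ^ 2 ≤ ∑ j ∈ F, ξ j ^ 2 * e j := by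
            refine Finset.sum_le_sum fun j _ => ?_
            rw [mul_pow, sq_abs, sq (e j)]
            have := mul_le_of_le_one_left (he0 j).le (he1 j)
            gcongr
        _ ≤ _ := Finset.sum_le_sum_of_subset_of_nonneg (Finset.subset_univ _)
            fun j _ _ => by have := he0 j; positivity
    have h3 : (0:ℝ) ≤ ∑ j ∈ F, (|ξ j| * e j) ^ 2 := Finset.sum_nonneg fun _ _ => sq_nonneg _
    refine le_of_sq_le_sq ?_ (by positivity)
    calc _ ≤ F.card * ∑ j ∈ F, (|ξ j| * e j) ^ 2 := h1
      _ ≤ q * s ^ 2 := by gcongr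
      _ ≤ k ^ 2 / 16 * s ^ 2 := by gcongr; linarith
      _ = _ := by ring
  have htail : k / 4 * s ≤ ∑ j ∈ Finset.univ.filter (fun j : Fin p => ¬ (j : ℕ) < q),
      |ξ j| * e j := by
    have h1 := Finset.sum_filter_add_sum_filter_not Finset.univ (fun j : Fin p => (j : ℕ) < q)
      (fun j => |ξ j| * e j)
    have h2 : ∑ j, |ξ j| * e j = k / 2 * s := h
    rw [h2] at h1
    linarith
  have hqp : q ≤ p := by
    by_contra hc
    have : Finset.univ.filter (fun j : Fin p => ¬ (j : ℕ) < q) = ∅ := by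
      ext j; simp; have := j.2; omega
    rw [this, Finset.sum_empty] at htail
    nlinarith
  -- The last head coordinate: it dominates the whole tail, and q of the squares are at least as
  -- large as its own.
  set i : Fin p := ⟨q - 1, by omega⟩ with hi
  set x := |ξ i| with hx
  have hx0 : 0 ≤ x := abs_nonneg _
  have hqx := mul_sq_le_topSq (ξ := ξ) ha (q := q) (j := i) (by simp [hi]; omega)
  rw [← sq_abs, ← hx] at hqx
  set E := Real.exp (-(l ^ 2 / (2 * x ^ 2))) with hE
  have hEpos : 0 < E := Real.exp_pos _
  have hE2 : Real.exp (-l ^ 2 / x ^ 2) = E ^ 2 := by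
    rw [hE, pow_two (Real.exp _), ← Real.exp_add]; congr 1; field_simp; ring
  have hmono : ∀ y z : ℝ, 0 ≤ y → y ≤ z → y * Real.exp (-l ^ 2 / y ^ 2) ≤
      z * Real.exp (-l ^ 2 / z ^ 2) := by
    intro y z hy hyz
    rcases hy.eq_or_lt with rfl | hy
    · simp; positivity
    have : 0 < z := by linarith
    gcongr ?_ * ?_
    refine Real.exp_le_exp.mpr ?_
    rw [neg_div, neg_div, neg_le_neg_iff]
    gcongr
  -- The map y ↦ y·exp(-l²/y²) is increasing, so every tail term is at most its value at x.
  have htail2 : k / 4 * s ≤ p * (x * E ^ 2) := by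
    refine htail.trans ?_
    have : ∀ j ∈ Finset.univ.filter (fun j : Fin p => ¬ (j : ℕ) < q), |ξ j| * e j ≤ x * E ^ 2 := by
      intro j hj
      simp only [Finset.mem_filter, Finset.mem_univ, true_and] at hj
      rw [← hE2]
      have h1 : |ξ j| ≤ x := ha (Fin.mk_le_mk.mpr (by simp; omega))
      have := hmono |ξ j| x (abs_nonneg _) h1
      rwa [sq_abs (ξ j)] at this
    refine (Finset.sum_le_card_nsmul _ _ _ this).trans ?_
    rw [nsmul_eq_mul]
    have : ((Finset.univ.filter (fun j : Fin p => ¬ (j : ℕ) < q)).card : ℝ) ≤ p := by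
      have := Finset.card_filter_le (Finset.univ : Finset (Fin p)) (fun j => ¬ (j : ℕ) < q)
      rw [Finset.card_univ, Fintype.card_fin] at this
      exact_mod_cast this
    gcongr
  have hxpos : 0 < x := by
    rcases hx0.eq_or_lt with h0 | h0
    · rw [← h0] at htail2; nlinarith
    · exact h0
  have hslow : x * E ≤ s := by
    refine Real.le_sqrt_of_sq_le ?_
    have h1 := Finset.single_le_sum (f := fun j => ξ j ^ 2 * e j)
      (fun j _ => by have := he0 j; positivity) (Finset.mem_univ i)
    have h2 : ξ i ^ 2 * e i = (x * E) ^ 2 := by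
      rw [mul_pow, ← hE2, hx, sq_abs]
    rw [← h2]; exact h1
  have hpE : 1 ≤ p * E := by
    have h1 : 1 * (x * E) ≤ p * (x * E ^ 2) := by
      refine le_trans ?_ htail2
      gcongr
      linarith
    have h2 : 0 < x * E := by positivity
    have h3 : p * (x * E ^ 2) = p * E * (x * E) := by ring
    rw [h3] at h1
    exact le_of_mul_le_mul_right h1 h2
  have hlog : l ^ 2 / (2 * x ^ 2) ≤ Real.log p := by
    have h1 := Real.log_le_log one_pos hpE
    rw [Real.log_one, Real.log_mul hp0.ne' hEpos.ne', hE, Real.log_exp] at h1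
    linarith
  have hlog0 : 0 ≤ Real.log p := le_trans (by positivity) hlog
  rw [div_le_iff₀ (by positivity)] at hlog
  have hmon := topSq_mono (q := q) (r := k ^ 2) (by omega) ξ
  rw [mul_assoc, ← Real.sqrt_mul hlog0]
  refine le_of_sq_le_sq ?_ (by positivity)
  rw [mul_pow, mul_pow, Real.sq_sqrt (mul_nonneg hlog0 (topSq_nonneg _ _))]
  calc l ^ 2 * (k : ℝ) ^ 2 ≤ (Real.log p * (2 * x ^ 2)) * (32 * q) := by gcongr
    _ = 64 * Real.log p * (q * x ^ 2) := by ring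
    _ ≤ 64 * Real.log p * topSq (k ^ 2) ξ := by gcongr; linarith
    _ = _ := by ring

theorem lam_nonneg (ku : ℕ) (ξ : Fin p → ℝ) : 0 ≤ lam ku ξ := Real.sqrt_nonneg _

theorem lam_sq (ku : ℕ) (ξ : Fin p → ℝ) : lam ku ξ ^ 2 = max (zeta ku ξ) 0 :=
  Real.sq_sqrt (le_max_right _ _)

theorem tiltRatio_lam (ξ : Fin p → ℝ) (l : ℝ) :
    tiltRatio ξ (l ^ 2) = tiltAbs ξ l / √(tiltSq ξ l) := rfl

theorem sqrt_tiltSq_pos (hξ : ξ ≠ 0) (l : ℝ) : 0 < √(tiltSq ξ l) :=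
  Real.sqrt_pos.mpr (den_pos hξ (l ^ 2))

/-- Truncating ζ at 0 only increases it, and the tilt ratio is decreasing; equality survives when no
truncation occurs, as in `tiltAbs_lam_eq`. -/
theorem tiltAbs_lam_le (hξ : ξ ≠ 0) {ku : ℕ} (hk : 1 ≤ ku) :
    tiltAbs ξ (lam ku ξ) ≤ ku / 2 * √(tiltSq ξ (lam ku ξ)) := by
  rw [← div_le_iff₀ (sqrt_tiltSq_pos hξ _), ← tiltRatio_lam, lam_sq, ← zeta_spec hk hξ]
  exact (tiltRatio_strictAnti hξ).antitone (le_max_left _ _)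

theorem tiltAbs_lam_eq (hξ : ξ ≠ 0) {ku : ℕ} (hk : 1 ≤ ku) (hl : 0 < lam ku ξ) :
    tiltAbs ξ (lam ku ξ) = ku / 2 * √(tiltSq ξ (lam ku ξ)) := by
  have hz : max (zeta ku ξ) 0 = zeta ku ξ := by
    refine max_eq_left (le_of_not_gt fun h => ?_)
    simp [lam, max_eq_right h.le] at hl
  rw [← div_eq_iff (sqrt_tiltSq_pos hξ _).ne', ← tiltRatio_lam, lam_sq, hz, zeta_spec hk hξ]

theorem nu1_eq (ku : ℕ) (ξ : Fin p → ℝ) :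
    nu1 ku ξ = lam ku ξ * ku + √(tiltSq ξ (lam ku ξ)) := rfl

theorem topNorm_le_nu1 (ku : ℕ) (ξ : Fin p → ℝ) :
    topNorm ((ku : ℝ) ^ 2) ξ ≤ 2 * nu1 ku ξ := by
  have h := topSq_le_tiltSq_add (ξ := ξ) (ku ^ 2) (lam_nonneg ku ξ)
  have hl := lam_nonneg ku ξ
  rw [topNorm_natCast_sq, nu1_eq]
  set s := √(tiltSq ξ (lam ku ξ)) with hs
  have hs0 : 0 ≤ s := Real.sqrt_nonneg _
  have hs2 : s ^ 2 = tiltSq ξ (lam ku ξ) := Real.sq_sqrt (tiltSq_nonneg _ _)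
  have he := Real.exp_one_lt_d9
  refine Real.sqrt_le_iff.mpr ⟨by positivity, h.trans ?_⟩
  rw [← hs2]
  push_cast
  have h1 : 0 ≤ lam ku ξ * ku * s := by positivity
  nlinarith [sq_nonneg s, sq_nonneg (lam ku ξ * ku)]

theorem nu1_le_topNorm (hξ : ξ ≠ 0) (ha : Antitone fun j => |ξ j|) {ku : ℕ} (hk : 8 ≤ ku)
    (hp : 1 ≤ Real.log p) :
    nu1 ku ξ ≤ 10 * √(Real.log p) * topNorm ((ku : ℝ) ^ 2) ξ := by
  have h1 := tiltSq_le ha (by omega) (tiltAbs_lam_le hξ (by omega : 1 ≤ ku))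
  rw [topNorm_natCast_sq, nu1_eq]
  have hlog : 1 ≤ √(Real.log p) := Real.one_le_sqrt.mpr hp
  have h2 : lam ku ξ * ku ≤ 8 * √(Real.log p) * √(topSq (ku ^ 2) ξ) := by
    rcases (lam_nonneg ku ξ).eq_or_lt with h | h
    · rw [← h, zero_mul]; positivity
    · exact mul_lam_le hξ ha hk (tiltAbs_lam_eq hξ (by omega) h)
  have h3 : 1 * √(topSq (ku ^ 2) ξ) ≤ √(Real.log p) * √(topSq (ku ^ 2) ξ) := by gcongr
  linarith

theorem topNorm_mul_log_le (ha : Antitone fun j => |ξ j|) (ku : ℕ) (hp : 1 ≤ Real.log p) :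
    topNorm ((ku : ℝ) ^ 2 * Real.log p) ξ ≤
      2 * √(Real.log p) * topNorm ((ku : ℝ) ^ 2) ξ := by
  rw [topNorm_natCast_sq, topNorm_eq]
  set A := ⌈Real.log p⌉₊ with hA
  have h1 : ⌈(ku : ℝ) ^ 2 * Real.log p⌉₊ ≤ A * ku ^ 2 := by
    rw [Nat.ceil_le]; push_cast
    rw [mul_comm]
    gcongr
    exact Nat.le_ceil _
  have h2 : (A : ℝ) ≤ 4 * Real.log p := by
    have := Nat.ceil_lt_add_one (by linarith : 0 ≤ Real.log p)
    linarith
  have h3 := (topSq_mono h1 ξ).trans (topSq_mul_le ha A (ku ^ 2))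
  refine Real.sqrt_le_iff.mpr ⟨by positivity, ?_⟩
  rw [mul_pow, mul_pow, Real.sq_sqrt (topSq_nonneg _ _), Real.sq_sqrt (by linarith)]
  refine h3.trans ?_
  have := topSq_nonneg (ku ^ 2) ξ
  nlinarith

theorem lam_le_abs_of_lt_j1 (ha : Antitone fun j => |ξ j|) {ku : ℕ} {j : Fin p}
    (hj : (j : ℕ) < j1 ku ξ) : lam ku ξ ≤ |ξ j| := by
  obtain ⟨i, hi, hi'⟩ := (Finset.lt_sup_iff).mp hj
  simp only [Finset.mem_filter, Finset.mem_univ, true_and] at hi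
  exact hi.trans (ha (Fin.mk_le_mk.mpr (by omega)))

theorem j1_le (ku : ℕ) (ξ : Fin p → ℝ) : j1 ku ξ ≤ p :=
  Finset.sup_le fun j _ => j.2

/-- The first j₁ loadings all have size at least λ, so tilting shrinks each square by at most the
factor e. -/
theorem topSq_j1_le (ha : Antitone fun j => |ξ j|) (ku : ℕ) :
    topSq (j1 ku ξ) ξ ≤ Real.exp 1 * tiltSq ξ (lam ku ξ) := by
  rw [topSq, tiltSq, Finset.mul_sum]
  refine (Finset.sum_le_sum fun j hj => ?_).trans
    (Finset.sum_le_sum_of_subset_of_nonneg (Finset.filter_subset _ _) fun _ _ _ => by positivity)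
  simp only [Finset.mem_filter, Finset.mem_univ, true_and] at hj
  exact sq_le_exp_one_mul (lam_nonneg _ _) (lam_le_abs_of_lt_j1 ha hj)

theorem topNorm_mul_log_le_nu1 (ha : Antitone fun j => |ξ j|) {ku : ℕ} {Cj : ℝ}
    (h : (ku : ℝ) ^ 2 * Real.log p ≤ Cj * j1 ku ξ) :
    topNorm ((ku : ℝ) ^ 2 * Real.log p) ξ ≤ 2 * √⌈Cj⌉₊ * nu1 ku ξ := by
  rw [topNorm_eq, nu1_eq]
  have h1 : ⌈(ku : ℝ) ^ 2 * Real.log p⌉₊ ≤ ⌈Cj⌉₊ * j1 ku ξ := by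
    rw [Nat.ceil_le]; push_cast
    refine h.trans ?_
    gcongr
    exact Nat.le_ceil _
  have h3 := (topSq_mono h1 ξ).trans (topSq_mul_le ha _ _)
  have h4 := topSq_j1_le ha ku
  have hl := lam_nonneg ku ξ
  set s := √(tiltSq ξ (lam ku ξ)) with hs
  have hs0 : 0 ≤ s := Real.sqrt_nonneg _
  have hs2 : s ^ 2 = tiltSq ξ (lam ku ξ) := Real.sq_sqrt (tiltSq_nonneg _ _)
  have he := Real.exp_one_lt_d9
  refine Real.sqrt_le_iff.mpr ⟨by positivity, h3.trans ?_⟩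
  rw [mul_pow, mul_pow, Real.sq_sqrt (Nat.cast_nonneg _)]
  have h5 : topSq (j1 ku ξ) ξ ≤ 4 * (lam ku ξ * ku + s) ^ 2 := by
    rw [← hs2] at h4
    have h6 : 0 ≤ lam ku ξ * ku := by positivity
    nlinarith [sq_nonneg s, mul_nonneg h6 hs0, sq_nonneg (lam ku ξ * ku)]
  calc _ ≤ (⌈Cj⌉₊ : ℝ) * (4 * (lam ku ξ * ku + s) ^ 2) := by gcongr
    _ = _ := by ring

/-- Each of the first j₁ coordinates adds at least λ/e to the tilted ℓ¹ sum, which is at most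
ku·s/2; so λj₁ is at most a multiple of ku·s. As ku² is at most a multiple of j₁, λku is at most a
multiple of s without logarithms, and `tiltSq_le` concludes. -/
theorem nu1_le_topNorm_of_j1 (hξ : ξ ≠ 0) (ha : Antitone fun j => |ξ j|) {ku : ℕ} (hk : 1 ≤ ku)
    (hp : 1 ≤ Real.log p) {Cj : ℝ} (h : (ku : ℝ) ^ 2 * Real.log p ≤ Cj * j1 ku ξ) :
    nu1 ku ξ ≤ (4 * |Cj| + 2) * topNorm ((ku : ℝ) ^ 2) ξ := by
  have hk0 : (0 : ℝ) < ku := by exact_mod_cast hk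
  have h1 := tiltSq_le ha hk (tiltAbs_lam_le hξ hk)
  have h2 := tiltAbs_lam_le hξ hk
  have hl := lam_nonneg ku ξ
  rw [topNorm_natCast_sq, nu1_eq]
  set l := lam ku ξ with hl'
  set s := √(tiltSq ξ l) with hs
  set H := √(topSq (ku ^ 2) ξ)
  have hs0 : 0 ≤ s := Real.sqrt_nonneg _
  have hN : l * j1 ku ξ ≤ Real.exp 1 * tiltAbs ξ l := by
    have hterm : ∀ j ∈ Finset.univ.filter (fun j : Fin p => (j : ℕ) < j1 ku ξ),
        l ≤ Real.exp 1 * (|ξ j| * Real.exp (-l ^ 2 / ξ j ^ 2)) := by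
      intro j hj
      simp only [Finset.mem_filter, Finset.mem_univ, true_and] at hj
      have h3 := lam_le_abs_of_lt_j1 ha hj
      rw [← hl'] at h3
      by_cases hx : ξ j = 0
      · simp only [hx, abs_zero] at h3 ⊢; linarith
      have hx' : 0 < |ξ j| := abs_pos.mpr hx
      have h4 := sq_le_exp_one_mul hl h3
      rw [← sq_abs] at h4
      have h6 : |ξ j| * |ξ j| ≤
          (Real.exp 1 * (|ξ j| * Real.exp (-l ^ 2 / |ξ j| ^ 2))) * |ξ j| :=
        calc |ξ j| * |ξ j| = |ξ j| ^ 2 := (sq _).symm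
          _ ≤ _ := h4
          _ = _ := by ring
      have h7 := le_of_mul_le_mul_right h6 hx'
      rw [sq_abs] at h7
      linarith
    have h8 := Finset.card_nsmul_le_sum _ _ _ hterm
    have hcard : (Finset.univ.filter (fun j : Fin p => (j : ℕ) < j1 ku ξ)).card = j1 ku ξ := by
      rw [Fin.card_filter_val_lt]; exact min_eq_right (j1_le _ _)
    rw [hcard, nsmul_eq_mul, ← Finset.mul_sum] at h8
    have h9 : ∑ j ∈ Finset.univ.filter (fun j : Fin p => (j : ℕ) < j1 ku ξ),
      |ξ j| * Real.exp (-l ^ 2 / ξ j ^ 2) ≤ tiltAbs ξ l :=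
      Finset.sum_le_sum_of_subset_of_nonneg (Finset.filter_subset _ _) fun _ _ _ => by positivity
    calc _ = (j1 ku ξ : ℝ) * l := mul_comm _ _
      _ ≤ _ := h8
      _ ≤ _ := by gcongr
  have he := Real.exp_one_lt_d9
  have h10 : l * ku * ku ≤ 2 * |Cj| * s * ku := by
    calc l * ku * ku ≤ l * ku * ku * Real.log p := le_mul_of_one_le_right (by positivity) hp
      _ = l * ((ku : ℝ) ^ 2 * Real.log p) := by ring
      _ ≤ l * (Cj * j1 ku ξ) := by gcongr
      _ ≤ l * (|Cj| * j1 ku ξ) := by gcongr; exact le_abs_self _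
      _ = |Cj| * (l * j1 ku ξ) := by ring
      _ ≤ |Cj| * (Real.exp 1 * (ku / 2 * s)) := by
          refine mul_le_mul_of_nonneg_left (hN.trans ?_) (abs_nonneg _)
          gcongr
      _ ≤ |Cj| * (4 * (ku / 2 * s)) := by gcongr; linarith
      _ = _ := by ring
  have h11 := le_of_mul_le_mul_right h10 hk0
  have : 2 * |Cj| * s ≤ 2 * |Cj| * (2 * H) := by gcongr
  nlinarith

end Loading

/-! ### Exponential moments of Gaussian quadratic forms. -/

section Gaussian

theorem lintegral_exp_mul_sq_gaussianReal {v : NNReal} {s : ℝ} (h : 2 * s * v < 1) :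
    ∫⁻ x, ENNReal.ofReal (Real.exp (s * x ^ 2)) ∂(gaussianReal 0 v) =
      ENNReal.ofReal (√(1 - 2 * s * v))⁻¹ := by
  by_cases hv : v = 0
  · subst hv; simp
  have hv0 : (0 : ℝ) < v := by positivity
  rw [gaussianReal_of_var_ne_zero _ hv, lintegral_withDensity_eq_lintegral_mul _
    (measurable_gaussianPDF _ _) (by fun_prop)]
  set b : ℝ := 1 / (2 * v) - s with hb
  have hbpos : 0 < b := by
    rw [hb, sub_pos, lt_div_iff₀ (by positivity)]; linarith
  have h1 : ∀ x : ℝ, (gaussianPDF 0 v * fun x => ENNReal.ofReal (Real.exp (s * x ^ 2))) x =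
      ENNReal.ofReal ((√(2 * Real.pi * v))⁻¹ * Real.exp (-b * x ^ 2)) := by
    intro x
    simp only [Pi.mul_apply, gaussianPDF, gaussianPDFReal]
    rw [← ENNReal.ofReal_mul (by positivity), mul_assoc, ← Real.exp_add]
    congr 3
    rw [hb]; field_simp; ring
  simp_rw [h1]
  rw [← ofReal_integral_eq_lintegral_ofReal ((integrable_exp_neg_mul_sq hbpos).const_mul _)
    (ae_of_all _ fun x => by positivity), integral_const_mul, integral_gaussian,
    ← Real.sqrt_inv, ← Real.sqrt_mul (by positivity), ← Real.sqrt_inv]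
  congr 2
  rw [hb]
  have : (1 : ℝ) - 2 * s * v ≠ 0 := by linarith
  have h2 : (1 : ℝ) / (2 * v) - s = (1 - 2 * s * v) / (2 * v) := by field_simp
  rw [h2]
  field_simp

theorem lintegral_exp_mul_gaussianReal (v : NNReal) (t : ℝ) :
    ∫⁻ x, ENNReal.ofReal (Real.exp (t * x)) ∂(gaussianReal 0 v) =
      ENNReal.ofReal (Real.exp (v * t ^ 2 / 2)) := by
  rw [← ofReal_integral_eq_lintegral_ofReal (integrable_exp_mul_gaussianReal t)
    (ae_of_all _ fun x => by positivity)]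
  have := congrFun (mgf_fun_id_gaussianReal (μ := 0) (v := v)) t
  simp only [mgf] at this
  rw [this]; simp

theorem inv_sqrt_one_sub_le {u : ℝ} (h0 : 0 ≤ u) (h : u ≤ 1 / 4) :
    (√(1 - 2 * u))⁻¹ ≤ Real.exp (2 * u) := by
  have h1 : 1 ≤ √(1 - 2 * u) * Real.exp (2 * u) := by
    refine (one_le_sq_iff₀ (by positivity)).mp ?_
    rw [mul_pow, Real.sq_sqrt (by linarith), ← Real.exp_nat_mul]
    have h2 := Real.add_one_le_exp (((2 : ℕ) : ℝ) * (2 * u))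
    push_cast at h2 ⊢
    nlinarith
  rw [inv_le_iff_one_le_mul₀ (Real.sqrt_pos.mpr (by linarith))]
  linarith

variable {E : Type*} [NormedAddCommGroup E] [InnerProductSpace ℝ E] [FiniteDimensional ℝ E]
  [MeasurableSpace E] [BorelSpace E]

theorem map_inner_stdGaussian (b : E) :
    (stdGaussian E).map (fun x => inner ℝ b x) = gaussianReal 0 (‖b‖ ^ 2).toNNReal := by
  have := IsGaussian.map_eq_gaussianReal (μ := stdGaussian E) (innerSL ℝ b)
  rw [variance_dual_stdGaussian, integral_strongDual_stdGaussian, innerSL_apply_norm] at this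
  simpa using this

theorem map_inner_pair_stdGaussian {b h : E} (hbh : inner ℝ b h = 0) :
    (stdGaussian E).map (fun x => (inner ℝ b x, inner ℝ h x)) =
      (gaussianReal 0 (‖b‖ ^ 2).toNNReal).prod (gaussianReal 0 (‖h‖ ^ 2).toNNReal) := by
  have hG : HasGaussianLaw (fun x => (inner ℝ b x, inner ℝ h x)) (stdGaussian E) :=
    (IsGaussian.hasGaussianLaw_id (μ := stdGaussian E)).map
      ((innerSL ℝ b).prod (innerSL ℝ h))
  have hcov : cov[fun x => inner ℝ b x, fun x => inner ℝ h x; stdGaussian E] = 0 := by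
    rw [← covarianceBilin_apply_eq_cov IsGaussian.memLp_two_id, covarianceBilin_stdGaussian,
      innerSL_apply_apply, hbh]
  have hI := hG.indepFun_of_covariance_eq_zero hcov
  rw [indepFun_iff_map_prod_eq_prod_map_map (by fun_prop) (by fun_prop),
    map_inner_stdGaussian, map_inner_stdGaussian] at hI
  exact hI

/-- Split c into its component along b and an orthogonal part d, whose inner product with the
Gaussian vector is independent of ⟨b, x⟩. Integrating out ⟨d, x⟩ leaves exp(κ⟨b, x⟩²), a χ²
exponential moment; the smallness hypothesis gives κ‖b‖² ≤ 1/4. -/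
theorem lintegral_exp_inner_mul_inner_le {b c : E} (h0 : 0 ≤ inner ℝ b c)
    (h : inner ℝ b c + ‖b‖ ^ 2 * ‖c‖ ^ 2 / 2 ≤ 1 / 4) :
    ∫⁻ x, ENNReal.ofReal (Real.exp (inner ℝ b x * inner ℝ c x)) ∂(stdGaussian E) ≤
      ENNReal.ofReal (Real.exp (2 * inner ℝ b c + ‖b‖ ^ 2 * ‖c‖ ^ 2)) := by
  by_cases hb : b = 0
  · subst hb; simp
  have hb2 : 0 < ‖b‖ ^ 2 := by positivity
  set r : ℝ := inner ℝ b c / ‖b‖ ^ 2 with hr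
  set d : E := c - r • b with hd
  have hbd : inner ℝ b d = 0 := by
    rw [hd, inner_sub_right, inner_smul_right, real_inner_self_eq_norm_sq, hr]
    field_simp; ring
  have hc : c = r • b + d := by rw [hd]; abel
  have hdn : ‖d‖ ^ 2 ≤ ‖c‖ ^ 2 := by
    rw [hc, norm_add_sq_real, inner_smul_left, hbd]
    simp
  have hr0 : 0 ≤ r := by positivity
  set F : ℝ × ℝ → ENNReal := fun w => ENNReal.ofReal (Real.exp (w.1 * (r * w.1 + w.2))) with hF
  have hFm : Measurable F := by fun_prop
  have h1 : ∀ x, ENNReal.ofReal (Real.exp (inner ℝ b x * inner ℝ c x)) =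
      F (inner ℝ b x, inner ℝ d x) := by
    intro x
    simp only [hF]
    rw [hc, inner_add_left, inner_smul_left]; simp
  simp_rw [h1]
  rw [← lintegral_map hFm (g := fun x => (inner ℝ b x, inner ℝ d x)) (by fun_prop),
    map_inner_pair_stdGaussian hbd, lintegral_prod _ hFm.aemeasurable]
  set κ : ℝ := r + ‖d‖ ^ 2 / 2 with hκ
  have h2 : ∀ g : ℝ, ∫⁻ y, F (g, y) ∂(gaussianReal 0 (‖d‖ ^ 2).toNNReal) =
      ENNReal.ofReal (Real.exp (κ * g ^ 2)) := by
    intro g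
    have h3 : ∀ y : ℝ, F (g, y) =
        ENNReal.ofReal (Real.exp (r * g ^ 2)) * ENNReal.ofReal (Real.exp (g * y)) := by
      intro y
      rw [← ENNReal.ofReal_mul (by positivity), ← Real.exp_add]
      simp only [hF]; congr 2; ring
    simp_rw [h3]
    rw [lintegral_const_mul _ (by fun_prop), lintegral_exp_mul_gaussianReal,
      ← ENNReal.ofReal_mul (by positivity), ← Real.exp_add, Real.coe_toNNReal _ (by positivity)]
    congr 2; rw [hκ]; ring
  simp_rw [h2]
  have h4 : κ * ‖b‖ ^ 2 ≤ inner ℝ b c + ‖b‖ ^ 2 * ‖c‖ ^ 2 / 2 := by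
    have : r * ‖b‖ ^ 2 = inner ℝ b c := by rw [hr]; field_simp
    rw [hκ, add_mul, this]
    nlinarith
  have h5 : 0 ≤ κ * ‖b‖ ^ 2 := by positivity
  have hv : (((‖b‖ ^ 2).toNNReal : NNReal) : ℝ) = ‖b‖ ^ 2 := Real.coe_toNNReal _ (by positivity)
  rw [lintegral_exp_mul_sq_gaussianReal (by rw [hv]; nlinarith), hv]
  refine ENNReal.ofReal_le_ofReal ?_
  rw [mul_assoc]
  refine (inv_sqrt_one_sub_le h5 (by linarith)).trans (Real.exp_le_exp.mpr ?_)
  linarith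

end Gaussian

/-! ### Densities on finite product spaces. -/

section Product

theorem lintegral_pi_ofReal_prod {ι Ω : Type*} [Fintype ι] [MeasurableSpace Ω] (μ : Measure Ω)
    [SigmaFinite μ] (f : ι → Ω → ℝ) (hf0 : ∀ i x, 0 ≤ f i x) (hf : ∀ i, Integrable (f i) μ) :
    ∫⁻ z, ENNReal.ofReal (∏ i, f i (z i)) ∂(Measure.pi fun _ : ι => μ) =
      ∏ i, ∫⁻ x, ENNReal.ofReal (f i x) ∂μ := by
  rw [← ofReal_integral_eq_lintegral_ofReal (Integrable.fintype_prod hf)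
    (ae_of_all _ fun z => Finset.prod_nonneg fun i _ => hf0 i _), integral_fintype_prod_eq_prod,
    ENNReal.ofReal_prod_of_nonneg fun i _ => integral_nonneg (hf0 i)]
  refine Finset.prod_congr rfl fun i _ => ?_
  rw [ofReal_integral_eq_lintegral_ofReal (hf i) (ae_of_all _ (hf0 i))]

theorem pi_withDensity_ofReal {ι Ω : Type*} [Fintype ι] [MeasurableSpace Ω] (μ : Measure Ω)
    [SigmaFinite μ] (f : Ω → ℝ) (hf0 : ∀ x, 0 ≤ f x) (hf : Integrable f μ)
    [SigmaFinite (μ.withDensity fun x => ENNReal.ofReal (f x))] :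
    (Measure.pi fun _ : ι => μ.withDensity fun x => ENNReal.ofReal (f x)) =
      (Measure.pi fun _ : ι => μ).withDensity fun z => ENNReal.ofReal (∏ i, f (z i)) := by
  refine Measure.pi_eq fun s hs => ?_
  rw [withDensity_apply _ (MeasurableSet.univ_pi hs),
    ← lintegral_indicator (MeasurableSet.univ_pi hs)]
  have h1 : ∀ z : ι → Ω, (Set.univ.pi s).indicator
      (fun z => ENNReal.ofReal (∏ i, f (z i))) z =
      ENNReal.ofReal (∏ i, (s i).indicator f (z i)) := by
    intro z
    by_cases hz : z ∈ Set.univ.pi s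
    · rw [Set.indicator_of_mem hz]
      congr 1
      refine Finset.prod_congr rfl fun i _ => ?_
      rw [Set.indicator_of_mem (hz i (Set.mem_univ i))]
    · rw [Set.indicator_of_notMem hz]
      simp only [Set.mem_univ_pi, not_forall] at hz
      obtain ⟨i, hi⟩ := hz
      rw [Finset.prod_eq_zero (Finset.mem_univ i) (Set.indicator_of_notMem hi f)]
      simp
  simp_rw [h1]
  rw [lintegral_pi_ofReal_prod μ (fun i => (s i).indicator f)
    (fun i x => Set.indicator_nonneg (fun x _ => hf0 x) x) (fun i => hf.indicator (hs i))]
  refine Finset.prod_congr rfl fun i _ => ?_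
  rw [withDensity_apply _ (hs i), ← lintegral_indicator (hs i)]
  refine lintegral_congr fun x => ?_
  by_cases hx : x ∈ s i <;> simp [hx]

end Product

/-! ### The second-moment bound on the power of a test. -/

section ChiSquare

/-- Second-moment method for a simple alternative against a finite mixture of nulls. -/
theorem integral_le_of_mixture {Ω τ : Type*} [MeasurableSpace Ω] (P : Measure Ω)
    [IsProbabilityMeasure P] (A : Finset τ) (w : τ → ℝ) (hw : ∀ T ∈ A, 0 ≤ w T)
    (hw1 : ∑ T ∈ A, w T = 1) (L : τ → Ω → ℝ) (hLm : ∀ T, Measurable (L T))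
    (hL0 : ∀ T x, 0 ≤ L T x) (hL1 : ∀ T ∈ A, ∫ x, L T x ∂P = 1)
    (hL2 : ∀ T ∈ A, ∀ U ∈ A, Integrable (fun x => L T x * L U x) P)
    {χ : ℝ} (hχ : ∑ T ∈ A, ∑ U ∈ A, w T * w U * (∫ x, L T x * L U x ∂P - 1) ≤ χ)
    {ψ : Ω → ℝ} (hψm : Measurable ψ) (hψ : ∀ x, ψ x ∈ Set.Icc (0 : ℝ) 1) {α : ℝ}
    (hα : ∀ T ∈ A, ∫ x, ψ x ∂(P.withDensity fun x => ENNReal.ofReal (L T x)) ≤ α) :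
    ∫ x, ψ x ∂P ≤ α + √χ := by
  have hLi : ∀ T ∈ A, MemLp (L T) 2 P := fun T hT => by
    rw [memLp_two_iff_integrable_sq (hLm T).aestronglyMeasurable]
    simpa [sq] using hL2 T hT T hT
  have hψb : ∀ᵐ x ∂P, ‖ψ x‖ ≤ 1 := ae_of_all _ fun x => by
    rw [Real.norm_of_nonneg (hψ x).1]; exact (hψ x).2
  have hψL : ∀ T ∈ A, Integrable (fun x => L T x * ψ x) P := fun T hT =>
    ((hLi T hT).integrable one_le_two).mul_bdd hψm.aestronglyMeasurable hψb
  have hα' : ∀ T ∈ A, ∫ x, L T x * ψ x ∂P ≤ α := by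
    intro T hT
    have h1 := hα T hT
    rw [integral_withDensity_eq_integral_toReal_smul (by have := hLm T; fun_prop)
      (ae_of_all _ fun _ => ENNReal.ofReal_lt_top)] at h1
    simpa [ENNReal.toReal_ofReal (hL0 T _)] using h1
  set M : Ω → ℝ := fun x => ∑ T ∈ A, w T * L T x with hM
  have hM2 : MemLp M 2 P := memLp_finsetSum A fun T hT => (hLi T hT).const_mul _
  have hMψ : Integrable (fun x => M x * ψ x) P :=
    (hM2.integrable one_le_two).mul_bdd hψm.aestronglyMeasurable hψb
  have hMα : ∫ x, M x * ψ x ∂P ≤ α := by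
    have h1 : ∫ x, M x * ψ x ∂P = ∑ T ∈ A, w T * ∫ x, L T x * ψ x ∂P := by
      simp only [hM, Finset.sum_mul, mul_assoc]
      rw [integral_finsetSum _ fun T hT => (hψL T hT).const_mul _]
      simp_rw [integral_const_mul]
    rw [h1]
    calc _ ≤ ∑ T ∈ A, w T * α := Finset.sum_le_sum fun T hT =>
          mul_le_mul_of_nonneg_left (hα' T hT) (hw T hT)
      _ = α := by rw [← Finset.sum_mul, hw1, one_mul]
  -- Since 0 ≤ ψ ≤ 1, the gap between E ψ under P and under the mixture is at most E|D| ≤ √(E D²),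
  -- and E D² is the χ² divergence of the mixture from P.
  set D : Ω → ℝ := fun x => 1 - M x with hD
  have hD2 : MemLp D 2 P := (memLp_const 1).sub hM2
  have hDi : Integrable D P := hD2.integrable one_le_two
  have hDψ : Integrable (fun x => D x * ψ x) P := hDi.mul_bdd hψm.aestronglyMeasurable hψb
  have hMint : ∫ x, M x ∂P = 1 := by
    simp only [hM]
    rw [integral_finsetSum _ fun T hT => ((hLi T hT).integrable one_le_two).const_mul _]
    simp_rw [integral_const_mul]
    rw [← hw1]
    exact Finset.sum_congr rfl fun T hT => by rw [hL1 T hT, mul_one]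
  have hMsq : ∫ x, M x ^ 2 ∂P = ∑ T ∈ A, ∑ U ∈ A, w T * w U * ∫ x, L T x * L U x ∂P := by
    have h1 : ∀ x, M x ^ 2 = ∑ T ∈ A, ∑ U ∈ A, w T * w U * (L T x * L U x) := by
      intro x
      rw [sq, hM, Finset.sum_mul_sum]
      exact Finset.sum_congr rfl fun T _ => Finset.sum_congr rfl fun U _ => by ring
    simp_rw [h1]
    rw [integral_finsetSum _ fun T hT => integrable_finsetSum _ fun U hU =>
      (hL2 T hT U hU).const_mul _]
    refine Finset.sum_congr rfl fun T hT => ?_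
    rw [integral_finsetSum _ fun U hU => (hL2 T hT U hU).const_mul _]
    simp_rw [integral_const_mul]
  have hDsq : ∫ x, D x ^ 2 ∂P ≤ χ := by
    have h1 : ∀ x, D x ^ 2 = 1 - 2 * M x + M x ^ 2 := fun x => by simp only [hD]; ring
    simp_rw [h1]
    have hi : Integrable (fun x => 2 * M x) P := (hM2.integrable one_le_two).const_mul _
    have hi' : Integrable (fun x => 1 - 2 * M x) P := (integrable_const _).sub hi
    rw [integral_add hi' hM2.integrable_sq, integral_sub (integrable_const _) hi,
      integral_const_mul, hMint, hMsq]
    refine le_trans (le_of_eq ?_) hχ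
    have h2 : ∑ T ∈ A, ∑ U ∈ A, w T * w U = 1 := by
      rw [← Finset.sum_mul_sum, hw1, one_mul]
    simp_rw [mul_sub, Finset.sum_sub_distrib, mul_one]
    rw [h2]; simp; ring
  have hDabs : ∫ x, D x * ψ x ∂P ≤ √χ := by
    have h1 : ∫ x, D x * ψ x ∂P ≤ ∫ x, |D x| ∂P := by
      refine integral_mono hDψ hDi.abs fun x => ?_
      calc D x * ψ x ≤ |D x| * ψ x := mul_le_mul_of_nonneg_right (le_abs_self _) (hψ x).1
        _ ≤ |D x| * 1 := mul_le_mul_of_nonneg_left (hψ x).2 (abs_nonneg _)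
        _ = |D x| := mul_one _
    refine h1.trans (Real.le_sqrt_of_sq_le (le_trans ?_ hDsq))
    have hDa : MemLp (fun x => |D x|) 2 P := hD2.abs
    -- Nonnegativity of the variance of |D| is the inequality (E|D|)² ≤ E D².
    have h2 := variance_nonneg (fun x => |D x|) P
    rw [variance_eq_sub hDa] at h2
    have h3 : (P[(fun x => |D x|) ^ 2] : ℝ) = ∫ x, D x ^ 2 ∂P :=
      integral_congr_ae (ae_of_all _ fun x => by simp)
    linarith
  have hsplit : ∫ x, ψ x ∂P = ∫ x, M x * ψ x ∂P + ∫ x, D x * ψ x ∂P := by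
    rw [← integral_add hMψ hDψ]
    exact integral_congr_ae (ae_of_all _ fun x => by simp only [hD]; ring)
  linarith

end ChiSquare

/-! ### Likelihood ratios for shifted regression signals. -/

section Shift

variable {p : ℕ}

theorem lintegral_const_add_gaussianReal {v : NNReal} (hv : v ≠ 0) (m : ℝ) {g : ℝ → ENNReal}
    (hg : Measurable g) :
    ∫⁻ e, g (m + e) ∂(gaussianReal 0 v) =
      ∫⁻ e, ENNReal.ofReal (Real.exp ((e * m - m ^ 2 / 2) / v)) * g e ∂(gaussianReal 0 v) := by
  have hv0 : (0 : ℝ) < v := by positivity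
  rw [← lintegral_map hg (by fun_prop : Measurable fun e => m + e), gaussianReal_map_const_add,
    gaussianReal_of_var_ne_zero _ hv, gaussianReal_of_var_ne_zero _ hv,
    lintegral_withDensity_eq_lintegral_mul _ (measurable_gaussianPDF _ _) hg,
    lintegral_withDensity_eq_lintegral_mul _ (measurable_gaussianPDF _ _) (by fun_prop)]
  refine lintegral_congr fun e => ?_
  simp only [Pi.mul_apply]
  rw [← mul_assoc]
  congr 1
  simp only [gaussianPDF, gaussianPDFReal]
  rw [← ENNReal.ofReal_mul (by positivity), mul_assoc _ (Real.exp _) (Real.exp _), ← Real.exp_add]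
  congr 3
  field_simp
  ring

theorem lin_comm (x b : Fin p → ℝ) : lin x b = lin b x :=
  Finset.sum_congr rfl fun _ _ => mul_comm _ _

theorem lin_add (x b c : Fin p → ℝ) : lin x (b + c) = lin x b + lin x c := by
  simp [lin, mul_add, Finset.sum_add_distrib]

theorem lin_sub (x b c : Fin p → ℝ) : lin x (b - c) = lin x b - lin x c := by
  simp [lin, mul_sub, Finset.sum_sub_distrib]

@[fun_prop]
theorem continuous_lin_left (b : Fin p → ℝ) :
    Continuous fun x : EuclideanSpace ℝ (Fin p) => lin x b := by
  unfold lin; fun_prop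

@[fun_prop]
theorem measurable_lin_left {Ω : Type*} [MeasurableSpace Ω] (b : Fin p → ℝ)
    {f : Ω → EuclideanSpace ℝ (Fin p)} (hf : Measurable f) :
    Measurable fun ω => lin (f ω) b :=
  (continuous_lin_left b).measurable.comp hf

instance isProbabilityMeasure_obsLaw (θ : Param p) : IsProbabilityMeasure (obsLaw θ) := by
  unfold obsLaw
  refine Measure.isProbabilityMeasure_map (Measurable.aemeasurable ?_)
  fun_prop

instance isProbabilityMeasure_dataLaw (n : ℕ) (θ : Param p) :
    IsProbabilityMeasure (dataLaw n θ) := by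
  unfold dataLaw; infer_instance

theorem lintegral_obsLaw (θ : Param p) {f : Obs p → ENNReal} (hf : Measurable f) :
    ∫⁻ z, f z ∂(obsLaw θ) = ∫⁻ x, ∫⁻ e, f (lin x θ.beta + e, x)
      ∂(gaussianReal 0 (Real.toNNReal (θ.sigma ^ 2)))
      ∂(multivariateGaussian (0 : EuclideanSpace ℝ (Fin p)) θ.Sig) := by
  have hm : Measurable fun w : EuclideanSpace ℝ (Fin p) × ℝ => (lin w.1 θ.beta + w.2, w.1) := by
    fun_prop
  change ∫⁻ z, f z ∂(Measure.map (fun w : EuclideanSpace ℝ (Fin p) × ℝ =>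
    (lin w.1 θ.beta + w.2, w.1)) _) = _
  rw [lintegral_map hf hm, lintegral_prod (fun w : EuclideanSpace ℝ (Fin p) × ℝ => f (lin w.1 θ.beta + w.2, w.1))
      (hf.comp hm).aemeasurable]

/-- Likelihood ratio of one observation for signals `β + b` and `β`. -/
noncomputable def likRatio (β b : Fin p → ℝ) (σ : ℝ) (z : Obs p) : ℝ :=
  Real.exp (((z.1 - lin z.2 β) * lin z.2 b - lin z.2 b ^ 2 / 2) / σ ^ 2)

@[fun_prop]
theorem measurable_likRatio (β b : Fin p → ℝ) (σ : ℝ) : Measurable (likRatio β b σ) := by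
  unfold likRatio; fun_prop

theorem likRatio_pos (β b : Fin p → ℝ) (σ : ℝ) (z : Obs p) : 0 < likRatio β b σ z :=
  Real.exp_pos _

/-- Given the design, adding b to the signal translates the Gaussian noise by xᵀb, so the density is
the one-dimensional Gaussian shift density. -/
theorem obsLaw_add (β b : Fin p → ℝ) (S : Matrix (Fin p) (Fin p) ℝ) {σ : ℝ} (hσ : 0 < σ) :
    obsLaw ⟨β + b, S, σ⟩ =
      (obsLaw ⟨β, S, σ⟩).withDensity fun z => ENNReal.ofReal (likRatio β b σ z) := by
  refine Measure.ext_of_lintegral _ fun f hf => ?_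
  rw [lintegral_withDensity_eq_lintegral_mul _ (by fun_prop) hf, lintegral_obsLaw _ hf,
    lintegral_obsLaw _ (by fun_prop)]
  refine lintegral_congr fun x => ?_
  have hv : Real.toNNReal (σ ^ 2) ≠ 0 := by
    rw [Ne, Real.toNNReal_eq_zero, not_le]; positivity
  have h1 := lintegral_const_add_gaussianReal hv (lin x b)
    (g := fun e => f (lin x β + e, x)) (by fun_prop)
  simp only [lin_add, Pi.mul_apply]
  simp only [← add_assoc] at h1
  rw [h1]
  refine lintegral_congr fun e => ?_
  simp only [likRatio]
  rw [Real.coe_toNNReal _ (by positivity)]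
  congr 4
  ring

/-- Integrating over the noise cancels the squares of xᵀb and xᵀc and leaves only their cross term,
a quadratic form of the design. -/
theorem lintegral_likRatio_mul (β b c : Fin p → ℝ) (S : Matrix (Fin p) (Fin p) ℝ) {σ : ℝ}
    (hσ : 0 < σ) :
    ∫⁻ z, ENNReal.ofReal (likRatio β b σ z * likRatio β c σ z) ∂(obsLaw ⟨β, S, σ⟩) =
      ∫⁻ x, ENNReal.ofReal (Real.exp (lin x b * lin x c / σ ^ 2))
        ∂(multivariateGaussian (0 : EuclideanSpace ℝ (Fin p)) S) := by
  rw [lintegral_obsLaw _ (by fun_prop)]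
  refine lintegral_congr fun x => ?_
  have hv : ((Real.toNNReal (σ ^ 2) : NNReal) : ℝ) = σ ^ 2 := Real.coe_toNNReal _ (by positivity)
  have h1 : ∀ e : ℝ, ENNReal.ofReal (likRatio β b σ (lin x β + e, x) *
      likRatio β c σ (lin x β + e, x)) =
      ENNReal.ofReal (Real.exp (-(lin x b ^ 2 + lin x c ^ 2) / 2 / σ ^ 2)) *
        ENNReal.ofReal (Real.exp ((lin x b + lin x c) / σ ^ 2 * e)) := by
    intro e
    rw [← ENNReal.ofReal_mul (by positivity), ← Real.exp_add]
    simp only [likRatio]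
    rw [← Real.exp_add]
    congr 2; ring
  simp_rw [h1]
  rw [lintegral_const_mul _ (by fun_prop), lintegral_exp_mul_gaussianReal, hv,
    ← ENNReal.ofReal_mul (by positivity), ← Real.exp_add]
  congr 2
  field_simp
  ring

theorem lintegral_likRatio_mul_le (β b c : Fin p → ℝ) {σ : ℝ} (hσ : 0 < σ)
    (h0 : 0 ≤ lin b c)
    (h : lin b c / σ ^ 2 + lin b b * lin c c / σ ^ 4 / 2 ≤ 1 / 4) :
    ∫⁻ z, ENNReal.ofReal (likRatio β b σ z * likRatio β c σ z) ∂(obsLaw ⟨β, 1, σ⟩) ≤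
      ENNReal.ofReal (Real.exp (2 * (lin b c / σ ^ 2) + lin b b * lin c c / σ ^ 4)) := by
  rw [lintegral_likRatio_mul β b c 1 hσ, multivariateGaussian_zero_one]
  set b' : EuclideanSpace ℝ (Fin p) := σ⁻¹ • WithLp.toLp 2 b with hb'
  set c' : EuclideanSpace ℝ (Fin p) := σ⁻¹ • WithLp.toLp 2 c with hc'
  have hin : ∀ (d : Fin p → ℝ) (x : EuclideanSpace ℝ (Fin p)),
      inner ℝ (σ⁻¹ • (WithLp.toLp 2 d : EuclideanSpace ℝ (Fin p))) x = lin x d / σ := by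
    intro d x
    rw [inner_smul_left, PiLp.inner_apply]
    simp only [lin, RCLike.inner_apply, conj_trivial]
    rw [div_eq_inv_mul]
  have hbc : inner ℝ b' c' = lin b c / σ ^ 2 := by
    rw [hb', hin, lin_comm]
    simp only [hc', lin, PiLp.smul_apply, smul_eq_mul, Finset.sum_div]
    refine Finset.sum_congr rfl fun j _ => ?_
    field_simp
  have hnn : ∀ d : Fin p → ℝ, ‖σ⁻¹ • (WithLp.toLp 2 d : EuclideanSpace ℝ (Fin p))‖ ^ 2 =
      lin d d / σ ^ 2 := by
    intro d
    rw [← real_inner_self_eq_norm_sq, hin, lin_comm]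
    simp only [lin, PiLp.smul_apply, smul_eq_mul, Finset.sum_div]
    refine Finset.sum_congr rfl fun j _ => ?_
    field_simp
  have hprod : ‖b'‖ ^ 2 * ‖c'‖ ^ 2 = lin b b * lin c c / σ ^ 4 := by
    rw [hb', hc', hnn, hnn]; field_simp
  have hfun : ∀ x : EuclideanSpace ℝ (Fin p),
      lin x b * lin x c / σ ^ 2 = inner ℝ b' x * inner ℝ c' x := by
    intro x; rw [hb', hc', hin, hin]; field_simp
  simp_rw [hfun]
  rw [← hprod, ← hbc] at h ⊢
  exact lintegral_exp_inner_mul_inner_le (by rw [hbc]; positivity) h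

/-- Likelihood ratio of the whole data set. -/
noncomputable def dataRatio (n : ℕ) (β b : Fin p → ℝ) (σ : ℝ) (z : Data n p) : ℝ :=
  ∏ i, likRatio β b σ (z i)

theorem integrable_likRatio (β b : Fin p → ℝ) (S : Matrix (Fin p) (Fin p) ℝ) {σ : ℝ}
    (hσ : 0 < σ) : Integrable (likRatio β b σ) (obsLaw ⟨β, S, σ⟩) := by
  refine ⟨by fun_prop, ?_⟩
  rw [hasFiniteIntegral_iff_ofReal (ae_of_all _ fun z => (likRatio_pos β b σ z).le)]
  have : IsProbabilityMeasure
      ((obsLaw ⟨β, S, σ⟩).withDensity fun z => ENNReal.ofReal (likRatio β b σ z)) := by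
    rw [← obsLaw_add β b S hσ]; infer_instance
  have h1 := measure_univ
    (μ := (obsLaw ⟨β, S, σ⟩).withDensity fun z => ENNReal.ofReal (likRatio β b σ z))
  rw [withDensity_apply _ MeasurableSet.univ, Measure.restrict_univ] at h1
  rw [h1]; exact ENNReal.one_lt_top

theorem dataLaw_add (n : ℕ) (β b : Fin p → ℝ) (S : Matrix (Fin p) (Fin p) ℝ) {σ : ℝ}
    (hσ : 0 < σ) :
    dataLaw n ⟨β + b, S, σ⟩ =
      (dataLaw n ⟨β, S, σ⟩).withDensity fun z => ENNReal.ofReal (dataRatio n β b σ z) := by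
  have : IsProbabilityMeasure
      ((obsLaw ⟨β, S, σ⟩).withDensity fun z => ENNReal.ofReal (likRatio β b σ z)) := by
    rw [← obsLaw_add β b S hσ]; infer_instance
  unfold dataLaw dataRatio
  rw [obsLaw_add β b S hσ]
  exact pi_withDensity_ofReal _ _ (fun z => (likRatio_pos β b σ z).le)
    (integrable_likRatio β b S hσ)

@[fun_prop]
theorem measurable_dataRatio (n : ℕ) (β b : Fin p → ℝ) (σ : ℝ) :
    Measurable (dataRatio n β b σ) := by
  unfold dataRatio; fun_prop

theorem dataRatio_nonneg (n : ℕ) (β b : Fin p → ℝ) (σ : ℝ) (z : Data n p) :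
    0 ≤ dataRatio n β b σ z := Finset.prod_nonneg fun _ _ => (likRatio_pos _ _ _ _).le

theorem integral_dataRatio (n : ℕ) (β b : Fin p → ℝ) (S : Matrix (Fin p) (Fin p) ℝ) {σ : ℝ}
    (hσ : 0 < σ) : ∫ z, dataRatio n β b σ z ∂(dataLaw n ⟨β, S, σ⟩) = 1 := by
  rw [integral_eq_lintegral_of_nonneg_ae (ae_of_all _ (dataRatio_nonneg n β b σ)) (by fun_prop)]
  have h1 := measure_univ (μ := dataLaw n ⟨β + b, S, σ⟩)
  rw [dataLaw_add n β b S hσ, withDensity_apply _ MeasurableSet.univ,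
    Measure.restrict_univ] at h1
  rw [h1]; rfl

theorem dataRatio_mul_moment (n : ℕ) (β b c : Fin p → ℝ) {σ : ℝ} (hσ : 0 < σ)
    (h0 : 0 ≤ lin b c)
    (h : lin b c / σ ^ 2 + lin b b * lin c c / σ ^ 4 / 2 ≤ 1 / 4) :
    Integrable (fun z => dataRatio n β b σ z * dataRatio n β c σ z) (dataLaw n ⟨β, 1, σ⟩) ∧
    ∫ z, dataRatio n β b σ z * dataRatio n β c σ z ∂(dataLaw n ⟨β, 1, σ⟩) ≤
      Real.exp (n * (2 * (lin b c / σ ^ 2) + lin b b * lin c c / σ ^ 4)) := by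
  have hle := lintegral_likRatio_mul_le β b c hσ h0 h
  set f : Obs p → ℝ := fun z => likRatio β b σ z * likRatio β c σ z with hf
  have hf0 : ∀ z, 0 ≤ f z := fun z => (mul_pos (likRatio_pos _ _ _ _) (likRatio_pos _ _ _ _)).le
  have hfi : Integrable f (obsLaw ⟨β, 1, σ⟩) := by
    refine ⟨by fun_prop, ?_⟩
    rw [hasFiniteIntegral_iff_ofReal (ae_of_all _ hf0)]
    exact hle.trans_lt ENNReal.ofReal_lt_top
  have hfint : ∫ z, f z ∂(obsLaw ⟨β, 1, σ⟩) ≤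
      Real.exp (2 * (lin b c / σ ^ 2) + lin b b * lin c c / σ ^ 4) := by
    rw [← ofReal_integral_eq_lintegral_ofReal hfi (ae_of_all _ hf0)] at hle
    exact (ENNReal.ofReal_le_ofReal_iff (Real.exp_pos _).le).mp hle
  have hprod : (fun z : Data n p => dataRatio n β b σ z * dataRatio n β c σ z) =
      fun z => ∏ i, f (z i) := by
    ext z; simp only [dataRatio, hf, Finset.prod_mul_distrib]
  rw [hprod]
  refine ⟨Integrable.fintype_prod (f := fun _ => f) fun _ => hfi, ?_⟩
  unfold dataLaw
  rw [integral_fintype_prod_eq_pow, Fintype.card_fin, Real.exp_nat_mul]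
  exact pow_le_pow_left₀ (integral_nonneg hf0) hfint n

end Shift

/-! ### Independent random subsets: overlap, weight and size. -/

section RandomSubset

theorem prod_one_add_le_exp_sum {ι : Type*} (S : Finset ι) (x : ι → ℝ) (hx : ∀ j ∈ S, -1 ≤ x j) :
    ∏ j ∈ S, (1 + x j) ≤ Real.exp (∑ j ∈ S, x j) := by
  rw [Real.exp_sum]
  refine Finset.prod_le_prod (fun j hj => by have := hx j hj; linarith) fun j _ => ?_
  have := Real.add_one_le_exp (x j); linarith

variable {ι : Type*} [DecidableEq ι]

/-- Probability that the random subset of `S` which contains each `j` independently with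
probability `ρ j` equals `T`. -/
noncomputable def subsetWeight (S : Finset ι) (ρ : ι → ℝ) (T : Finset ι) : ℝ :=
  (∏ j ∈ T, ρ j) * ∏ j ∈ S \ T, (1 - ρ j)

theorem sum_subsetWeight_mul_prod (S : Finset ι) (ρ g : ι → ℝ) :
    ∑ T ∈ S.powerset, subsetWeight S ρ T * ∏ j ∈ T, g j = ∏ j ∈ S, (1 - ρ j + ρ j * g j) := by
  have h1 : ∏ j ∈ S, (1 - ρ j + ρ j * g j) = ∏ j ∈ S, (ρ j * g j + (1 - ρ j)) :=
    Finset.prod_congr rfl fun _ _ => add_comm _ _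
  rw [h1, Finset.prod_add]
  refine Finset.sum_congr rfl fun T _ => ?_
  rw [subsetWeight, Finset.prod_mul_distrib]; ring

theorem sum_subsetWeight (S : Finset ι) (ρ : ι → ℝ) :
    ∑ T ∈ S.powerset, subsetWeight S ρ T = 1 := by
  simpa using sum_subsetWeight_mul_prod S ρ fun _ => 1

theorem subsetWeight_nonneg {S : Finset ι} {ρ : ι → ℝ} (h0 : ∀ j, 0 ≤ ρ j) (h1 : ∀ j ∈ S, ρ j ≤ 1)
    (T : Finset ι) : 0 ≤ subsetWeight S ρ T :=
  mul_nonneg (Finset.prod_nonneg fun j _ => h0 j) (Finset.prod_nonneg fun j hj => by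
    have := h1 j (Finset.mem_sdiff.mp hj).1; linarith)

/-- For independent T and U, each j lies in T ∩ U with probability ρⱼ², independently over j. The
moment is therefore ∏(1 + ρⱼ²(eᵃ - 1)), at most exp((eᵃ - 1)∑ρⱼ²). -/
theorem sum_subsetWeight_inter_le {S : Finset ι} {ρ : ι → ℝ} {a : ℝ} (ha : 0 ≤ a) (h2 : ∑ j ∈ S, ρ j ^ 2 ≤ 1) :
    ∑ T ∈ S.powerset, ∑ U ∈ S.powerset,
      subsetWeight S ρ T * subsetWeight S ρ U * Real.exp (a * (T ∩ U).card) ≤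
      Real.exp (Real.exp a - 1) := by
  have hea : 1 ≤ Real.exp a := Real.one_le_exp ha
  have hinner : ∀ T ∈ S.powerset, ∑ U ∈ S.powerset,
      subsetWeight S ρ T * subsetWeight S ρ U * Real.exp (a * (T ∩ U).card) =
      subsetWeight S ρ T * ∏ j ∈ T, (1 + ρ j * (Real.exp a - 1)) := by
    intro T hT
    rw [Finset.mem_powerset] at hT
    have h3 : ∀ U ∈ S.powerset, Real.exp (a * (T ∩ U).card) =
        ∏ j ∈ U, (if j ∈ T then Real.exp a else 1) := by
      intro U _
      rw [Finset.prod_ite, Finset.prod_const_one, mul_one, Finset.prod_const,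
        Finset.filter_mem_eq_inter, Finset.inter_comm, mul_comm, Real.exp_nat_mul]
    calc _ = subsetWeight S ρ T * ∑ U ∈ S.powerset, subsetWeight S ρ U *
          ∏ j ∈ U, (if j ∈ T then Real.exp a else 1) := by
          rw [Finset.mul_sum]
          refine Finset.sum_congr rfl fun U hU => ?_
          rw [h3 U hU]; ring
      _ = _ := by
          rw [sum_subsetWeight_mul_prod]
          congr 1
          rw [← Finset.prod_subset hT (f := fun j => 1 - ρ j + ρ j * if j ∈ T then Real.exp a else 1)]
          · refine Finset.prod_congr rfl fun j hj => ?_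
            rw [if_pos hj]; ring
          · intro j _ hj
            rw [if_neg hj]; ring
  rw [Finset.sum_congr rfl hinner, sum_subsetWeight_mul_prod]
  have h4 : ∏ j ∈ S, (1 - ρ j + ρ j * (1 + ρ j * (Real.exp a - 1))) =
      ∏ j ∈ S, (1 + ρ j ^ 2 * (Real.exp a - 1)) :=
    Finset.prod_congr rfl fun j _ => by ring
  rw [h4]
  refine (prod_one_add_le_exp_sum S _ fun j _ => ?_).trans (Real.exp_le_exp.mpr ?_)
  · have : 0 ≤ ρ j ^ 2 * (Real.exp a - 1) := by
      have : 0 ≤ Real.exp a - 1 := by linarith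
      positivity
    linarith
  · rw [← Finset.sum_mul]
    nlinarith

/-- Subsets with a large `ρ`-sum and few elements. -/
noncomputable def goodSubsets (S : Finset ι) (ρ : ι → ℝ) (k : ℕ) : Finset (Finset ι) :=
  S.powerset.filter fun T => 1 / 10 ≤ ∑ j ∈ T, ρ j ∧ T.card < k

/-- Two Chernoff bounds. The ρ-sum of T has mean ∑ρⱼ² = 1 and drops below 1/10 with probability at
most 17/25; the size of T has mean at most k/10 and reaches k with probability at most 1/20. At
least 1/4 of the mass remains. -/
theorem sum_subsetWeight_goodSubsets_ge {S : Finset ι} {ρ : ι → ℝ} (h0 : ∀ j, 0 ≤ ρ j)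
    (h1 : ∀ j ∈ S, ρ j ≤ 1) (h2 : ∑ j ∈ S, ρ j ^ 2 = 1) {k : ℕ} (hk : 8 ≤ k)
    (hs : ∑ j ∈ S, ρ j ≤ k / 10) :
    1 / 4 ≤ ∑ T ∈ goodSubsets S ρ k, subsetWeight S ρ T := by
  have hk0 : (8 : ℝ) ≤ k := by exact_mod_cast hk
  have hW := fun T => subsetWeight_nonneg h0 h1 T
  set R : Finset ι → ℝ := fun T => ∑ j ∈ T, ρ j
  have hlow : ∑ T ∈ S.powerset, subsetWeight S ρ T * Real.exp (1 / 10 - R T) ≤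
      Real.exp (-(2 / 5)) := by
    have h3 : ∀ T, Real.exp (1 / 10 - R T) =
        Real.exp (1 / 10) * ∏ j ∈ T, Real.exp (-ρ j) := by
      intro T
      rw [← Real.exp_sum, ← Real.exp_add, Finset.sum_neg_distrib]; rfl
    have h4 : ∑ T ∈ S.powerset, subsetWeight S ρ T * Real.exp (1 / 10 - R T) =
        Real.exp (1 / 10) * ∏ j ∈ S, (1 - ρ j + ρ j * Real.exp (-ρ j)) := by
      rw [← sum_subsetWeight_mul_prod, Finset.mul_sum]
      refine Finset.sum_congr rfl fun T _ => ?_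
      rw [h3]; ring
    rw [h4]
    have h5 : ∏ j ∈ S, (1 - ρ j + ρ j * Real.exp (-ρ j)) ≤ ∏ j ∈ S, (1 + -(ρ j ^ 2 / 2)) := by
      refine Finset.prod_le_prod (fun j hj => ?_) fun j hj => ?_
      · have := h1 j hj
        have := mul_nonneg (h0 j) (Real.exp_pos (-ρ j)).le
        linarith
      · have hj0 := h0 j
        have hj1 := h1 j hj
        have h6 : Real.exp (-ρ j) ≤ 1 - ρ j / 2 := by
          have h7 := Real.add_one_le_exp (ρ j)
          have h8 : Real.exp (-ρ j) * Real.exp (ρ j) = 1 := by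
            rw [← Real.exp_add]; simp
          have h9 := Real.exp_pos (-ρ j)
          have h10 : 1 ≤ (1 - ρ j / 2) * (ρ j + 1) := by nlinarith
          nlinarith
        nlinarith
    have h6 := prod_one_add_le_exp_sum S (fun j => -(ρ j ^ 2 / 2)) fun j hj => by
      have := h1 j hj; have := h0 j; nlinarith
    have h7 : ∑ j ∈ S, -(ρ j ^ 2 / 2) = -(1 / 2) := by
      rw [Finset.sum_neg_distrib, ← Finset.sum_div, h2]
    rw [h7] at h6
    calc _ ≤ Real.exp (1 / 10) * Real.exp (-(1 / 2)) := by gcongr; exact h5.trans h6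
      _ = _ := by rw [← Real.exp_add]; norm_num
  have hcardb : ∑ T ∈ S.powerset, subsetWeight S ρ T * Real.exp (T.card - k) ≤
      Real.exp (-4) := by
    have h3 : ∀ T : Finset ι, Real.exp ((T.card : ℝ) - k) =
        Real.exp (-k) * ∏ _j ∈ T, Real.exp 1 := by
      intro T
      rw [Finset.prod_const, ← Real.exp_nat_mul, ← Real.exp_add]
      congr 1; ring
    have h4 : ∑ T ∈ S.powerset, subsetWeight S ρ T * Real.exp (T.card - k) =
        Real.exp (-k) * ∏ j ∈ S, (1 - ρ j + ρ j * Real.exp 1) := by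
      rw [← sum_subsetWeight_mul_prod, Finset.mul_sum]
      refine Finset.sum_congr rfl fun T _ => ?_
      rw [h3]; ring
    have h5 : ∏ j ∈ S, (1 - ρ j + ρ j * Real.exp 1) = ∏ j ∈ S, (1 + ρ j * (Real.exp 1 - 1)) :=
      Finset.prod_congr rfl fun j _ => by ring
    have he := Real.exp_one_lt_d9
    have he' := Real.exp_one_gt_d9
    have h6 := prod_one_add_le_exp_sum S (fun j => ρ j * (Real.exp 1 - 1)) fun j hj => by
      have := mul_nonneg (h0 j) (by linarith : 0 ≤ Real.exp 1 - 1); linarith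
    rw [h4, h5]
    calc _ ≤ Real.exp (-k) * Real.exp (∑ j ∈ S, ρ j * (Real.exp 1 - 1)) := by gcongr
      _ = Real.exp (-k + (∑ j ∈ S, ρ j) * (Real.exp 1 - 1)) := by
          rw [← Real.exp_add, Finset.sum_mul]
      _ ≤ _ := by
          refine Real.exp_le_exp.mpr ?_
          have : (∑ j ∈ S, ρ j) * (Real.exp 1 - 1) ≤ k / 10 * 2 :=
            mul_le_mul hs (by linarith) (by linarith) (by positivity)
          linarith
  -- Pointwise Markov inequality: if T fails one of the two conditions, the matching exponential is
  -- at least 1.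
  have hpt : ∀ T ∈ S.powerset, subsetWeight S ρ T ≤
      (if 1 / 10 ≤ ∑ j ∈ T, ρ j ∧ T.card < k then subsetWeight S ρ T else 0) +
        (subsetWeight S ρ T * Real.exp (1 / 10 - R T) +
          subsetWeight S ρ T * Real.exp (T.card - k)) := by
    intro T _
    have hw := hW T
    have p1 := mul_nonneg hw (Real.exp_pos (1 / 10 - R T)).le
    have p2 := mul_nonneg hw (Real.exp_pos ((T.card : ℝ) - k)).le
    split_ifs with hT
    · linarith
    · rw [not_and_or, not_le, not_lt] at hT
      rcases hT with hT | hT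
      · have : 1 ≤ Real.exp (1 / 10 - R T) := Real.one_le_exp (by simp only [R]; linarith)
        have := le_mul_of_one_le_right hw this
        linarith
      · have h3 : (k : ℝ) ≤ T.card := by exact_mod_cast hT
        have : 1 ≤ Real.exp ((T.card : ℝ) - k) := Real.one_le_exp (by linarith)
        have := le_mul_of_one_le_right hw this
        linarith
  have hsum := Finset.sum_le_sum hpt
  rw [sum_subsetWeight, Finset.sum_add_distrib, Finset.sum_add_distrib,
    ← Finset.sum_filter] at hsum
  have n1 : Real.exp (-(2 / 5)) ≤ 17 / 25 := by
    have h3 := Real.quadratic_le_exp_of_nonneg (x := 2 / 5) (by norm_num)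
    have h8 : Real.exp (-(2 / 5)) * Real.exp (2 / 5) = 1 := by rw [← Real.exp_add]; simp
    nlinarith [Real.exp_pos (-(2 / 5) : ℝ)]
  have n2 : Real.exp (-4) ≤ 1 / 20 := by
    have h3 := Real.exp_one_gt_d9
    have h8 : Real.exp (-4) * Real.exp 1 ^ 4 = 1 := by
      rw [← Real.exp_nat_mul, ← Real.exp_add]; norm_num
    have h9 : (20 : ℝ) ≤ Real.exp 1 ^ 4 :=
      le_trans (by norm_num) (pow_le_pow_left₀ (by norm_num) h3.le 4)
    nlinarith [Real.exp_pos (-4 : ℝ)]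
  change 1 / 4 ≤ ∑ T ∈ S.powerset.filter _, _
  linarith

end RandomSubset

/-! ### The lower bound: sparse nulls surrounding one 1-sparse alternative. -/

section LowerBound

variable {p : ℕ} {ξ : Fin p → ℝ}

theorem mem_paramSpace_one {M₁ M₂ : ℝ} (hM₁ : 1 < M₁) (hM₂ : 0 < M₂) {k : ℕ} {β : Fin p → ℝ}
    (hβ : (Function.support β).ncard ≤ k) : (⟨β, 1, M₂⟩ : Param p) ∈ paramSpace M₁ M₂ p k := by
  refine ⟨hβ, ⟨Matrix.isHermitian_one, fun i => ?_⟩, hM₂, le_rfl⟩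
  have : Nonempty (Fin p) := ⟨i⟩
  have h1 := (Matrix.isHermitian_one (n := Fin p) (α := ℝ)).eigenvalues_mem_spectrum_real i
  rw [spectrum.one_eq, Set.mem_singleton_iff] at h1
  rw [h1]
  exact ⟨by rw [div_le_one (by linarith)]; exact hM₁.le, hM₁.le⟩

theorem sum_top_abs_div_sq (hξ : ξ ≠ 0) (ha : Antitone fun j => |ξ j|) {q : ℕ} (hq : 1 ≤ q) :
    ∑ j ∈ Finset.univ.filter (fun j : Fin p => (j : ℕ) < q), (|ξ j| / √(topSq q ξ)) ^ 2 = 1 := by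
  have := topSq_pos hξ ha hq
  simp_rw [div_pow, sq_abs, Real.sq_sqrt this.le]
  rw [← Finset.sum_div]
  exact div_self this.ne'

/-- Signal supported on `T`, aligned with `-ξ`, scaled so that `lin ξ` takes a value that does not
depend on `T`. -/
noncomputable def prickle (ξ ρ : Fin p → ℝ) (v : ℝ) (T : Finset (Fin p)) (j : Fin p) : ℝ :=
  if j ∈ T then -(1 / (10 * ∑ i ∈ T, ρ i)) * (ξ j / |ξ j|) * v else 0

/-- Alignment with the signs of ξ gives -v·(∑_T |ξⱼ|)/(10·∑_T ρⱼ), and the two sums are proportional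
with ratio H. This exact independence of T puts every perturbed signal on the null hyperplane. -/
theorem lin_prickle {ρ : Fin p → ℝ} {H : ℝ} (hρ : ∀ j, H * ρ j = |ξ j|) (v : ℝ)
    {T : Finset (Fin p)} (hT : 1 / 10 ≤ ∑ i ∈ T, ρ i) :
    lin ξ (prickle ξ ρ v T) = -(v * H / 10) := by
  have hR : ∑ i ∈ T, ρ i ≠ 0 := by linarith
  have h1 : ∀ j, ξ j * prickle ξ ρ v T j =
      if j ∈ T then -(1 / (10 * ∑ i ∈ T, ρ i)) * v * H * ρ j else 0 := by
    intro j
    rw [prickle]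
    split_ifs
    · rw [mul_assoc _ H, hρ]
      by_cases hx : ξ j = 0
      · simp [hx]
      have : |ξ j| ≠ 0 := abs_ne_zero.mpr hx
      have h2 : ξ j * (ξ j / |ξ j|) = |ξ j| := by
        rw [← mul_div_assoc, ← sq, ← sq_abs, sq, mul_div_assoc, div_self this, mul_one]
      calc _ = -(1 / (10 * ∑ i ∈ T, ρ i)) * v * (ξ j * (ξ j / |ξ j|)) := by ring
        _ = _ := by rw [h2]
    · simp
  rw [lin, Finset.sum_congr rfl fun j _ => h1 j, ← Finset.sum_filter, Finset.filter_mem_eq_inter,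
    Finset.univ_inter, ← Finset.mul_sum]
  field_simp

/-- Both signals carry the sign of -ξⱼ on the overlap, so no product is negative; a ρ-sum of at
least 1/10 keeps each entry at most v in size. -/
theorem lin_prickle_prickle {ρ : Fin p → ℝ} (v : ℝ) {T U : Finset (Fin p)}
    (hT : 1 / 10 ≤ ∑ i ∈ T, ρ i) (hU : 1 / 10 ≤ ∑ i ∈ U, ρ i) :
    0 ≤ lin (prickle ξ ρ v T) (prickle ξ ρ v U) ∧
      lin (prickle ξ ρ v T) (prickle ξ ρ v U) ≤ v ^ 2 * (T ∩ U).card := by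
  have hs : ∀ V : Finset (Fin p), 1 / 10 ≤ ∑ i ∈ V, ρ i →
      0 ≤ 1 / (10 * ∑ i ∈ V, ρ i) ∧ 1 / (10 * ∑ i ∈ V, ρ i) ≤ 1 := by
    intro V hV
    refine ⟨by positivity, ?_⟩
    rw [div_le_one (by linarith)]; linarith
  obtain ⟨hT0, hT1⟩ := hs T hT
  obtain ⟨hU0, hU1⟩ := hs U hU
  have h1 : ∀ j, prickle ξ ρ v T j * prickle ξ ρ v U j = if j ∈ T ∩ U then
      (1 / (10 * ∑ i ∈ T, ρ i)) * (1 / (10 * ∑ i ∈ U, ρ i)) * (ξ j / |ξ j|) ^ 2 * v ^ 2 else 0 := by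
    intro j
    simp only [prickle, Finset.mem_inter]
    by_cases h1 : j ∈ T <;> by_cases h2 : j ∈ U <;> simp only [h1, h2] <;> simp; ring
  have hx : ∀ j, (ξ j / |ξ j|) ^ 2 ≤ 1 := by
    intro j
    rw [div_pow, sq_abs]; exact div_self_le_one _
  rw [lin, Finset.sum_congr rfl fun j _ => h1 j, ← Finset.sum_filter, Finset.filter_mem_eq_inter,
    Finset.univ_inter]
  refine ⟨Finset.sum_nonneg fun j _ => by positivity, ?_⟩
  rw [mul_comm (v ^ 2), ← nsmul_eq_mul]
  refine Finset.sum_le_card_nsmul _ _ _ fun j _ => ?_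
  have h2 : (1 / (10 * ∑ i ∈ T, ρ i)) * (1 / (10 * ∑ i ∈ U, ρ i)) * (ξ j / |ξ j|) ^ 2 ≤ 1 :=
    mul_le_one₀ (mul_le_one₀ hT1 hU0 hU1) (sq_nonneg _) (hx j)
  exact mul_le_of_le_one_left (sq_nonneg _) h2

theorem exists_alt_power_le {M₁ M₂ α c₀ t₀ : ℝ} (hM₁ : 1 < M₁) (hM₂ : 0 < M₂) {n ku k q : ℕ}
    (hn : 1 ≤ n) (hku : 10 ≤ ku) (hkn : ku ≤ n) (hk : 1 ≤ k)
    (hξ : ξ ≠ 0) (ha : Antitone fun j => |ξ j|) (hc₀ : 0 < c₀) (hc₀' : c₀ ≤ 1 / 8)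
    (hq : 1 ≤ q) (hqk : 100 * q ≤ ku ^ 2) {ψ : Data n p → ℝ}
    (hψ : ψ ∈ levelTests n α (nullSpace M₁ M₂ ku ξ t₀)) :
    ∃ θ ∈ altSpace M₁ M₂ k ξ t₀ (√c₀ * M₂ / √n * √(topSq q ξ) / 10),
      ∫ z, ψ z ∂(dataLaw n θ) ≤
        α + √(16 * (Real.exp (c₀ ^ 2 * (ku : ℝ) ^ 2 / n + (Real.exp (2 * c₀) - 1)) - 1)) := by
  have hn0 : (0 : ℝ) < n := by exact_mod_cast hn
  have hku0 : (10 : ℝ) ≤ ku := by exact_mod_cast hku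
  have hkn' : (ku : ℝ) ≤ n := by exact_mod_cast hkn
  have hqk' : 100 * (q : ℝ) ≤ (ku : ℝ) ^ 2 := by exact_mod_cast hqk
  set S := Finset.univ.filter (fun j : Fin p => (j : ℕ) < q) with hS
  set H := √(topSq q ξ) with hH
  have hHpos : 0 < H := Real.sqrt_pos.mpr (topSq_pos hξ ha hq)
  -- Inclusion probabilities proportional to the loadings: their unit ℓ² norm on S controls the
  -- overlap, and with 100q ≤ ku² Cauchy–Schwarz keeps the expected size at most ku/10.
  set ρ : Fin p → ℝ := fun j => |ξ j| / H with hρ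
  have hHρ : ∀ j, H * ρ j = |ξ j| := fun j => by simp only [hρ]; field_simp
  have hρ0 : ∀ j, 0 ≤ ρ j := fun j => by positivity
  have hρ2 : ∑ j ∈ S, ρ j ^ 2 = 1 := sum_top_abs_div_sq hξ ha hq
  have hρ1 : ∀ j ∈ S, ρ j ≤ 1 := by
    intro j hj
    have h1 := Finset.single_le_sum (f := fun j => ρ j ^ 2) (fun i _ => sq_nonneg _) hj
    rw [hρ2] at h1
    exact (sq_le_one_iff₀ (hρ0 j)).mp h1
  have hρs : ∑ j ∈ S, ρ j ≤ ku / 10 := by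
    refine le_of_sq_le_sq ?_ (by positivity)
    have h1 : (∑ j ∈ S, ρ j) ^ 2 ≤ S.card * ∑ j ∈ S, ρ j ^ 2 := sq_sum_le_card_mul_sum_sq
    rw [hρ2, mul_one] at h1
    have h2 : (S.card : ℝ) ≤ q := by exact_mod_cast card_filter_val_lt_le q
    linarith
  set A := goodSubsets S ρ ku with hA
  have hAS : A ⊆ S.powerset := Finset.filter_subset _ _
  have hAT : ∀ T ∈ A, 1 / 10 ≤ ∑ j ∈ T, ρ j ∧ T.card < ku := fun T hT =>
    (Finset.mem_filter.mp hT).2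
  set PA := ∑ T ∈ A, subsetWeight S ρ T with hPA
  have hPA4 : 1 / 4 ≤ PA := sum_subsetWeight_goodSubsets_ge hρ0 hρ1 hρ2 (by omega) hρs
  set v := √c₀ * M₂ / √n with hv
  have hv0 : 0 < v := by positivity
  have hv2 : v ^ 2 / M₂ ^ 2 = c₀ / n := by
    rw [hv, div_pow, mul_pow, Real.sq_sqrt hc₀.le, Real.sq_sqrt hn0.le]; field_simp
  set τ₀ := v * H / 10 with hτ₀
  have hτpos : 0 < τ₀ := by positivity
  set b : Finset (Fin p) → Fin p → ℝ := fun T => prickle ξ ρ v T with hb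
  have hp : 0 < p := by
    obtain ⟨j, _⟩ := Function.ne_iff.mp hξ
    exact j.pos
  set j₀ : Fin p := ⟨0, hp⟩
  have hξ0 : ξ j₀ ≠ 0 := by
    intro h0
    apply hξ
    ext j
    have h1 : |ξ j| ≤ |ξ j₀| := ha (Fin.mk_le_mk.mpr (Nat.zero_le _))
    rw [h0, abs_zero] at h1
    exact abs_nonpos_iff.mp h1
  -- The alternative uses only the largest loading, which is nonzero, so sparsity 1 is enough.
  set β₁ : Fin p → ℝ := Pi.single j₀ ((t₀ + τ₀) / ξ j₀) with hβ₁
  have hlin1 : lin ξ β₁ = t₀ + τ₀ := by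
    rw [lin, Finset.sum_eq_single j₀]
    · rw [hβ₁, Pi.single_eq_same]; field_simp
    · intro j _ hj; rw [hβ₁, Pi.single_eq_of_ne hj, mul_zero]
    · simp
  have hsupp1 : Function.support β₁ ⊆ {j₀} := Pi.support_single_subset
  refine ⟨⟨β₁, 1, M₂⟩, ⟨mem_paramSpace_one hM₁ hM₂ ?_, ?_⟩, ?_⟩
  · refine (Set.ncard_le_ncard hsupp1).trans ?_
    rw [Set.ncard_singleton]; exact hk
  · change _ ≤ |lin ξ β₁ - t₀|
    rw [hlin1, add_sub_cancel_left, abs_of_pos hτpos]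
  have hnull : ∀ T ∈ A, (⟨β₁ + b T, 1, M₂⟩ : Param p) ∈ nullSpace M₁ M₂ ku ξ t₀ := by
    intro T hT
    obtain ⟨hT1, hT2⟩ := hAT T hT
    refine ⟨mem_paramSpace_one hM₁ hM₂ ?_, ?_⟩
    · have h1 : Function.support (β₁ + b T) ⊆ ((insert j₀ T : Finset (Fin p)) : Set (Fin p)) := by
        intro j hj
        by_contra hc
        rw [Finset.coe_insert, Set.mem_insert_iff, not_or, Finset.mem_coe] at hc
        apply hj
        have h2 : β₁ j = 0 := by
          by_contra h3; exact hc.1 (hsupp1 h3)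
        have h4 : b T j = 0 := if_neg hc.2
        rw [Pi.add_apply, h2, h4, add_zero]
      refine (Set.ncard_le_ncard h1).trans ?_
      rw [Set.ncard_coe_finset]
      -- The strict inequality on the size of T leaves room for the coordinate j₀.
      exact (Finset.card_insert_le _ _).trans hT2
    · change lin ξ (β₁ + b T) = t₀
      rw [lin_add, hlin1, hb, lin_prickle hHρ v hT1]; ring
  have hmom : ∀ T ∈ A, ∀ U ∈ A,
      Integrable (fun z => dataRatio n β₁ (b T) M₂ z * dataRatio n β₁ (b U) M₂ z)
        (dataLaw n ⟨β₁, 1, M₂⟩) ∧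
      ∫ z, dataRatio n β₁ (b T) M₂ z * dataRatio n β₁ (b U) M₂ z ∂(dataLaw n ⟨β₁, 1, M₂⟩) ≤
        Real.exp (c₀ ^ 2 * (ku : ℝ) ^ 2 / n) * Real.exp (2 * c₀ * (T ∩ U).card) := by
    intro T hT U hU
    obtain ⟨hT1, hT2⟩ := hAT T hT
    obtain ⟨hU1, hU2⟩ := hAT U hU
    obtain ⟨hTU0, hTU⟩ := lin_prickle_prickle (ξ := ξ) v hT1 hU1
    obtain ⟨hTT0, hTT⟩ := lin_prickle_prickle (ξ := ξ) v hT1 hT1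
    obtain ⟨hUU0, hUU⟩ := lin_prickle_prickle (ξ := ξ) v hU1 hU1
    rw [Finset.inter_self] at hTT hUU
    have hTk : (T.card : ℝ) ≤ ku := by exact_mod_cast hT2.le
    have hUk : (U.card : ℝ) ≤ ku := by exact_mod_cast hU2.le
    have hTUk : ((T ∩ U).card : ℝ) ≤ ku :=
      le_trans (by exact_mod_cast Finset.card_le_card Finset.inter_subset_left) hTk
    have hx : lin (b T) (b U) / M₂ ^ 2 ≤ c₀ / n * (T ∩ U).card := by
      rw [← hv2, div_mul_eq_mul_div]; gcongr
    have hy : lin (b T) (b T) * lin (b U) (b U) / M₂ ^ 4 ≤ (c₀ / n * ku) ^ 2 := by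
      rw [← hv2, div_mul_eq_mul_div, div_pow, ← pow_mul, sq]
      gcongr
      · exact hTT.trans (by gcongr)
      · exact hUU.trans (by gcongr)
    have hr : (ku : ℝ) / n ≤ 1 := by rw [div_le_one hn0]; exact hkn'
    have hr0 : 0 ≤ (ku : ℝ) / n := by positivity
    have hcr : c₀ / n * ku ≤ 1 / 8 := by
      calc c₀ / n * ku = c₀ * (ku / n) := by ring
        _ ≤ 1 / 8 * 1 := by gcongr
        _ = _ := by norm_num
    have hcr0 : 0 ≤ c₀ / n * ku := by positivity
    have hx' : c₀ / n * (T ∩ U).card ≤ c₀ / n * ku := by gcongr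
    obtain ⟨h1, h2⟩ := dataRatio_mul_moment n β₁ (b T) (b U) hM₂ hTU0 (by nlinarith)
    refine ⟨h1, h2.trans ?_⟩
    rw [← Real.exp_add]
    refine Real.exp_le_exp.mpr ?_
    calc (n : ℝ) * (2 * (lin (b T) (b U) / M₂ ^ 2) + lin (b T) (b T) * lin (b U) (b U) / M₂ ^ 4)
        ≤ n * (2 * (c₀ / n * (T ∩ U).card) + (c₀ / n * ku) ^ 2) := by gcongr
      _ = _ := by field_simp; ring
  set ε := c₀ ^ 2 * (ku : ℝ) ^ 2 / n with hε
  have hε0 : 0 ≤ ε := by positivity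
  have hW := fun T => subsetWeight_nonneg hρ0 hρ1 T
  -- The reference measure is the alternative and the mixture runs over nulls. The prior is the
  -- random-subset law conditioned on good subsets; conditioning costs 1/PA² ≤ 16.
  refine integral_le_of_mixture (dataLaw n ⟨β₁, 1, M₂⟩) A (fun T => subsetWeight S ρ T / PA)
    (fun T _ => div_nonneg (hW T) (by linarith)) ?_ (fun T => dataRatio n β₁ (b T) M₂)
    (fun T => by fun_prop) (fun T => dataRatio_nonneg _ _ _ _)
    (fun T _ => integral_dataRatio _ _ _ _ hM₂) (fun T hT U hU => (hmom T hT U hU).1) ?_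
    hψ.1 hψ.2.1 fun T hT => ?_
  · rw [← Finset.sum_div, ← hPA, div_self (by linarith)]
  · have hG0 : ∀ T U : Finset (Fin p),
        0 ≤ Real.exp ε * Real.exp (2 * c₀ * (T ∩ U).card) - 1 := by
      intro T U
      rw [← Real.exp_add, sub_nonneg, Real.one_le_exp_iff]; positivity
    have hPA2 : 1 / PA ^ 2 ≤ 16 := by
      rw [div_le_iff₀ (by positivity)]; nlinarith
    calc _ ≤ ∑ T ∈ A, ∑ U ∈ A, 16 * (subsetWeight S ρ T * subsetWeight S ρ U *
            (Real.exp ε * Real.exp (2 * c₀ * (T ∩ U).card) - 1)) := by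
          refine Finset.sum_le_sum fun T hT => Finset.sum_le_sum fun U hU => ?_
          have h1 : subsetWeight S ρ T / PA * (subsetWeight S ρ U / PA) =
              1 / PA ^ 2 * (subsetWeight S ρ T * subsetWeight S ρ U) := by
            field_simp
          have h2 := mul_nonneg (hW T) (hW U)
          rw [h1, ← mul_assoc 16]
          have h3 := (hmom T hT U hU).2
          exact (mul_le_mul_of_nonneg_left (sub_le_sub_right h3 1) (by positivity)).trans
            (mul_le_mul_of_nonneg_right (mul_le_mul_of_nonneg_right hPA2 h2) (hG0 T U))
      -- The overlap exponents are nonnegative, so each term is too and the sum may be enlarged to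
      -- all subsets, where it factorizes.
      _ ≤ ∑ T ∈ S.powerset, ∑ U ∈ S.powerset, 16 * (subsetWeight S ρ T * subsetWeight S ρ U *
            (Real.exp ε * Real.exp (2 * c₀ * (T ∩ U).card) - 1)) := by
          have hterm : ∀ T U : Finset (Fin p), 0 ≤ 16 * (subsetWeight S ρ T * subsetWeight S ρ U *
            (Real.exp ε * Real.exp (2 * c₀ * (T ∩ U).card) - 1)) := fun T U =>
            mul_nonneg (by norm_num) (mul_nonneg (mul_nonneg (hW T) (hW U)) (hG0 T U))
          refine (Finset.sum_le_sum fun T _ => Finset.sum_le_sum_of_subset_of_nonneg hAS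
            fun U _ _ => hterm T U).trans ?_
          exact Finset.sum_le_sum_of_subset_of_nonneg hAS fun T _ _ =>
            Finset.sum_nonneg fun U _ => hterm T U
      _ = 16 * (Real.exp ε * ∑ T ∈ S.powerset, ∑ U ∈ S.powerset, subsetWeight S ρ T *
            subsetWeight S ρ U * Real.exp (2 * c₀ * (T ∩ U).card) - 1) := by
          have h1 : ∑ T ∈ S.powerset, ∑ U ∈ S.powerset,
              subsetWeight S ρ T * subsetWeight S ρ U = 1 := by
            rw [← Finset.sum_mul_sum, sum_subsetWeight, one_mul]
          nth_rw 2 [← h1]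
          simp only [Finset.mul_sum, ← Finset.sum_sub_distrib]
          refine Finset.sum_congr rfl fun T _ => Finset.sum_congr rfl fun U _ => ?_
          ring
      _ ≤ _ := by
          rw [Real.exp_add]
          have := sum_subsetWeight_inter_le (S := S) (ρ := ρ) (a := 2 * c₀) (by positivity) hρ2.le
          gcongr
  · rw [← dataLaw_add n β₁ (b T) 1 hM₂]
    exact hψ.2.2 _ (hnull T hT)

theorem exists_small_chiSq (K : ℝ) {δ : ℝ} (hδ : 0 < δ) : ∃ c₀ : ℝ, 0 < c₀ ∧ c₀ ≤ 1 / 8 ∧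
    √(16 * (Real.exp (c₀ ^ 2 * K + (Real.exp (2 * c₀) - 1)) - 1)) < δ := by
  have hcont : Continuous fun c : ℝ =>
      √(16 * (Real.exp (c ^ 2 * K + (Real.exp (2 * c) - 1)) - 1)) := by fun_prop
  have h0 := hcont.tendsto 0
  simp only [ne_eq, OfNat.ofNat_ne_zero, not_false_eq_true, zero_pow, zero_mul, mul_zero,
    Real.exp_zero, sub_self, add_zero, Real.sqrt_zero] at h0
  have h1 := h0.mono_left (nhdsWithin_le_nhds (s := Set.Ioi 0))
  have h2 := (h1.eventually (gt_mem_nhds hδ)).and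
    (Ioc_mem_nhdsGT (by norm_num : (0 : ℝ) < 1 / 8))
  obtain ⟨c, hc1, hc2⟩ := h2.exists
  exact ⟨c, hc2.1, hc2.2, hc1⟩

/-- Lower bound: no test separates below the norm of the `ku²` largest loadings. -/
theorem tauAdap_ge {M₁ M₂ α η : ℝ} (Cu : ℝ) (hM₁ : 1 < M₁) (hM₂ : 0 < M₂) (hαη : α + η < 1) :
    ∃ (c : ℝ) (N : ℕ), 0 < c ∧ ∀ (n p ku k : ℕ) (ξ : Fin p → ℝ) (t₀ : ℝ),
      N ≤ n → N ≤ ku → 1 ≤ Real.log p → (ku : ℝ) ≤ Cu * (√(n : ℝ) / Real.log p) →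
      1 ≤ k → ξ ≠ 0 → (Antitone fun j => |ξ j|) →
      ((c * topNorm ((ku : ℝ) ^ 2) ξ / √n : ℝ) : EReal) ≤ tauAdap M₁ M₂ α η n ku k ξ t₀ := by
  obtain ⟨c₀, hc0, hc8, hχ⟩ := exists_small_chiSq (Cu ^ 2) (by linarith : 0 < 1 - η - α)
  -- 200 = 10·20: the 10 comes from the separation τ₀, the 20 from passing from q = ku²/100 (integer
  -- division) to ku² coordinates. The threshold on n gives Cu² ≤ n, so ku² ≤ Cu²n implies ku ≤ n.
  refine ⟨√c₀ * M₂ / 200, ⌈Cu ^ 2⌉₊ + 10, by positivity, ?_⟩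
  intro n p ku k ξ t₀ hn hku hlog hkuU hk hξ ha
  have hn0 : (0 : ℝ) < n := by
    have : 0 < n := by omega
    exact_mod_cast this
  have hsn : 0 < √(n : ℝ) := Real.sqrt_pos.mpr hn0
  have hkC : (ku : ℝ) ^ 2 ≤ Cu ^ 2 * n := by
    have h1 : (ku : ℝ) ≤ |Cu| * √n := by
      refine hkuU.trans ?_
      gcongr
      · exact le_abs_self _
      · exact div_le_self hsn.le hlog
    calc (ku : ℝ) ^ 2 ≤ (|Cu| * √n) ^ 2 := by gcongr
      _ = _ := by rw [mul_pow, sq_abs, Real.sq_sqrt hn0.le]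
  have hCn : Cu ^ 2 ≤ n := by
    refine (Nat.le_ceil _).trans ?_
    exact_mod_cast (by omega : ⌈Cu ^ 2⌉₊ ≤ n)
  have hkn : ku ≤ n := by
    have h1 : (ku : ℝ) ≤ n := by
      refine le_of_sq_le_sq ?_ hn0.le
      nlinarith
    exact_mod_cast h1
  set q := ku ^ 2 / 100 with hq
  have hk100 : 100 ≤ ku ^ 2 := by nlinarith
  have hq1 : 1 ≤ q := by omega
  have hqk : 100 * q ≤ ku ^ 2 := Nat.mul_div_le _ _
  have hkq : ku ^ 2 ≤ 200 * q := by omega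
  set τ₀ := √c₀ * M₂ / √n * √(topSq q ξ) / 10 with hτ
  have hcmp : √c₀ * M₂ / 200 * topNorm ((ku : ℝ) ^ 2) ξ / √n ≤ τ₀ := by
    have h1 : topNorm ((ku : ℝ) ^ 2) ξ ≤ 20 * √(topSq q ξ) := by
      rw [topNorm_natCast_sq]
      refine Real.sqrt_le_iff.mpr ⟨by positivity, ?_⟩
      have := (topSq_mono hkq ξ).trans (topSq_mul_le ha 200 q)
      rw [mul_pow, Real.sq_sqrt (topSq_nonneg _ _)]
      have := topSq_nonneg q ξ
      push_cast at *
      linarith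
    calc _ ≤ √c₀ * M₂ / 200 * (20 * √(topSq q ξ)) / √n := by gcongr
      _ = _ := by rw [hτ]; ring
  refine le_trans (EReal.coe_le_coe_iff.mpr hcmp) ?_
  refine le_iInf₂ fun τ hτm => EReal.coe_le_coe_iff.mpr (le_of_not_gt fun hlt => ?_)
  refine absurd hτm.2 (not_le.mpr ?_)
  have hbound : α + √(16 * (Real.exp (c₀ ^ 2 * (ku : ℝ) ^ 2 / n + (Real.exp (2 * c₀) - 1)) - 1)) <
      1 - η := by
    have h1 : √(16 * (Real.exp (c₀ ^ 2 * (ku : ℝ) ^ 2 / n + (Real.exp (2 * c₀) - 1)) - 1)) ≤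
        √(16 * (Real.exp (c₀ ^ 2 * Cu ^ 2 + (Real.exp (2 * c₀) - 1)) - 1)) := by
      gcongr
      rw [div_le_iff₀ hn0, mul_assoc]
      gcongr
    linarith
  refine lt_of_le_of_lt ?_ (EReal.coe_lt_coe_iff.mpr hbound)
  refine iSup₂_le fun ψ hψ => ?_
  obtain ⟨θ, hθ, hle⟩ := exists_alt_power_le hM₁ hM₂ (by omega : 1 ≤ n) (by omega) hkn hk hξ ha
    hc0 hc8 hq1 hqk hψ
  refine iInf₂_le_of_le θ ⟨hθ.1, hlt.le.trans hθ.2⟩ ?_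
  exact EReal.coe_le_coe_iff.mpr hle

end LowerBound

/-! ### Concentration of empirical second moments of Gaussian variables. -/

section ChiSquareTail

/-- Centring the χ² moment removes the linear term of -½ log(1 - 2y), leaving a quadratic bound for
y of either sign, as two-sided tails require. -/
theorem inv_sqrt_mul_exp_le {y : ℝ} (hy : |y| ≤ 1 / 4) :
    (√(1 - 2 * y))⁻¹ * Real.exp (-y) ≤ Real.exp (2 * y ^ 2) := by
  obtain ⟨h1, h2⟩ := abs_le.mp hy
  have hpos : 0 < 1 - 2 * y := by linarith
  have key : 1 ≤ (1 - 2 * y) * Real.exp (2 * y + 4 * y ^ 2) := by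
    rcases le_total y 0 with h | h
    · have h3 := Real.add_one_le_exp (2 * y + 4 * y ^ 2)
      have h4 : 1 ≤ (1 - 2 * y) * (2 * y + 4 * y ^ 2 + 1) := by
        have : 0 ≤ -y * y ^ 2 := mul_nonneg (by linarith) (sq_nonneg _)
        nlinarith
      nlinarith
    · have h3 := Real.quadratic_le_exp_of_nonneg (x := 2 * y + 4 * y ^ 2) (by positivity)
      have h4 : 1 ≤ (1 - 2 * y) * (1 + (2 * y + 4 * y ^ 2) + (2 * y + 4 * y ^ 2) ^ 2 / 2) := by
        have h5 : (1 - 2 * y) * (1 + (2 * y + 4 * y ^ 2) + (2 * y + 4 * y ^ 2) ^ 2 / 2) =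
          1 + 2 * y ^ 2 * (1 - 2 * y - 4 * y ^ 2 - 8 * y ^ 3) := by ring
        have h6 : 0 ≤ 1 - 2 * y - 4 * y ^ 2 - 8 * y ^ 3 := by
          have : y ^ 2 ≤ 1 / 16 := by nlinarith
          have : y ^ 3 ≤ 1 / 64 := by nlinarith
          linarith
        rw [h5]
        have := mul_nonneg (by positivity : 0 ≤ 2 * y ^ 2) h6
        linarith
      nlinarith
  have h3 : 1 ≤ √(1 - 2 * y) * Real.exp (y + 2 * y ^ 2) := by
    refine (one_le_sq_iff₀ (by positivity)).mp ?_
    rw [mul_pow, Real.sq_sqrt hpos.le, ← Real.exp_nat_mul]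
    have h4 : ((2 : ℕ) : ℝ) * (y + 2 * y ^ 2) = 2 * y + 4 * y ^ 2 := by push_cast; ring
    rw [h4]; exact key
  have hs := Real.sqrt_pos.mpr hpos
  have h4 : Real.exp (-y) ≤ √(1 - 2 * y) * Real.exp (2 * y ^ 2) := by
    calc Real.exp (-y) = 1 * Real.exp (-y) := (one_mul _).symm
      _ ≤ √(1 - 2 * y) * Real.exp (y + 2 * y ^ 2) * Real.exp (-y) := by gcongr
      _ = √(1 - 2 * y) * Real.exp (2 * y ^ 2) := by
        rw [mul_assoc, ← Real.exp_add]; congr 2; ring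
  rw [inv_mul_le_iff₀ hs]
  exact h4

variable {Ω : Type*} [MeasurableSpace Ω] {μ : Measure Ω}

theorem exp_centered_sq_moment {G : Ω → ℝ} (hGm : Measurable G) {v : NNReal}
    (hG : μ.map G = gaussianReal 0 v) {s : ℝ} (hs : |s * v| ≤ 1 / 4) :
    Integrable (fun ω => Real.exp (s * (G ω ^ 2 - v))) μ ∧
      ∫ ω, Real.exp (s * (G ω ^ 2 - v)) ∂μ ≤ Real.exp (2 * (s * v) ^ 2) := by
  have hsv := abs_le.mp hs
  have hle : ∫⁻ ω, ENNReal.ofReal (Real.exp (s * (G ω ^ 2 - v))) ∂μ ≤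
      ENNReal.ofReal (Real.exp (2 * (s * v) ^ 2)) := by
    have h1 : ∀ ω, ENNReal.ofReal (Real.exp (s * (G ω ^ 2 - v))) =
        ENNReal.ofReal (Real.exp (-(s * v))) * ENNReal.ofReal (Real.exp (s * G ω ^ 2)) := by
      intro ω
      rw [← ENNReal.ofReal_mul (by positivity), ← Real.exp_add]
      congr 2; ring
    simp_rw [h1]
    rw [lintegral_const_mul _ (by fun_prop),
      ← lintegral_map (f := fun x => ENNReal.ofReal (Real.exp (s * x ^ 2))) (by fun_prop) hGm, hG,
      lintegral_exp_mul_sq_gaussianReal (by linarith), ← ENNReal.ofReal_mul (by positivity)]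
    refine ENNReal.ofReal_le_ofReal ?_
    rw [mul_comm, mul_assoc 2]
    exact inv_sqrt_mul_exp_le hs
  have hi : Integrable (fun ω => Real.exp (s * (G ω ^ 2 - v))) μ := by
    refine ⟨by fun_prop, ?_⟩
    rw [hasFiniteIntegral_iff_ofReal (ae_of_all _ fun _ => (Real.exp_pos _).le)]
    exact hle.trans_lt ENNReal.ofReal_lt_top
  refine ⟨hi, ?_⟩
  rw [← ofReal_integral_eq_lintegral_ofReal hi (ae_of_all _ fun _ => (Real.exp_pos _).le)] at hle
  exact (ENNReal.ofReal_le_ofReal_iff (Real.exp_pos _).le).mp hle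

variable [IsProbabilityMeasure μ]

theorem chiSq_mgf_le {G : Ω → ℝ} (hGm : Measurable G) {v : NNReal}
    (hG : μ.map G = gaussianReal 0 v) {s : ℝ} (hs : |s * v| ≤ 1 / 4) (n : ℕ) :
    Integrable (fun z : Fin n → Ω => Real.exp (s * ∑ i, (G (z i) ^ 2 - v)))
        (Measure.pi fun _ : Fin n => μ) ∧
      mgf (fun z : Fin n → Ω => ∑ i, (G (z i) ^ 2 - v)) (Measure.pi fun _ : Fin n => μ) s ≤
        Real.exp (n * (2 * (s * v) ^ 2)) := by
  obtain ⟨hi, hle⟩ := exp_centered_sq_moment hGm hG hs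
  have h1 : ∀ z : Fin n → Ω, Real.exp (s * ∑ i, (G (z i) ^ 2 - v)) =
      ∏ i, Real.exp (s * (G (z i) ^ 2 - v)) := by
    intro z; rw [Finset.mul_sum, Real.exp_sum]
  simp only [mgf]
  simp_rw [h1]
  refine ⟨Integrable.fintype_prod (f := fun _ ω => Real.exp (s * (G ω ^ 2 - v))) fun _ => hi, ?_⟩
  rw [integral_fintype_prod_eq_pow (fun ω => Real.exp (s * (G ω ^ 2 - v))), Fintype.card_fin,
    Real.exp_nat_mul]
  exact pow_le_pow_left₀ (integral_nonneg fun _ => (Real.exp_pos _).le) hle n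

theorem chiSq_tail {G : Ω → ℝ} (hGm : Measurable G) {v : NNReal}
    (hG : μ.map G = gaussianReal 0 v) {V t : ℝ} (hV : 0 < V) (hvV : v ≤ V) (ht0 : 0 ≤ t)
    (ht1 : t ≤ 1) (n : ℕ) :
    (Measure.pi fun _ : Fin n => μ).real {z | t * n * V < |∑ i, G (z i) ^ 2 - n * v|} ≤
      2 * Real.exp (-(n * t ^ 2 / 8)) := by
  have hv0 : (0 : ℝ) ≤ v := v.2
  set X : (Fin n → Ω) → ℝ := fun z => ∑ i, (G (z i) ^ 2 - v) with hX
  have hXeq : ∀ z : Fin n → Ω, ∑ i, G (z i) ^ 2 - n * v = X z := by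
    intro z; simp [hX, Finset.sum_sub_distrib]
  -- This Chernoff parameter gives the exponent -nt²/4 + nt²/8; t ≤ 1 keeps |sv| ≤ 1/4.
  set s := t / (4 * V) with hs
  have hs0 : 0 ≤ s := by positivity
  have hsv : s * v ≤ t / 4 := by
    calc s * v ≤ s * V := by gcongr
      _ = t / 4 := by rw [hs]; field_simp
  have hsv0 : 0 ≤ s * v := by positivity
  have hval : -s * (t * n * V) + n * (2 * (s * v) ^ 2) ≤ -(n * t ^ 2 / 8) := by
    have h1 : s * (t * n * V) = n * t ^ 2 / 4 := by rw [hs]; field_simp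
    have h2 : (s * v) ^ 2 ≤ (t / 4) ^ 2 := by gcongr
    have h3 : (n : ℝ) * (2 * (s * v) ^ 2) ≤ n * (2 * (t / 4) ^ 2) := by gcongr
    nlinarith
  obtain ⟨hi1, hm1⟩ := chiSq_mgf_le hGm hG (s := s)
    (by rw [abs_of_nonneg hsv0]; linarith) n
  obtain ⟨hi2, hm2⟩ := chiSq_mgf_le hGm hG (s := -s)
    (by rw [neg_mul, abs_neg, abs_of_nonneg hsv0]; linarith) n
  have hup := measure_ge_le_exp_mul_mgf (X := X) (t * n * V) hs0 hi1
  have hlow := measure_le_le_exp_mul_mgf (X := X) (-(t * n * V)) (by linarith : -s ≤ 0) hi2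
  have hup' : (Measure.pi fun _ : Fin n => μ).real {z | t * n * V ≤ X z} ≤
      Real.exp (-(n * t ^ 2 / 8)) := by
    refine hup.trans ((mul_le_mul_of_nonneg_left hm1 (Real.exp_pos _).le).trans ?_)
    rw [← Real.exp_add]
    exact Real.exp_le_exp.mpr hval
  have hlow' : (Measure.pi fun _ : Fin n => μ).real {z | X z ≤ -(t * n * V)} ≤
      Real.exp (-(n * t ^ 2 / 8)) := by
    refine hlow.trans ((mul_le_mul_of_nonneg_left hm2 (Real.exp_pos _).le).trans ?_)
    rw [← Real.exp_add]
    refine Real.exp_le_exp.mpr (le_trans (le_of_eq ?_) hval)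
    ring
  have hsub : {z | t * n * V < |∑ i, G (z i) ^ 2 - n * v|} ⊆
      {z | t * n * V ≤ X z} ∪ {z | X z ≤ -(t * n * V)} := by
    intro z hz
    simp only [Set.mem_ofPred_eq, hXeq] at hz
    rcases lt_abs.mp hz with h | h
    · exact Or.inl h.le
    · exact Or.inr (by simp only [Set.mem_ofPred_eq]; linarith)
  calc _ ≤ _ := measureReal_mono hsub
    _ ≤ _ := measureReal_union_le _ _
    _ ≤ _ := by linarith

/-- Polarization, FG = ((F+G)² - (F-G)²)/4, reduces products to two χ² deviations. Only the sum and
the difference have to be Gaussian. -/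
theorem cross_tail {F G : Ω → ℝ} (hFm : Measurable F) (hGm : Measurable G) {v w : NNReal}
    (hadd : μ.map (fun ω => F ω + G ω) = gaussianReal 0 v)
    (hsub : μ.map (fun ω => F ω - G ω) = gaussianReal 0 w)
    {V t : ℝ} (hV : 0 < V) (hv : v ≤ 2 * V) (hw : w ≤ 2 * V) (ht0 : 0 ≤ t) (ht1 : t ≤ 1) (n : ℕ) :
    (Measure.pi fun _ : Fin n => μ).real
      {z | t * n * V < |∑ i, F (z i) * G (z i) - n * ((v - w) / 4)|} ≤
      4 * Real.exp (-(n * t ^ 2 / 8)) := by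
  have h1 := chiSq_tail (hFm.add hGm) hadd (by linarith : 0 < 2 * V) hv ht0 ht1 n
  have h2 := chiSq_tail (hFm.sub hGm) hsub (by linarith : 0 < 2 * V) hw ht0 ht1 n
  simp only [Pi.add_apply, Pi.sub_apply] at h1 h2
  have hsubset : {z : Fin n → Ω | t * n * V < |∑ i, F (z i) * G (z i) - n * ((v - w) / 4)|} ⊆
      {z | t * n * (2 * V) < |∑ i, (F (z i) + G (z i)) ^ 2 - n * v|} ∪
      {z | t * n * (2 * V) < |∑ i, (F (z i) - G (z i)) ^ 2 - n * w|} := by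
    intro z hz
    by_contra hc
    simp only [Set.mem_union, Set.mem_ofPred_eq, not_or, not_lt] at hc hz
    have h3 : ∑ i, F (z i) * G (z i) - n * ((v - w) / 4 : ℝ) =
        ((∑ i, (F (z i) + G (z i)) ^ 2 - n * v) - (∑ i, (F (z i) - G (z i)) ^ 2 - n * w)) / 4 := by
      have : ∑ i, F (z i) * G (z i) =
          (∑ i, (F (z i) + G (z i)) ^ 2 - ∑ i, (F (z i) - G (z i)) ^ 2) / 4 := by
        rw [← Finset.sum_sub_distrib, Finset.sum_div]
        exact Finset.sum_congr rfl fun i _ => by ring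
      rw [this]; ring
    rw [h3] at hz
    obtain ⟨a1, a2⟩ := abs_le.mp hc.1
    obtain ⟨a3, a4⟩ := abs_le.mp hc.2
    rcases lt_abs.mp hz with h | h <;> linarith
  calc _ ≤ _ := measureReal_mono hsubset
    _ ≤ _ := measureReal_union_le _ _
    _ ≤ _ := by linarith

end ChiSquareTail

/-! ### Linear functionals of one observation and the spectrum of the covariance. -/

section Covariance

variable {p : ℕ}

/-- The bilinear form of a matrix. -/
noncomputable def bil (S : Matrix (Fin p) (Fin p) ℝ) (a b : Fin p → ℝ) : ℝ := lin a (S.mulVec b)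

theorem map_lin_multivariateGaussian {S : Matrix (Fin p) (Fin p) ℝ} (hS : S.PosSemidef)
    (a : Fin p → ℝ) :
    (multivariateGaussian (0 : EuclideanSpace ℝ (Fin p)) S).map
      (fun x : EuclideanSpace ℝ (Fin p) => lin x a) =
      gaussianReal 0 (bil S a a).toNNReal := by
  set a' : EuclideanSpace ℝ (Fin p) := WithLp.toLp 2 a with ha'
  set P := multivariateGaussian (0 : EuclideanSpace ℝ (Fin p)) S with hP
  have h1 : (fun x : EuclideanSpace ℝ (Fin p) => lin x a) = innerSL ℝ a' := by
    ext x
    rw [innerSL_apply_apply, PiLp.inner_apply]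
    simp [lin, ha']
  have h2 : Var[innerSL ℝ a'; P] = bil S a a := by
    rw [← covariance_self (by fun_prop)]
    change cov[fun x => inner ℝ a' x, fun x => inner ℝ a' x; P] = _
    rw [← covarianceBilin_apply_eq_cov IsGaussian.memLp_two_id,
      covarianceBilin_multivariateGaussian hS]
    rfl
  have h3 : ∫ x, innerSL ℝ a' x ∂P = 0 := by
    rw [(innerSL ℝ a').integral_comp_comm IsGaussian.integrable_fun_id,
      integral_id_multivariateGaussian, map_zero]
  rw [h1, IsGaussian.map_eq_gaussianReal, h2, h3]

/-- The linear functional `a·x + s ε` of one observation, where `ε = y - x·β`. -/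
noncomputable def combo (β a : Fin p → ℝ) (s : ℝ) (z : Obs p) : ℝ :=
  lin z.2 a + s * (z.1 - lin z.2 β)

@[fun_prop]
theorem measurable_combo (β a : Fin p → ℝ) (s : ℝ) : Measurable (combo β a s) := by
  unfold combo; fun_prop

theorem combo_add (β a b : Fin p → ℝ) (s r : ℝ) (z : Obs p) :
    combo β a s z + combo β b r z = combo β (a + b) (s + r) z := by
  simp only [combo, lin_add]; ring

theorem combo_sub (β a b : Fin p → ℝ) (s r : ℝ) (z : Obs p) :
    combo β a s z - combo β b r z = combo β (a - b) (s - r) z := by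
  simp only [combo, lin_sub]; ring

theorem bil_self_nonneg {S : Matrix (Fin p) (Fin p) ℝ} (hS : S.PosSemidef) (a : Fin p → ℝ) :
    0 ≤ bil S a a := by
  have := hS.dotProduct_mulVec_nonneg a
  simpa [bil, lin, dotProduct] using this

theorem map_combo (θ : Param p) (hS : θ.Sig.PosSemidef) (a : Fin p → ℝ) (s : ℝ) :
    (obsLaw θ).map (combo θ.beta a s) =
      gaussianReal 0 (bil θ.Sig a a + s ^ 2 * θ.sigma ^ 2).toNNReal := by
  have hm : Measurable fun w : EuclideanSpace ℝ (Fin p) × ℝ => (lin w.1 θ.beta + w.2, w.1) := by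
    fun_prop
  change Measure.map _ (Measure.map (fun w : EuclideanSpace ℝ (Fin p) × ℝ =>
    (lin w.1 θ.beta + w.2, w.1)) _) = _
  rw [Measure.map_map (by fun_prop) hm]
  have h1 : (combo θ.beta a s ∘ fun w : EuclideanSpace ℝ (Fin p) × ℝ =>
      (lin w.1 θ.beta + w.2, w.1)) =
      (fun u : ℝ × ℝ => u.1 + u.2) ∘ Prod.map (fun x : EuclideanSpace ℝ (Fin p) => lin x a)
        (fun e : ℝ => s * e) := by
    ext w; simp [combo]
  rw [h1, ← Measure.map_map (by fun_prop) (by fun_prop),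
    ← Measure.map_prod_map _ _ (by fun_prop) (by fun_prop), map_lin_multivariateGaussian hS,
    gaussianReal_map_const_mul]
  change Measure.conv _ _ = _
  rw [gaussianReal_conv_gaussianReal]
  congr 1
  · simp
  · rw [Real.toNNReal_add (bil_self_nonneg hS a) (by positivity),
      Real.toNNReal_mul (sq_nonneg _)]
    congr 2
    exact NNReal.eq (Real.coe_toNNReal _ (sq_nonneg s)).symm

theorem bil_add_left (S : Matrix (Fin p) (Fin p) ℝ) (a b c : Fin p → ℝ) :
    bil S (a + b) c = bil S a c + bil S b c := by
  simp [bil, lin, add_mul, Finset.sum_add_distrib]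

theorem bil_add_right (S : Matrix (Fin p) (Fin p) ℝ) (a b c : Fin p → ℝ) :
    bil S a (b + c) = bil S a b + bil S a c := by
  simp [bil, Matrix.mulVec_add, lin_add]

theorem bil_sub_left (S : Matrix (Fin p) (Fin p) ℝ) (a b c : Fin p → ℝ) :
    bil S (a - b) c = bil S a c - bil S b c := by
  simp [bil, lin, sub_mul, Finset.sum_sub_distrib]

theorem bil_sub_right (S : Matrix (Fin p) (Fin p) ℝ) (a b c : Fin p → ℝ) :
    bil S a (b - c) = bil S a b - bil S a c := by
  simp [bil, Matrix.mulVec_sub, lin_sub]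

theorem bil_comm {S : Matrix (Fin p) (Fin p) ℝ} (hS : S.PosSemidef) (a b : Fin p → ℝ) :
    bil S a b = bil S b a := by
  have hsymm : ∀ i j, S i j = S j i := fun i j => by
    have := hS.1.apply i j; simpa using this.symm
  simp only [bil, lin, Matrix.mulVec, dotProduct, Finset.mul_sum]
  rw [Finset.sum_comm]
  refine Finset.sum_congr rfl fun i _ => Finset.sum_congr rfl fun j _ => ?_
  rw [hsymm]; ring

/-- Covariance of two linear functionals of an observation. -/
noncomputable def comboCov (θ : Param p) (a b : Fin p → ℝ) (s r : ℝ) : ℝ :=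
  bil θ.Sig a b + s * r * θ.sigma ^ 2

theorem combo_cross_tail (θ : Param p) (hS : θ.Sig.PosSemidef) (a b : Fin p → ℝ) (s r : ℝ)
    {V t : ℝ} (hV : 0 < V) (hab : comboCov θ a a s s + comboCov θ b b r r ≤ V)
    (ht0 : 0 ≤ t) (ht1 : t ≤ 1) (n : ℕ) :
    (dataLaw n θ).real {z | t * n * V <
      |∑ i, combo θ.beta a s (z i) * combo θ.beta b r (z i) - n * comboCov θ a b s r|} ≤
      4 * Real.exp (-(n * t ^ 2 / 8)) := by
  set v := bil θ.Sig (a + b) (a + b) + (s + r) ^ 2 * θ.sigma ^ 2 with hv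
  set w := bil θ.Sig (a - b) (a - b) + (s - r) ^ 2 * θ.sigma ^ 2 with hw
  have hv0 : 0 ≤ v := add_nonneg (bil_self_nonneg hS _) (by positivity)
  have hw0 : 0 ≤ w := add_nonneg (bil_self_nonneg hS _) (by positivity)
  have hadd : (obsLaw θ).map (fun z => combo θ.beta a s z + combo θ.beta b r z) =
      gaussianReal 0 v.toNNReal := by
    simp_rw [combo_add]; exact map_combo θ hS _ _
  have hsub : (obsLaw θ).map (fun z => combo θ.beta a s z - combo θ.beta b r z) =
      gaussianReal 0 w.toNNReal := by
    simp_rw [combo_sub]; exact map_combo θ hS _ _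
  have hsum : v + w = 2 * (comboCov θ a a s s + comboCov θ b b r r) := by
    simp only [hv, hw, comboCov, bil_add_left, bil_add_right, bil_sub_left, bil_sub_right]; ring
  have hdiff : (v - w) / 4 = comboCov θ a b s r := by
    simp only [hv, hw, comboCov, bil_add_left, bil_add_right, bil_sub_left, bil_sub_right,
      bil_comm hS b a]; ring
  have := cross_tail (μ := obsLaw θ) (by fun_prop) (by fun_prop) hadd hsub hV
    (by rw [Real.coe_toNNReal _ hv0]; linarith) (by rw [Real.coe_toNNReal _ hw0]; linarith)
    ht0 ht1 n
  rw [Real.coe_toNNReal _ hv0, Real.coe_toNNReal _ hw0, hdiff] at this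
  exact this

theorem bil_bounds {M₁ : ℝ} {S : Matrix (Fin p) (Fin p) ℝ} (h : S.IsHermitian)
    (hev : ∀ i, 1 / M₁ ≤ h.eigenvalues i ∧ h.eigenvalues i ≤ M₁) (a : Fin p → ℝ) :
    1 / M₁ * lin a a ≤ bil S a a ∧ bil S a a ≤ M₁ * lin a a := by
  set a' : EuclideanSpace ℝ (Fin p) := WithLp.toLp 2 a with ha'
  set B := h.eigenvectorBasis with hB
  have hlin : lin a a = ∑ i, (inner ℝ (B i) a') ^ 2 := by
    rw [B.sum_sq_inner_right, EuclideanSpace.real_norm_sq_eq]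
    simp [lin, ha', sq]
  have hSa : ∀ i, inner ℝ (B i) (WithLp.toLp 2 (S.mulVec a) : EuclideanSpace ℝ (Fin p)) =
      h.eigenvalues i * inner ℝ (B i) a' := by
    intro i
    have h1 := h.mulVec_eigenvectorBasis i
    have h2 : (inner ℝ (B i) (WithLp.toLp 2 (S.mulVec a) : EuclideanSpace ℝ (Fin p)) : ℝ) =
        (S.mulVec a) ⬝ᵥ (B i).ofLp := by
      rw [PiLp.inner_apply]; simp [dotProduct]
    have hT : S.transpose = S := by
      have := h.eq; rwa [Matrix.conjTranspose_eq_transpose_of_trivial] at this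
    have h3 : (S.mulVec a) ⬝ᵥ (B i).ofLp = a ⬝ᵥ (S.mulVec (B i).ofLp) := by
      rw [Matrix.dotProduct_mulVec, ← Matrix.mulVec_transpose, hT]
    rw [h2, h3, h1, PiLp.inner_apply]
    simp [dotProduct, ha', Finset.mul_sum]
    refine Finset.sum_congr rfl fun j _ => ?_
    ring
  have hbil : bil S a a = ∑ i, h.eigenvalues i * (inner ℝ (B i) a') ^ 2 := by
    have h1 : bil S a a =
        inner ℝ a' (WithLp.toLp 2 (S.mulVec a) : EuclideanSpace ℝ (Fin p)) := by
      rw [PiLp.inner_apply]; simp [bil, lin, ha', mul_comm]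
    rw [h1, ← B.sum_inner_mul_inner]
    refine Finset.sum_congr rfl fun i _ => ?_
    rw [hSa, real_inner_comm]; ring
  rw [hlin, hbil, Finset.mul_sum, Finset.mul_sum]
  exact ⟨Finset.sum_le_sum fun i _ => mul_le_mul_of_nonneg_right (hev i).1 (sq_nonneg _),
    Finset.sum_le_sum fun i _ => mul_le_mul_of_nonneg_right (hev i).2 (sq_nonneg _)⟩

theorem lin_self_nonneg (a : Fin p → ℝ) : 0 ≤ lin a a :=
  Finset.sum_nonneg fun _ _ => mul_self_nonneg _

theorem lin_sq_le (a b : Fin p → ℝ) : lin a b ^ 2 ≤ lin a a * lin b b := by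
  have := Finset.sum_mul_sq_le_sq_mul_sq Finset.univ a b
  simpa [lin, sq] using this

/-- Coercivity makes S injective, hence surjective in finite dimension; applied to u together with
Cauchy–Schwarz for lin u b, it bounds the norm of the solution. -/
theorem exists_mulVec_eq {M₁ : ℝ} (hM₁ : 1 < M₁) {S : Matrix (Fin p) (Fin p) ℝ}
    (hlow : ∀ a, 1 / M₁ * lin a a ≤ bil S a a) (b : Fin p → ℝ) :
    ∃ u, S.mulVec u = b ∧ lin u u ≤ M₁ ^ 2 * lin b b := by
  have hM0 : 0 < 1 / M₁ := by positivity
  have hinj : Function.Injective S.mulVec := by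
    intro u w huw
    have h1 : S.mulVec (u - w) = 0 := by rw [Matrix.mulVec_sub, huw, sub_self]
    have h2 := hlow (u - w)
    rw [bil, h1] at h2
    have h3 : lin (u - w) (0 : Fin p → ℝ) = 0 := by simp [lin]
    rw [h3] at h2
    have h4 : lin (u - w) (u - w) = 0 :=
      le_antisymm (nonpos_of_mul_nonpos_right h2 hM0) (lin_self_nonneg _)
    have h5 := (Finset.sum_eq_zero_iff_of_nonneg fun j _ => mul_self_nonneg _).mp h4
    ext j
    have := mul_self_eq_zero.mp (h5 j (Finset.mem_univ j))
    simpa [sub_eq_zero] using this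
  obtain ⟨u, hu⟩ := Matrix.mulVec_surjective_iff_isUnit.mpr
    (Matrix.mulVec_injective_iff_isUnit.mp hinj) b
  refine ⟨u, hu, ?_⟩
  have h1 := hlow u
  rw [bil, hu] at h1
  have h2 := lin_sq_le u b
  have h0 := lin_self_nonneg u
  have hb0 := lin_self_nonneg b
  rw [div_mul_eq_mul_div, one_mul, div_le_iff₀ (by linarith)] at h1
  rcases h0.eq_or_lt with h | h
  · rw [← h]; positivity
  · have h3 : lin u u ^ 2 ≤ (lin u b * M₁) ^ 2 := by gcongr
    have h4 : lin u u * lin u u ≤ M₁ ^ 2 * lin b b * lin u u := by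
      calc _ = lin u u ^ 2 := (sq _).symm
        _ ≤ lin u b ^ 2 * M₁ ^ 2 := by rw [← mul_pow]; exact h3
        _ ≤ lin u u * lin b b * M₁ ^ 2 := by gcongr
        _ = _ := by ring
    exact le_of_mul_le_mul_right h4 h

end Covariance

/-! ### Noise averages with weights depending on the design only. -/

section Noise

variable {p : ℕ}

theorem pi_gaussianReal_tail {n : ℕ} (v : NNReal) (w : Fin n → ℝ) {b c : ℝ}
    (hw : ∑ i, w i ^ 2 ≤ b) (hc : 0 < c) :
    (Measure.pi fun _ : Fin n => gaussianReal 0 v) {e | c < |∑ i, w i * e i|} ≤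
      ENNReal.ofReal (v * b / c ^ 2) := by
  have hmem : ∀ i : Fin n, MemLp (fun x : ℝ => w i * x) 2 (gaussianReal 0 v) := fun i =>
    (memLp_id_gaussianReal 2).const_mul _
  set X : (Fin n → ℝ) → ℝ := ∑ i, fun e : Fin n → ℝ => w i * e i with hX
  have hXe : ∀ e, X e = ∑ i, w i * e i := fun e => by simp [hX]
  have hmem' : ∀ i : Fin n, MemLp (fun e : Fin n → ℝ => w i * e i) 2
      (Measure.pi fun _ : Fin n => gaussianReal 0 v) := fun i =>
    (hmem i).comp_measurePreserving (measurePreserving_eval _ i)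
  have hX2 : MemLp X 2 (Measure.pi fun _ : Fin n => gaussianReal 0 v) :=
    memLp_finsetSum' _ fun i _ => hmem' i
  have hvar : Var[X; Measure.pi fun _ : Fin n => gaussianReal 0 v] = v * ∑ i, w i ^ 2 := by
    rw [hX, variance_sum_pi hmem, Finset.mul_sum]
    refine Finset.sum_congr rfl fun i _ => ?_
    rw [variance_const_mul, variance_fun_id_gaussianReal]; ring
  have hmean : ∫ e, X e ∂(Measure.pi fun _ : Fin n => gaussianReal 0 v) = 0 := by
    simp_rw [hXe]
    rw [integral_finsetSum _ fun i _ => (hmem' i).integrable one_le_two]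
    refine Finset.sum_eq_zero fun i _ => ?_
    have h2 := integral_comp_eval (μ := fun _ : Fin n => gaussianReal 0 v) (i := i)
      (f := fun x : ℝ => x) (by fun_prop)
    rw [integral_const_mul, h2, integral_id_gaussianReal, mul_zero]
  have h1 := meas_ge_le_variance_div_sq hX2 hc
  rw [hmean, hvar] at h1
  refine (measure_mono fun e he => ?_).trans (h1.trans (ENNReal.ofReal_le_ofReal ?_))
  · simp only [Set.mem_ofPred_eq, sub_zero, hXe] at he ⊢
    exact he.le
  · gcongr

theorem dataLaw_eq_map (n : ℕ) (θ : Param p) :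
    dataLaw n θ = ((Measure.pi fun _ : Fin n =>
        multivariateGaussian (0 : EuclideanSpace ℝ (Fin p)) θ.Sig).prod
      (Measure.pi fun _ : Fin n => gaussianReal 0 (Real.toNNReal (θ.sigma ^ 2)))).map
        fun w i => (lin (w.1 i) θ.beta + w.2 i, w.1 i) := by
  set P := multivariateGaussian (0 : EuclideanSpace ℝ (Fin p)) θ.Sig
  set γ := gaussianReal 0 (Real.toNNReal (θ.sigma ^ 2))
  set Φ : EuclideanSpace ℝ (Fin p) × ℝ → Obs p := fun w => (lin w.1 θ.beta + w.2, w.1)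
  have hΦ : Measurable Φ := by fun_prop
  have h0 : obsLaw θ = (P.prod γ).map Φ := rfl
  have hp : IsProbabilityMeasure ((P.prod γ).map Φ) := by rw [← h0]; infer_instance
  have h1 : dataLaw n θ =
      (Measure.pi fun _ : Fin n => P.prod γ).map fun x i => Φ (x i) := by
    rw [Measure.pi_map_pi (fun _ => hΦ.aemeasurable)]; rfl
  have h2 := (measurePreserving_arrowProdEquivProdArrow (EuclideanSpace ℝ (Fin p)) ℝ (Fin n)
    (fun _ => P) (fun _ => γ)).symm
  rw [h1, ← h2.map_eq, Measure.map_map (by fun_prop) (MeasurableEquiv.measurable _)]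
  rfl

/-- Design and noise are independent by `dataLaw_eq_map`. Given the design the weights are
constants, and Chebyshev's inequality has a bound uniform in the design. -/
theorem noise_tail (n : ℕ) (θ : Param p) {w : (Fin n → EuclideanSpace ℝ (Fin p)) → Fin n → ℝ}
    (hwm : Measurable w) {b c : ℝ} (hw : ∀ x, ∑ i, w x i ^ 2 ≤ b) (hc : 0 < c) :
    (dataLaw n θ).real {z | c < |∑ i, w (fun i => (z i).2) i *
      ((z i).1 - lin (z i).2 θ.beta)|} ≤ θ.sigma ^ 2 * b / c ^ 2 := by
  have hb : 0 ≤ b := (Finset.sum_nonneg fun i _ => sq_nonneg _).trans (hw fun _ => 0)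
  have hwi : ∀ i, Measurable fun x => w x i := fun i => (measurable_pi_apply i).comp hwm
  have hwz : ∀ i, Measurable fun z : Data n p => w (fun i => (z i).2) i := fun i =>
    (hwi i).comp (by fun_prop)
  have hsum : Measurable fun z : Data n p => ∑ i, w (fun i => (z i).2) i *
      ((z i).1 - lin (z i).2 θ.beta) := by
    refine Finset.measurable_sum _ fun i _ => (hwz i).mul ?_
    fun_prop
  have hms : MeasurableSet {z : Data n p | c < |∑ i, w (fun i => (z i).2) i *
      ((z i).1 - lin (z i).2 θ.beta)|} :=
    measurableSet_lt measurable_const hsum.abs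
  refine ENNReal.toReal_le_of_le_ofReal (by positivity) ?_
  rw [dataLaw_eq_map, Measure.map_apply (by fun_prop) hms, Measure.prod_apply (by measurability)]
  refine (lintegral_mono (g := fun _ => ENNReal.ofReal (θ.sigma ^ 2 * b / c ^ 2)) fun x => ?_).trans
    (by simp)
  have h1 := pi_gaussianReal_tail (Real.toNNReal (θ.sigma ^ 2)) (w x) (hw x) hc
  rw [Real.coe_toNNReal _ (sq_nonneg _)] at h1
  refine (measure_mono fun e he => ?_).trans h1
  simpa using he

end Noise

/-! ### Sparse recovery: from near-orthogonality to an ℓ¹ bound. -/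

section Deterministic

variable {n p : ℕ}

theorem sum_abs_sq_le {δ : Fin p → ℝ} {s : ℕ} (hδ : (Function.support δ).ncard ≤ s) :
    (∑ j, |δ j|) ^ 2 ≤ s * lin δ δ := by
  classical
  set F := Finset.univ.filter (fun j => δ j ≠ 0) with hF
  have hcard : F.card ≤ s := by
    have : Function.support δ = (F : Set (Fin p)) := by
      ext j; simp [hF]
    rwa [this, Set.ncard_coe_finset] at hδ
  have h1 : ∑ j, |δ j| = ∑ j ∈ F, |δ j| := by
    refine (Finset.sum_subset (Finset.subset_univ _) fun j _ hj => ?_).symm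
    have : δ j = 0 := by by_contra h; exact hj (by simp [hF, h])
    simp [this]
  have h2 : ∑ j ∈ F, |δ j| ^ 2 ≤ lin δ δ := by
    rw [lin]
    calc _ ≤ ∑ j, |δ j| ^ 2 := Finset.sum_le_sum_of_subset_of_nonneg (Finset.subset_univ _)
          fun _ _ _ => sq_nonneg _
      _ = _ := Finset.sum_congr rfl fun j _ => by rw [sq_abs, sq]
  have h3 : (F.card : ℝ) ≤ s := by exact_mod_cast hcard
  rw [h1]
  calc _ ≤ F.card * ∑ j ∈ F, |δ j| ^ 2 := sq_sum_le_card_mul_sum_sq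
    _ ≤ _ := by gcongr

theorem abs_lin_le {a δ : Fin p → ℝ} {c : ℝ} (h : ∀ j, |a j| ≤ c) :
    |lin a δ| ≤ c * ∑ j, |δ j| := by
  rw [lin, Finset.mul_sum]
  refine (Finset.abs_sum_le_sum_abs _ _).trans (Finset.sum_le_sum fun j _ => ?_)
  rw [abs_mul]
  exact mul_le_mul_of_nonneg_right (h j) (abs_nonneg _)

theorem sum_lin_sq_eq (X : Fin n → Fin p → ℝ) (δ : Fin p → ℝ) :
    ∑ i, lin (X i) δ ^ 2 = lin (fun j => ∑ i, X i j * lin (X i) δ) δ := by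
  simp only [lin, Finset.sum_mul]
  rw [Finset.sum_comm]
  refine Finset.sum_congr rfl fun i _ => ?_
  rw [sq, Finset.sum_mul]
  refine Finset.sum_congr rfl fun j _ => ?_
  ring

theorem abs_sum_lin_sq_sub_bil_le {X : Fin n → Fin p → ℝ} {S : Matrix (Fin p) (Fin p) ℝ} {c : ℝ}
    (h : ∀ j l, |∑ i, X i j * X i l - n * S j l| ≤ c) (δ : Fin p → ℝ) :
    |∑ i, lin (X i) δ ^ 2 - n * bil S δ δ| ≤ c * (∑ j, |δ j|) ^ 2 := by
  have h1 : ∑ i, lin (X i) δ ^ 2 - n * bil S δ δ =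
      lin (fun j => lin (fun l => ∑ i, X i j * X i l - n * S j l) δ) δ := by
    have h2 : bil S δ δ = lin (fun j => lin (S j) δ) δ := by
      simp only [bil, lin_comm δ]; rfl
    have h3 : ∀ j, ∑ i, X i j * lin (X i) δ = lin (fun l => ∑ i, X i j * X i l) δ := by
      intro j
      simp only [lin, Finset.mul_sum, Finset.sum_mul]
      rw [Finset.sum_comm]
      exact Finset.sum_congr rfl fun l _ => Finset.sum_congr rfl fun i _ => by ring
    rw [sum_lin_sq_eq, h2]
    simp_rw [h3]
    simp only [lin, Finset.mul_sum, ← Finset.sum_sub_distrib]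
    refine Finset.sum_congr rfl fun j _ => ?_
    simp only [sub_mul, Finset.sum_sub_distrib]
    congr 1
    rw [Finset.sum_mul, Finset.sum_mul, Finset.mul_sum]
    exact Finset.sum_congr rfl fun l _ => by ring
  rw [h1, sq, ← mul_assoc]
  exact abs_lin_le fun j => abs_lin_le fun l => h j l

/-- With D the ℓ¹ norm, sparsity and the eigenvalue bound give D²/(2kM) ≤ δᵀSδ. Replacing S by the
empirical covariance costs tV·D², and the empirical energy is at most 3tV·D by the correlation
bound. Since 4kM·tV ≤ 1, the quadratic error is absorbed. -/
theorem sum_abs_le_of_feasible {X : Fin n → Fin p → ℝ} {S : Matrix (Fin p) (Fin p) ℝ}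
    {δ : Fin p → ℝ} {k : ℕ} {M t V : ℝ} (hn : 0 < n) (hM : 0 < M) (hk : 1 ≤ k)
    (hδ : (Function.support δ).ncard ≤ 2 * k) (hlow : 1 / M * lin δ δ ≤ bil S δ δ)
    (hS : ∀ j l, |∑ i, X i j * X i l - n * S j l| ≤ t * n * V)
    (hg : ∀ j, |∑ i, X i j * lin (X i) δ| ≤ 3 * (t * n * V))
    (htV : 0 ≤ t * V)
    (ht : 4 * k * M * (t * V) ≤ 1) :
    ∑ j, |δ j| ≤ 12 * k * M * (t * V) := by
  have hn0 : (0 : ℝ) < n := by exact_mod_cast hn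
  have hk0 : (0 : ℝ) < k := by exact_mod_cast hk
  set D := ∑ j, |δ j| with hD
  have hD0 : 0 ≤ D := Finset.sum_nonneg fun _ _ => abs_nonneg _
  have h1 : ∑ i, lin (X i) δ ^ 2 ≤ 3 * (t * n * V) * D := by
    rw [sum_lin_sq_eq]
    exact (le_abs_self _).trans (abs_lin_le hg)
  have h2 := (abs_le.mp (abs_sum_lin_sq_sub_bil_le hS δ)).1
  have h3 := sum_abs_sq_le hδ
  rw [← hD] at h2 h3
  push_cast at h3
  have h4 : D ^ 2 / (2 * k * M) ≤ bil S δ δ := by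
    refine le_trans ?_ hlow
    rw [div_le_iff₀ (by positivity)]
    calc D ^ 2 ≤ 2 * k * lin δ δ := h3
      _ = _ := by field_simp
  have h5 : D ^ 2 / (2 * k * M) ≤ 3 * (t * V) * D + t * V * D ^ 2 := by
    have : n * (D ^ 2 / (2 * k * M)) ≤ n * (3 * (t * V) * D + t * V * D ^ 2) := by
      have := mul_le_mul_of_nonneg_left h4 hn0.le
      nlinarith
    exact le_of_mul_le_mul_left this hn0
  rw [div_le_iff₀ (by positivity)] at h5
  have h6 : D * D ≤ 12 * k * M * (t * V) * D := by
    have h7 : 4 * k * M * (t * V) * D ^ 2 ≤ 1 * D ^ 2 := by gcongr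
    nlinarith
  rcases hD0.eq_or_lt with h | h
  · rw [← h]
    positivity
  · exact le_of_mul_le_mul_right h6 h

end Deterministic

/-! ### The high-probability event. -/

section GoodEvent

variable {n p : ℕ}

/-- The empirical second moments of design, noise and the direction `u` are close to the
population ones. -/
structure GoodDesign (θ : Param p) (u b : Fin p → ℝ) (h t V : ℝ) (z : Data n p) : Prop where
  design : ∀ j l, |∑ i, (z i).2 j * (z i).2 l - n * θ.Sig j l| ≤ t * n * V
  noise : ∀ j, |∑ i, (z i).2 j * ((z i).1 - lin (z i).2 θ.beta)| ≤ t * n * V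
  direction : ∀ j, |∑ i, (z i).2 j * lin (z i).2 u - n * b j| ≤ t * n * V * h
  energy : ∑ i, lin (z i).2 u ^ 2 ≤ 2 * n * V * h ^ 2

theorem lin_single (x : Fin p → ℝ) (j : Fin p) : lin x (Pi.single j 1) = x j := by
  rw [lin, Finset.sum_eq_single j]
  · simp
  · intro l _ hl; simp [Pi.single_eq_of_ne hl]
  · simp

theorem bil_single_left (S : Matrix (Fin p) (Fin p) ℝ) (j : Fin p) (a : Fin p → ℝ) :
    bil S (Pi.single j 1) a = S.mulVec a j := by
  rw [bil, lin_comm, lin_single]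

theorem lin_smul (x b : Fin p → ℝ) (c : ℝ) : lin x (c • b) = c * lin x b := by
  simp only [lin, Pi.smul_apply, smul_eq_mul, Finset.mul_sum]
  exact Finset.sum_congr rfl fun _ _ => by ring

theorem measureReal_biUnion_le {Ω ι : Type*} [MeasurableSpace Ω] (P : Measure Ω) (s : Finset ι)
    (f : ι → Set Ω) {c : ℝ} (h : ∀ i, P.real (f i) ≤ c) :
    P.real (⋃ i ∈ s, f i) ≤ s.card * c := by
  refine (measureReal_biUnion_finset_le s f).trans ?_
  rw [← nsmul_eq_mul]
  exact Finset.sum_le_card_nsmul _ _ _ fun i _ => h i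

/-- A union bound over p² + 2p + 1 ≤ 4p² product deviations, each of probability at most
4·exp(-nt²/8). Since Σu = b, the product of Xⱼ with Xᵀu has mean bⱼ. V dominates the sum of the two
variances in every product. -/
theorem not_goodDesign_prob_le (θ : Param p) {M₁ M₂ : ℝ} (hM₁ : 1 < M₁)
    (hS : θ.Sig.PosSemidef) (hup : ∀ a, bil θ.Sig a a ≤ M₁ * lin a a)
    (hσ : 0 < θ.sigma) (hσ' : θ.sigma ≤ M₂) {u b : Fin p → ℝ} {h t V : ℝ}
    (hh : 0 < h) (hu : θ.Sig.mulVec u = b) (huu : lin u u ≤ M₁ ^ 2 * h ^ 2)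
    (hV : 2 * M₁ ^ 3 + M₂ ^ 2 ≤ V) (ht0 : 0 ≤ t) (ht1 : t ≤ 1) (hp : 1 ≤ p) :
    (dataLaw n θ).real {z | ¬ GoodDesign θ u b h t V z} ≤
      16 * (p : ℝ) ^ 2 * Real.exp (-(n * t ^ 2 / 8)) := by
  classical
  have hM3 : M₁ ≤ M₁ ^ 3 := le_self_pow₀ hM₁.le (by norm_num)
  have hM30 : 0 < M₁ ^ 3 := by positivity
  have hVpos : 0 < V := by nlinarith [sq_nonneg M₂]
  have hp1 : (1 : ℝ) ≤ p := by exact_mod_cast hp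
  set e : Fin p → Fin p → ℝ := fun j => Pi.single j 1 with he
  -- Normalizing by h makes the variance of this direction at most M₁³, so the same V serves for all
  -- events.
  set u' : Fin p → ℝ := h⁻¹ • u with hu'
  set q := 4 * Real.exp (-(n * t ^ 2 / 8)) with hq
  have hq0 : 0 ≤ q := by positivity
  have ve : ∀ j, comboCov θ (e j) (e j) 0 0 ≤ M₁ ^ 3 := by
    intro j
    have := hup (e j)
    have h1 : lin (e j) (e j) = 1 := by simp [he, lin_single]
    rw [h1] at this
    simp only [comboCov]; linarith
  have vn : comboCov θ (0 : Fin p → ℝ) 0 1 1 ≤ M₂ ^ 2 := by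
    have : bil θ.Sig 0 0 = 0 := by simp [bil, lin]
    rw [comboCov, this]
    have : θ.sigma ^ 2 ≤ M₂ ^ 2 := by gcongr
    linarith
  have vu : comboCov θ u' u' 0 0 ≤ M₁ ^ 3 := by
    have := hup u'
    have h1 : lin u' u' = lin u u / h ^ 2 := by
      rw [hu', lin_smul, lin_comm, lin_smul]; field_simp
    have h2 : lin u u / h ^ 2 ≤ M₁ ^ 2 := by rw [div_le_iff₀ (by positivity)]; exact huu
    rw [h1] at this
    have h3 : M₁ * (lin u u / h ^ 2) ≤ M₁ * M₁ ^ 2 := by gcongr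
    simp only [comboCov]; nlinarith
  set B1 : Fin p × Fin p → Set (Data n p) := fun a => {z | t * n * V <
    |∑ i, combo θ.beta (e a.1) 0 (z i) * combo θ.beta (e a.2) 0 (z i) -
      n * comboCov θ (e a.1) (e a.2) 0 0|} with hB1
  set B2 : Fin p → Set (Data n p) := fun j => {z | t * n * V <
    |∑ i, combo θ.beta (e j) 0 (z i) * combo θ.beta 0 1 (z i) -
      n * comboCov θ (e j) 0 0 1|} with hB2
  set B3 : Fin p → Set (Data n p) := fun j => {z | t * n * V <
    |∑ i, combo θ.beta (e j) 0 (z i) * combo θ.beta u' 0 (z i) -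
      n * comboCov θ (e j) u' 0 0|} with hB3
  set B4 : Set (Data n p) := {z | t * n * V <
    |∑ i, combo θ.beta u' 0 (z i) * combo θ.beta u' 0 (z i) -
      n * comboCov θ u' u' 0 0|} with hB4
  have hsub : {z | ¬ GoodDesign θ u b h t V z} ⊆
      ((⋃ a ∈ Finset.univ, B1 a) ∪ (⋃ j ∈ Finset.univ, B2 j)) ∪
        ((⋃ j ∈ Finset.univ, B3 j) ∪ B4) := by
    intro z hz
    by_contra hc
    apply hz
    simp only [Set.mem_union, Set.mem_iUnion, not_or, not_exists, Finset.mem_univ, hB1, hB2, hB3,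
      hB4, Set.mem_ofPred_eq, not_lt, forall_const] at hc
    obtain ⟨⟨c1, c2⟩, c3, c4⟩ := hc
    have hcu : ∀ x : Obs p, combo θ.beta u' 0 x = lin x.2 u / h := by
      intro x; simp only [combo, hu', lin_smul]; field_simp; ring
    have hce : ∀ (j : Fin p) (x : Obs p), combo θ.beta (e j) 0 x = x.2 j := by
      intro j x; simp only [combo, he, lin_single]; ring
    have hcn : ∀ x : Obs p, combo θ.beta 0 1 x = x.1 - lin x.2 θ.beta := by
      intro x; simp [combo, lin]
    refine ⟨fun j l => ?_, fun j => ?_, fun j => ?_, ?_⟩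
    · have := c1 (j, l)
      simp only [hce] at this
      have h1 : comboCov θ (e j) (e l) 0 0 = θ.Sig j l := by
        simp only [comboCov, he, bil_single_left, Matrix.mulVec_single_one, Matrix.col_apply]; ring
      rwa [h1] at this
    · have := c2 j
      simp only [hce, hcn] at this
      have h1 : comboCov θ (e j) 0 0 1 = 0 := by simp [comboCov, bil, lin]
      rwa [h1, mul_zero, sub_zero] at this
    · have := c3 j
      simp only [hce, hcu] at this
      have h1 : comboCov θ (e j) u' 0 0 = b j / h := by
        simp only [comboCov, he, bil_single_left, hu', Matrix.mulVec_smul, hu, Pi.smul_apply,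
          smul_eq_mul]
        field_simp; ring
      have h2 : ∑ i, (z i).2 j * lin (z i).2 u - n * b j =
          (∑ i, (z i).2 j * (lin (z i).2 u / h) - n * (b j / h)) * h := by
        rw [sub_mul, Finset.sum_mul]
        congr 1
        · exact Finset.sum_congr rfl fun i _ => by field_simp
        · field_simp
      rw [h1] at this
      rw [h2, abs_mul, abs_of_pos hh]
      gcongr
    · have h1 := (abs_le.mp c4).2
      simp only [hcu] at h1
      have h2 : ∑ i, lin (z i).2 u ^ 2 = (∑ i, lin (z i).2 u / h * (lin (z i).2 u / h)) * h ^ 2 := by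
        rw [Finset.sum_mul]
        exact Finset.sum_congr rfl fun i _ => by field_simp
      rw [h2]
      gcongr
      have hn0 : (0 : ℝ) ≤ n := Nat.cast_nonneg n
      have h3 : n * comboCov θ u' u' 0 0 ≤ n * V := by
        gcongr; nlinarith [sq_nonneg M₂]
      have h4 : t * n * V ≤ 1 * n * V := by gcongr
      linarith
  have b1 : (dataLaw n θ).real (⋃ a ∈ Finset.univ, B1 a) ≤ (p : ℝ) ^ 2 * q := by
    have := measureReal_biUnion_le (dataLaw n θ) Finset.univ B1 (c := q) fun a =>
      combo_cross_tail θ hS _ _ _ _ hVpos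
        (by have := ve a.1; have := ve a.2; nlinarith [sq_nonneg M₂]) ht0 ht1 n
    simpa [sq] using this
  have b2 : (dataLaw n θ).real (⋃ j ∈ Finset.univ, B2 j) ≤ p * q := by
    have := measureReal_biUnion_le (dataLaw n θ) Finset.univ B2 (c := q) fun j =>
      combo_cross_tail θ hS _ _ _ _ hVpos (by have := ve j; linarith) ht0 ht1 n
    simpa using this
  have b3 : (dataLaw n θ).real (⋃ j ∈ Finset.univ, B3 j) ≤ p * q := by
    have := measureReal_biUnion_le (dataLaw n θ) Finset.univ B3 (c := q) fun j =>
      combo_cross_tail θ hS _ _ _ _ hVpos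
        (by have := ve j; nlinarith [sq_nonneg M₂]) ht0 ht1 n
    simpa using this
  have b4 : (dataLaw n θ).real B4 ≤ q :=
    combo_cross_tail θ hS _ _ _ _ hVpos (by nlinarith [sq_nonneg M₂]) ht0 ht1 n
  have hpq : (p : ℝ) * q ≤ p ^ 2 * q := by gcongr; nlinarith
  have hq1 : q ≤ (p : ℝ) ^ 2 * q := le_mul_of_one_le_left hq0 (by nlinarith)
  calc _ ≤ _ := measureReal_mono hsub
    _ ≤ _ := measureReal_union_le _ _
    _ ≤ _ := add_le_add (measureReal_union_le _ _) (measureReal_union_le _ _)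
    _ ≤ 4 * ((p : ℝ) ^ 2 * q) := by linarith
    _ = _ := by rw [hq]; ring

end GoodEvent

/-! ### Measurable choice under open conditions. -/

section Selection

/-- A nonempty open condition is met by a point of a countable dense sequence; taking the first such
point is measurable. -/
theorem exists_measurable_selection {Ω E : Type*} [MeasurableSpace Ω] [TopologicalSpace E]
    [MeasurableSpace E] [SecondCountableTopology E] [Zero E]
    (Q : Ω → E → Prop) (hopen : ∀ x, IsOpen {v | Q x v})
    (hmeas : ∀ v, MeasurableSet {x | Q x v}) :
    ∃ w : Ω → E, Measurable w ∧ ∀ x, (w x = 0 ∨ Q x (w x)) ∧ ((∃ v, Q x v) → Q x (w x)) := by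
  classical
  have : Nonempty E := ⟨0⟩
  set d : ℕ → E := TopologicalSpace.denseSeq E with hd
  have hex : ∀ x, (∃ v, Q x v) → ∃ m, Q x (d m) := by
    rintro x ⟨v, hv⟩
    obtain ⟨m, hm⟩ := (TopologicalSpace.denseRange_denseSeq E).exists_mem_open (hopen x) ⟨v, hv⟩
    exact ⟨m, hm⟩
  -- Index 0 stands for the default value 0, used exactly when no dense point qualifies; the dense
  -- sequence is shifted by one.
  set f : ℕ → E := fun m => Nat.casesOn m 0 d with hf
  set R : ℕ → Ω → Prop := fun m x => Nat.casesOn m (∀ l, ¬ Q x (d l)) (fun l => Q x (d l)) with hR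
  have hRex : ∀ x, ∃ m, R m x := by
    intro x
    by_cases h : ∃ l, Q x (d l)
    · obtain ⟨l, hl⟩ := h; exact ⟨l + 1, hl⟩
    · push Not at h; exact ⟨0, h⟩
  have hRm : ∀ m, MeasurableSet {x | R m x} := by
    intro m
    cases m with
    | zero =>
      have : {x | R 0 x} = ⋂ l, {x | Q x (d l)}ᶜ := by ext x; simp [hR]
      rw [this]; exact MeasurableSet.iInter fun l => (hmeas _).compl
    | succ l => exact hmeas (d l)
  refine ⟨fun x => f (Nat.find (hRex x)),
    Measurable.find (f := fun m (_ : Ω) => f m) (fun m => measurable_const) hRm hRex, fun x => ?_⟩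
  have hspec := Nat.find_spec (hRex x)
  change (f (Nat.find (hRex x)) = 0 ∨ Q x (f (Nat.find (hRex x)))) ∧
    ((∃ v, Q x v) → Q x (f (Nat.find (hRex x))))
  generalize Nat.find (hRex x) = m at hspec ⊢
  cases m with
  | zero =>
    refine ⟨Or.inl rfl, fun hv => ?_⟩
    obtain ⟨l, hl⟩ := hex x hv
    exact absurd hl (hspec l)
  | succ l => exact ⟨Or.inr hspec, fun _ => hspec⟩

/-- Openness lets the witness be taken in a countable dense subset of B itself, so B need not be
open: here it is the set of sparse vectors. -/
theorem measurableSet_exists_mem {Ω E : Type*} [MeasurableSpace Ω] [TopologicalSpace E]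
    [SecondCountableTopology E] (B : Set E) (F : Ω → E → Prop)
    (hopen : ∀ x, IsOpen {v | F x v}) (hmeas : ∀ v, MeasurableSet {x | F x v}) :
    MeasurableSet {x | ∃ v ∈ B, F x v} := by
  obtain ⟨D, hDc, hD⟩ := TopologicalSpace.exists_countable_dense B
  have : {x | ∃ v ∈ B, F x v} = ⋃ v ∈ D, {x | F x (v : E)} := by
    ext x
    simp only [Set.mem_ofPred_eq, Set.mem_iUnion, exists_prop]
    constructor
    · rintro ⟨v, hv, hF⟩
      have ho : IsOpen {v : B | F x v} := (hopen x).preimage continuous_subtype_val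
      obtain ⟨w, hw, hw'⟩ := hD.exists_mem_open ho ⟨⟨v, hv⟩, hF⟩
      exact ⟨w, hw, hw'⟩
    · rintro ⟨v, _, hF⟩
      exact ⟨v, v.2, hF⟩
  rw [this]
  exact MeasurableSet.biUnion hDc fun v _ => hmeas v

end Selection

/-! ### The debiased acceptance test and its weights. -/

section UpperBound

variable {n p : ℕ}

theorem tauAdap_le_of_measurableSet {M₁ M₂ α η τ : ℝ} {ku k : ℕ} {ξ : Fin p → ℝ} {t₀ : ℝ}
    {A : Set (Data n p)} (hA : MeasurableSet A) (hτ : 0 < τ)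
    (h0 : ∀ θ ∈ nullSpace M₁ M₂ ku ξ t₀, (dataLaw n θ).real Aᶜ ≤ α)
    (h1 : ∀ θ ∈ altSpace M₁ M₂ k ξ t₀ τ, (dataLaw n θ).real A ≤ η) :
    tauAdap M₁ M₂ α η n ku k ξ t₀ ≤ (τ : EReal) := by
  have hint : ∀ θ : Param p, ∫ z, Aᶜ.indicator (fun _ => (1 : ℝ)) z ∂(dataLaw n θ) =
      (dataLaw n θ).real Aᶜ := fun θ => integral_indicator_one hA.compl
  refine iInf₂_le τ ⟨hτ, ?_⟩
  refine le_iSup₂_of_le (Aᶜ.indicator fun _ => (1 : ℝ)) ⟨?_, ?_, ?_⟩ ?_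
  · exact measurable_const.indicator hA.compl
  · intro z
    by_cases hz : z ∈ Aᶜ
    · simp [Set.indicator_of_mem hz]
    · simp [Set.indicator_of_notMem hz]
  · intro θ hθ
    rw [hint]; exact h0 θ hθ
  · refine le_iInf₂ fun θ hθ => EReal.coe_le_coe_iff.mpr ?_
    rw [hint, probReal_compl_eq_one_sub hA]
    linarith [h1 θ hθ]

/-- One-step correction of the plug-in value `lin ξ b` with weights `w`. -/
def debiased (ξ : Fin p → ℝ) (w : Fin n → ℝ) (b : Fin p → ℝ) (z : Data n p) : ℝ :=
  lin ξ b + ∑ i, w i * ((z i).1 - lin (z i).2 b)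

/-- The error in b enters only through the mismatch between the weighted design and ξ, so a small
sup-norm mismatch and a small ℓ¹ error together give a small bias. -/
theorem debiased_sub (ξ : Fin p → ℝ) (w : Fin n → ℝ) (b β : Fin p → ℝ) (z : Data n p) :
    debiased ξ w b z - debiased ξ w β z =
      -lin (fun j => ∑ i, w i * (z i).2 j - ξ j) (b - β) := by
  have h1 : lin (fun j => ∑ i, w i * (z i).2 j - ξ j) (b - β) =
      ∑ i, w i * lin (z i).2 (b - β) - lin ξ (b - β) := by
    simp only [lin, sub_mul, Finset.sum_sub_distrib, Finset.sum_mul, Finset.mul_sum]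
    rw [Finset.sum_comm]
    congr 1
    exact Finset.sum_congr rfl fun _ _ => Finset.sum_congr rfl fun _ _ => by ring
  have h2 : ∑ i, w i * lin (z i).2 (b - β) =
      ∑ i, w i * ((z i).1 - lin (z i).2 β) - ∑ i, w i * ((z i).1 - lin (z i).2 b) := by
    rw [← Finset.sum_sub_distrib]
    exact Finset.sum_congr rfl fun i _ => by rw [lin_sub]; ring
  rw [h1, h2, lin_sub, debiased, debiased]
  ring

/-- Data for which some sparse, nearly uncorrelated fit has corrected value close to `t₀`. -/
def acceptSet (ku : ℕ) (ξ : Fin p → ℝ) (t₀ c r : ℝ)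
    (w : (Fin n → EuclideanSpace ℝ (Fin p)) → Fin n → ℝ) : Set (Data n p) :=
  {z | ∃ b ∈ {b : Fin p → ℝ | (Function.support b).ncard ≤ ku},
    (∀ j, |∑ i, (z i).2 j * ((z i).1 - lin (z i).2 b)| < c) ∧
      |debiased ξ (w fun i => (z i).2) b z - t₀| < r}

@[fun_prop]
theorem continuous_lin_right (x : Fin p → ℝ) : Continuous (lin x) := by
  unfold lin; fun_prop

theorem measurableSet_acceptSet (ku : ℕ) (ξ : Fin p → ℝ) (t₀ c r : ℝ)
    {w : (Fin n → EuclideanSpace ℝ (Fin p)) → Fin n → ℝ} (hw : Measurable w) :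
    MeasurableSet (acceptSet ku ξ t₀ c r w) := by
  refine measurableSet_exists_mem _ _ (fun z => ?_) fun b => ?_
  · refine IsOpen.inter (s := {b | ∀ j, |∑ i, (z i).2 j * ((z i).1 - lin (z i).2 b)| < c}) ?_ ?_
    · have : {b | ∀ j, |∑ i, (z i).2 j * ((z i).1 - lin (z i).2 b)| < c} =
          ⋂ j, {b | |∑ i, (z i).2 j * ((z i).1 - lin (z i).2 b)| < c} := by ext; simp
      rw [this]
      exact isOpen_iInter_of_finite fun j => isOpen_lt (by fun_prop) continuous_const
    · change IsOpen {b | |debiased ξ (w fun i => (z i).2) b z - t₀| < r}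
      unfold debiased
      exact isOpen_lt (by fun_prop) continuous_const
  · have hwz : ∀ i, Measurable fun z : Data n p => w (fun i => (z i).2) i := fun i =>
      ((measurable_pi_apply i).comp hw).comp (by fun_prop)
    refine MeasurableSet.inter
      (s₁ := {z : Data n p | ∀ j, |∑ i, (z i).2 j * ((z i).1 - lin (z i).2 b)| < c}) ?_ ?_
    · have : {z : Data n p | ∀ j, |∑ i, (z i).2 j * ((z i).1 - lin (z i).2 b)| < c} =
          ⋂ j, {z : Data n p | |∑ i, (z i).2 j * ((z i).1 - lin (z i).2 b)| < c} := by ext; simp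
      rw [this]
      refine MeasurableSet.iInter fun j => measurableSet_lt (Measurable.abs ?_) measurable_const
      refine Finset.measurable_sum _ fun i _ => Measurable.mul ?_ ?_
      · fun_prop
      · fun_prop
    · change MeasurableSet {z : Data n p | |debiased ξ (w fun i => (z i).2) b z - t₀| < r}
      refine measurableSet_lt (Measurable.abs (Measurable.sub_const ?_ _)) measurable_const
      refine Measurable.const_add (Finset.measurable_sum _ fun i _ => (hwz i).mul ?_) _
      fun_prop

theorem mem_acceptSet {θ : Param p} {u b : Fin p → ℝ} {h t V r : ℝ} {z : Data n p} {ku : ℕ}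
    {ξ : Fin p → ℝ} {t₀ : ℝ} {w : (Fin n → EuclideanSpace ℝ (Fin p)) → Fin n → ℝ}
    (hz : GoodDesign θ u b h t V z) (hβ : (Function.support θ.beta).ncard ≤ ku)
    (ht₀ : lin ξ θ.beta = t₀) (htV : 0 < t * n * V) (hr : 0 < r)
    (hnoise : |∑ i, w (fun i => (z i).2) i * ((z i).1 - lin (z i).2 θ.beta)| ≤ r / 2) :
    z ∈ acceptSet ku ξ t₀ (2 * (t * n * V)) r w := by
  refine ⟨θ.beta, hβ, fun j => (hz.noise j).trans_lt (by linarith), ?_⟩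
  rw [debiased, ht₀, add_sub_cancel_left]
  linarith

/-- The accepted b and the true signal both leave nearly uncorrelated residuals, and their
difference is 2·ku-sparse, so `sum_abs_le_of_feasible` bounds it in ℓ¹. The three errors are the
bias, the noise (r/2) and the acceptance radius (r). -/
theorem abs_lin_sub_lt_of_mem_acceptSet {θ : Param p} {u b : Fin p → ℝ} {h t V r a M : ℝ}
    {z : Data n p} {ku : ℕ} {ξ : Fin p → ℝ} {t₀ : ℝ}
    {w : (Fin n → EuclideanSpace ℝ (Fin p)) → Fin n → ℝ}
    (hz : GoodDesign θ u b h t V z) (hβ : (Function.support θ.beta).ncard ≤ ku)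
    (hn : 0 < n) (hM : 0 < M) (hku : 1 ≤ ku)
    (hlow : ∀ δ, 1 / M * lin δ δ ≤ bil θ.Sig δ δ) (htV : 0 ≤ t * V)
    (ht : 4 * ku * M * (t * V) ≤ 1) (ha : 0 ≤ a)
    (hw : ∀ j, |∑ i, w (fun i => (z i).2) i * (z i).2 j - ξ j| ≤ a)
    (hnoise : |∑ i, w (fun i => (z i).2) i * ((z i).1 - lin (z i).2 θ.beta)| ≤ r / 2)
    (hmem : z ∈ acceptSet ku ξ t₀ (2 * (t * n * V)) r w) :
    |lin ξ θ.beta - t₀| < a * (12 * ku * M * (t * V)) + 3 / 2 * r := by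
  obtain ⟨b, hb, hc, hr⟩ := hmem
  have hsupp : (Function.support (b - θ.beta)).ncard ≤ 2 * ku := by
    refine (Set.ncard_le_ncard (Function.support_sub b θ.beta) (Set.toFinite _)).trans ?_
    have hb' : (Function.support b).ncard ≤ ku := hb
    exact (Set.ncard_union_le _ _).trans (by omega)
  have hg : ∀ j, |∑ i, (z i).2 j * lin (z i).2 (b - θ.beta)| ≤ 3 * (t * n * V) := by
    intro j
    have h1 : ∑ i, (z i).2 j * lin (z i).2 (b - θ.beta) =
        ∑ i, (z i).2 j * ((z i).1 - lin (z i).2 θ.beta) -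
          ∑ i, (z i).2 j * ((z i).1 - lin (z i).2 b) := by
      rw [← Finset.sum_sub_distrib]
      exact Finset.sum_congr rfl fun i _ => by rw [lin_sub]; ring
    rw [h1]
    refine (abs_sub _ _).trans ?_
    linarith [hz.noise j, (hc j).le]
  have hD := sum_abs_le_of_feasible (X := fun i => (z i).2) hn hM hku hsupp (hlow _) hz.design hg
    htV ht
  have h1 := abs_lin_le (δ := b - θ.beta) hw
  have h2 : |debiased ξ (w fun i => (z i).2) b z -
      debiased ξ (w fun i => (z i).2) θ.beta z| ≤ a * (12 * ku * M * (t * V)) := by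
    rw [debiased_sub, abs_neg]
    exact h1.trans (by gcongr)
  have h3 : debiased ξ (w fun i => (z i).2) θ.beta z - lin ξ θ.beta =
      ∑ i, w (fun i => (z i).2) i * ((z i).1 - lin (z i).2 θ.beta) := by
    rw [debiased]; ring
  rw [← h3] at hnoise
  rw [abs_le] at h2 hnoise
  rw [abs_lt] at hr ⊢
  constructor <;> linarith [h2.1, h2.2, hnoise.1, hnoise.2, hr.1, hr.2]

theorem exists_measurable_weights (ξ : Fin p → ℝ) (a : ℝ) {B : ℝ} (hB : 0 ≤ B) :
    ∃ w : (Fin n → EuclideanSpace ℝ (Fin p)) → Fin n → ℝ, Measurable w ∧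
      (∀ x, ∑ i, w x i ^ 2 ≤ B) ∧
      ∀ x, (∃ v : Fin n → ℝ, (∀ j, |∑ i, v i * x i j - ξ j| < a) ∧ ∑ i, v i ^ 2 < B) →
        ∀ j, |∑ i, w x i * x i j - ξ j| ≤ a := by
  have hopen : ∀ x : Fin n → EuclideanSpace ℝ (Fin p),
      IsOpen {v : Fin n → ℝ | (∀ j, |∑ i, v i * x i j - ξ j| < a) ∧ ∑ i, v i ^ 2 < B} := by
    intro x
    have hB : IsOpen {v : Fin n → ℝ | ∑ i, v i ^ 2 < B} :=
      isOpen_lt (by fun_prop) continuous_const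
    refine IsOpen.inter (s := {v : Fin n → ℝ | ∀ j, |∑ i, v i * x i j - ξ j| < a}) ?_ hB
    have : {v : Fin n → ℝ | ∀ j, |∑ i, v i * x i j - ξ j| < a} =
        ⋂ j, {v : Fin n → ℝ | |∑ i, v i * x i j - ξ j| < a} := by ext; simp
    rw [this]
    exact isOpen_iInter_of_finite fun j => isOpen_lt (by fun_prop) continuous_const
  have hmeas : ∀ v : Fin n → ℝ, MeasurableSet {x : Fin n → EuclideanSpace ℝ (Fin p) |
      (∀ j, |∑ i, v i * x i j - ξ j| < a) ∧ ∑ i, v i ^ 2 < B} := by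
    intro v
    refine MeasurableSet.inter
      (s₁ := {x : Fin n → EuclideanSpace ℝ (Fin p) | ∀ j, |∑ i, v i * x i j - ξ j| < a}) ?_
      (MeasurableSet.const _)
    have : {x : Fin n → EuclideanSpace ℝ (Fin p) | ∀ j, |∑ i, v i * x i j - ξ j| < a} =
        ⋂ j, {x : Fin n → EuclideanSpace ℝ (Fin p) | |∑ i, v i * x i j - ξ j| < a} := by
      ext; simp
    rw [this]
    exact MeasurableSet.iInter fun j => measurableSet_lt (by fun_prop) measurable_const
  obtain ⟨w, hwm, hw⟩ := exists_measurable_selection _ hopen hmeas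
  refine ⟨w, hwm, fun x => ?_, fun x hx j => (((hw x).2 hx).1 j).le⟩
  rcases (hw x).1 with h | h
  · simpa [h] using hB
  · exact h.2.le

/-- The choice vᵢ = Xᵢᵀu/n is a certificate that the feasibility problem for the weights is
solvable. It depends on the unknown covariance; the test itself uses weights selected from the
design. -/
theorem GoodDesign.exists_weights {θ : Param p} {u b ξ : Fin p → ℝ} {h t V a e : ℝ}
    {z : Data n p} (hz : GoodDesign θ u b h t V z) (hn : 0 < n) (hh : 0 < h) (hV : 0 < V)
    (hb : ∀ j, |b j - ξ j| ≤ e) (ha : t * V * h + e < a) :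
    ∃ v : Fin n → ℝ, (∀ j, |∑ i, v i * (z i).2 j - ξ j| < a) ∧
      ∑ i, v i ^ 2 < 3 * V * h ^ 2 / n := by
  have hn0 : (0 : ℝ) < n := by exact_mod_cast hn
  refine ⟨fun i => lin (z i).2 u / n, fun j => ?_, ?_⟩
  · have h1 : ∑ i, lin (z i).2 u / n * (z i).2 j - ξ j =
        (∑ i, (z i).2 j * lin (z i).2 u - n * b j) / n + (b j - ξ j) := by
      have : ∑ i, lin (z i).2 u / n * (z i).2 j = (∑ i, (z i).2 j * lin (z i).2 u) / n := by
        rw [Finset.sum_div]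
        exact Finset.sum_congr rfl fun i _ => by ring
      rw [this]; field_simp; ring
    rw [h1]
    refine ((abs_add_le _ _).trans (add_le_add ?_ (hb j))).trans_lt ha
    rw [abs_div, abs_of_pos hn0, div_le_iff₀ hn0]
    linarith [hz.direction j]
  · have h1 : ∑ i, (lin (z i).2 u / n) ^ 2 = (∑ i, lin (z i).2 u ^ 2) / n ^ 2 := by
      rw [Finset.sum_div]
      exact Finset.sum_congr rfl fun i _ => by ring
    rw [h1, div_lt_div_iff₀ (by positivity) hn0]
    have := hz.energy
    have h2 : 0 < V * h ^ 2 * n := by positivity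
    nlinarith

/-- Truncation of a loading to its first `m` coordinates. -/
def headPart (m : ℕ) (ξ : Fin p → ℝ) : Fin p → ℝ := fun j => if (j : ℕ) < m then ξ j else 0

theorem lin_headPart (m : ℕ) (ξ : Fin p → ℝ) :
    lin (headPart m ξ) (headPart m ξ) = topSq m ξ := by
  rw [lin, topSq, Finset.sum_filter]
  refine Finset.sum_congr rfl fun j _ => ?_
  simp only [headPart]
  split_ifs <;> first | omega | ring

/-- A dropped loading is no larger than any of the m kept ones, so m of its squares fit into their
sum of squares. -/
theorem abs_headPart_sub_le {m : ℕ} {ξ : Fin p → ℝ} (hξ : Antitone fun j => |ξ j|) {d : ℝ}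
    (hd : 0 < d) (hm : d ^ 2 ≤ m) (j : Fin p) :
    |headPart m ξ j - ξ j| ≤ √(topSq m ξ) / d := by
  by_cases hj : (j : ℕ) < m
  · simp only [headPart, if_pos hj, sub_self, abs_zero]; positivity
  · simp only [headPart, if_neg hj, zero_sub, abs_neg]
    rw [le_div_iff₀ hd]
    refine Real.le_sqrt_of_sq_le ?_
    have := mul_sq_le_topSq hξ (q := m) (j := j) (by omega)
    rw [mul_pow, sq_abs]
    nlinarith [sq_nonneg (ξ j)]

end UpperBound

/-! ### Error probabilities and tuning of the test. -/

section Risk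

variable {n p : ℕ}

theorem tauAdap_le_of_bounds {M₁ M₂ α η t V d a r : ℝ} {ku k m : ℕ} {ξ : Fin p → ℝ} {t₀ : ℝ}
    (hM₁ : 1 < M₁) (hM₂ : 0 < M₂) (hn : 0 < n) (hp : 1 ≤ p) (hku : 1 ≤ ku) (hk : k ≤ ku)
    (hξ : Antitone fun j => |ξ j|) (hpos : 0 < topSq m ξ) (ht0 : 0 < t) (ht1 : t ≤ 1)
    (hV : 2 * M₁ ^ 3 + M₂ ^ 2 ≤ V) (ht : 4 * ku * M₁ * (t * V) ≤ 1) (hd : 0 < d)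
    (hm : d ^ 2 ≤ m) (ha : t * V * √(topSq m ξ) + √(topSq m ξ) / d < a) (hr : 0 < r)
    (hrisk : 16 * (p : ℝ) ^ 2 * Real.exp (-(n * t ^ 2 / 8)) +
      M₂ ^ 2 * (3 * V * topSq m ξ / n) / (r / 2) ^ 2 ≤ min α η) :
    tauAdap M₁ M₂ α η n ku k ξ t₀ ≤
      ((a * (12 * ku * M₁ * (t * V)) + 3 / 2 * r : ℝ) : EReal) := by
  have hn0 : (0 : ℝ) < n := by exact_mod_cast hn
  have hV0 : 0 < V := lt_of_lt_of_le (by positivity) hV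
  set h := √(topSq m ξ) with hh
  have hh0 : 0 < h := Real.sqrt_pos.mpr hpos
  have hh2 : h ^ 2 = topSq m ξ := Real.sq_sqrt hpos.le
  have ha0 : 0 < a := lt_trans (by positivity) ha
  obtain ⟨w, hwm, hwB, hw⟩ := exists_measurable_weights (n := n) ξ a
    (B := 3 * V * h ^ 2 / n) (by positivity)
  have hbad : ∀ θ ∈ paramSpace M₁ M₂ p ku, ∃ u : Fin p → ℝ,
      (∀ δ, 1 / M₁ * lin δ δ ≤ bil θ.Sig δ δ) ∧
      (dataLaw n θ).real {z | ¬ (GoodDesign θ u (headPart m ξ) h t V z ∧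
        |∑ i, w (fun i => (z i).2) i * ((z i).1 - lin (z i).2 θ.beta)| ≤ r / 2)} ≤ min α η := by
    rintro θ ⟨-, ⟨hS, hev⟩, hσ, hσ'⟩
    have hb := bil_bounds hS hev
    -- The certificate direction is Σ⁻¹ applied to the truncated loading, whose squared norm is h².
    obtain ⟨u, hu, huu⟩ := exists_mulVec_eq hM₁ (fun a => (hb a).1) (headPart m ξ)
    rw [lin_headPart, ← hh2] at huu
    have hpsd : θ.Sig.PosSemidef := hS.posSemidef_iff_eigenvalues_nonneg.mpr fun i =>
      le_trans (by positivity) (hev i).1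
    refine ⟨u, fun a => (hb a).1, ?_⟩
    have h1 := not_goodDesign_prob_le (n := n) θ hM₁ hpsd (fun a => (hb a).2) hσ hσ' hh0 hu huu hV
      ht0.le ht1 hp
    have h2 := noise_tail n θ hwm hwB (half_pos hr)
    rw [hh2] at h2
    refine le_trans ?_ hrisk
    calc _ ≤ (dataLaw n θ).real ({z | ¬ GoodDesign θ u (headPart m ξ) h t V z} ∪
          {z | r / 2 < |∑ i, w (fun i => (z i).2) i * ((z i).1 - lin (z i).2 θ.beta)|}) := by
          refine measureReal_mono fun z hz => ?_
          simp only [Set.mem_union, Set.mem_ofPred_eq] at hz ⊢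
          rw [not_and_or, not_le] at hz
          exact hz
      _ ≤ _ := measureReal_union_le _ _
      _ ≤ _ := by
          refine add_le_add h1 (h2.trans ?_)
          gcongr
  refine tauAdap_le_of_measurableSet
    (measurableSet_acceptSet ku ξ t₀ (2 * (t * n * V)) r hwm) (by positivity) ?_ ?_
  · rintro θ ⟨hθ, ht₀⟩
    obtain ⟨u, -, hu⟩ := hbad θ hθ
    refine le_trans (measureReal_mono fun z hz => ?_) (hu.trans (min_le_left _ _))
    rintro ⟨hg, hnoise⟩
    exact hz (mem_acceptSet hg hθ.1 ht₀ (by positivity) hr hnoise)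
  · rintro θ ⟨hθ, hτ⟩
    have hsupp : (Function.support θ.beta).ncard ≤ ku := hθ.1.trans hk
    obtain ⟨u, hlow, hu⟩ := hbad θ ⟨hsupp, hθ.2⟩
    refine le_trans (measureReal_mono fun z hz => ?_) (hu.trans (min_le_right _ _))
    rintro ⟨hg, hnoise⟩
    refine absurd hτ (not_le.mpr ?_)
    exact abs_lin_sub_lt_of_mem_acceptSet hg hsupp hn (by linarith) hku hlow (by positivity) ht
      ha0.le (hw _ (hg.exists_weights hn hh0 hV0 (abs_headPart_sub_le hξ hd hm) ha)) hnoise hz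

/-- Upper bound: the debiased estimator separates at the norm of the `ku² log p` largest
loadings. -/
theorem tauAdap_le {M₁ M₂ α η : ℝ} (Cu : ℝ) (hM₁ : 1 < M₁) (hM₂ : 0 < M₂) (hα : 0 < α)
    (hη : 0 < η) :
    ∃ (C : ℝ) (N : ℕ), 0 < C ∧ ∀ (n p ku k : ℕ) (ξ : Fin p → ℝ) (t₀ : ℝ),
      N ≤ p → 1 ≤ ku → (ku : ℝ) ≤ Cu * (√(n : ℝ) / Real.log p) → k ≤ ku →
      ξ ≠ 0 → (Antitone fun j => |ξ j|) →
      tauAdap M₁ M₂ α η n ku k ξ t₀ ≤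
        ((C * topNorm ((ku : ℝ) ^ 2 * Real.log p) ξ / √n : ℝ) : EReal) := by
  set V := 2 * M₁ ^ 3 + M₂ ^ 2 with hV
  set ε := min α η with hε
  have hε0 : 0 < ε := lt_min hα hη
  have hV1 : 1 ≤ V := by nlinarith [one_le_pow₀ (n := 3) hM₁.le, sq_nonneg M₂]
  set A := 6 * V * Cu + 1 with hA
  set R := M₂ * √(24 * V / ε) with hR
  have hR0 : 0 < R := by positivity
  have hlogtop : Filter.Tendsto (fun m : ℕ => Real.log m) Filter.atTop Filter.atTop :=
    Real.tendsto_log_atTop.comp tendsto_natCast_atTop_atTop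
  obtain ⟨N, hN⟩ := Filter.eventually_atTop.mp
    ((hlogtop.eventually_ge_atTop ((24 * M₁ * V * Cu) ^ 2 + 1)).and
      (Filter.eventually_ge_atTop (⌈32 / ε⌉₊ + 1)))
  -- The two terms are the bias and the noise contributions for the tuning used below. The absolute
  -- value is needed because Cu > 0 is only deduced later, from the sparsity condition.
  refine ⟨144 * |A| * M₁ * V + 3 / 2 * R, N, by positivity, ?_⟩
  intro n p ku k ξ t₀ hNp hku hkU hk hξ ha
  obtain ⟨hlog, hpε⟩ := hN p hNp
  have hp1 : 1 ≤ p := by omega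
  have hp0 : (1 : ℝ) ≤ p := by exact_mod_cast hp1
  have hku0 : (1 : ℝ) ≤ ku := by exact_mod_cast hku
  have hlog1 : 1 ≤ Real.log p := by nlinarith [sq_nonneg (24 * M₁ * V * Cu)]
  have hlog0 : 0 < Real.log p := by linarith
  have hn : 0 < n := by
    rcases Nat.eq_zero_or_pos n with h | h
    · subst h; simp at hkU; linarith
    · exact h
  have hn0 : (0 : ℝ) < n := by exact_mod_cast hn
  set s := √(n : ℝ) with hs
  have hs0 : 0 < s := Real.sqrt_pos.mpr hn0
  have hs2 : s ^ 2 = n := Real.sq_sqrt hn0.le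
  set L := √(Real.log p) with hL
  have hL0 : 0 < L := Real.sqrt_pos.mpr hlog0
  have hL2 : L ^ 2 = Real.log p := Real.sq_sqrt hlog0.le
  have hkL : ku * L ^ 2 ≤ Cu * s := by
    rw [hL2]
    calc _ ≤ Cu * (s / Real.log p) * Real.log p := by gcongr
      _ = _ := by field_simp
  have hCu : 0 < Cu := by
    by_contra hc
    have : Cu * s ≤ 0 := mul_nonpos_of_nonpos_of_nonneg (not_lt.mp hc) hs0.le
    have : 0 < ku * L ^ 2 := by positivity
    linarith
  have hA0 : 0 < A := by positivity
  rw [abs_of_pos hA0]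
  have hLbig : 24 * M₁ * V * Cu ≤ L := by
    refine Real.le_sqrt_of_sq_le (by linarith)
  have hkLs : 24 * M₁ * V * (ku * L) ≤ s := by
    have : 24 * M₁ * V * (ku * L) * L ≤ s * L := by
      calc _ = 24 * M₁ * V * (ku * L ^ 2) := by ring
        _ ≤ 24 * M₁ * V * (Cu * s) := by gcongr
        _ = 24 * M₁ * V * Cu * s := by ring
        _ ≤ L * s := by gcongr
        _ = _ := by ring
    exact le_of_mul_le_mul_right this hL0
  set m := ⌈(ku : ℝ) ^ 2 * Real.log p⌉₊ with hm
  set h := topNorm ((ku : ℝ) ^ 2 * Real.log p) ξ with hh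
  have hheq : h = √(topSq m ξ) := topNorm_eq _ _
  have hm1 : 1 ≤ m := Nat.one_le_ceil_iff.mpr (by positivity)
  have hpos : 0 < topSq m ξ := topSq_pos hξ ha hm1
  have hh0 : 0 < h := by rw [hheq]; exact Real.sqrt_pos.mpr hpos
  have hh2 : topSq m ξ = h ^ 2 := by rw [hheq, Real.sq_sqrt hpos.le]
  have hLs1 : 6 * L / s ≤ 1 := by
    rw [div_le_one hs0]
    have h1 : 1 ≤ M₁ * V := one_le_mul_of_one_le_of_one_le hM₁.le hV1
    have h2 : L ≤ ku * L := le_mul_of_one_le_left hL0.le hku0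
    nlinarith [mul_le_mul_of_nonneg_right h1 (by positivity : 0 ≤ (ku : ℝ) * L)]
  -- The deviation level t = 6√(log p/n) beats the union bound over p² events; d = ku·√(log p)
  -- matches the truncation level m. The factor 2 in a makes its constraint strict.
  have key := tauAdap_le_of_bounds (n := n) (M₁ := M₁) (M₂ := M₂) (α := α) (η := η) (t := 6 * L / s)
    (V := V) (d := ku * L) (a := 2 * h * A / (ku * L)) (r := R * h / s) (ku := ku) (k := k) (m := m)
    (ξ := ξ) (t₀ := t₀) hM₁ hM₂ hn hp1 hku hk ha hpos (by positivity) hLs1 le_rfl ?_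
    (by positivity) ?_ ?_ (by positivity) ?_
  · refine key.trans (EReal.coe_le_coe_iff.mpr (le_of_eq ?_))
    field_simp
    ring
  · have : 4 * (ku : ℝ) * M₁ * (6 * L / s * V) = 24 * M₁ * V * (ku * L) / s := by ring
    rw [this, div_le_one hs0]; exact hkLs
  · rw [mul_pow, hL2]; exact Nat.le_ceil _
  · rw [← hheq]
    -- The ultra-sparse condition: the sampling error of the weights is of the same order as the
    -- truncation error.
    have h1 : L / s ≤ Cu / (ku * L) := by
      rw [div_le_div_iff₀ hs0 (by positivity)]
      linarith
    calc 6 * L / s * V * h + h / (ku * L) = 6 * V * h * (L / s) + h / (ku * L) := by ring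
      _ ≤ 6 * V * h * (Cu / (ku * L)) + h / (ku * L) := by gcongr
      _ = h * A / (ku * L) := by rw [hA]; ring
      _ < 2 * (h * A / (ku * L)) := by
          have : 0 < h * A / (ku * L) := by positivity
          linarith
      _ = _ := by ring
  · have hexp : Real.exp (-(n * (6 * L / s) ^ 2 / 8)) ≤ 1 / (p : ℝ) ^ 4 := by
      have h1 : (n : ℝ) * (6 * L / s) ^ 2 / 8 = 9 / 2 * Real.log p := by
        rw [← hL2, ← hs2]; field_simp; norm_num
      have h2 : 1 / (p : ℝ) ^ 4 = Real.exp (-(4 * Real.log p)) := by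
        rw [Real.exp_neg, one_div]
        congr 1
        have : (4 : ℝ) * Real.log p = ((4 : ℕ) : ℝ) * Real.log p := by norm_num
        rw [this, Real.exp_nat_mul, Real.exp_log (by linarith)]
      rw [h1, h2]
      exact Real.exp_le_exp.mpr (by linarith)
    have hprob : 16 * (p : ℝ) ^ 2 * Real.exp (-(n * (6 * L / s) ^ 2 / 8)) ≤ ε / 2 := by
      have h1 : 32 / ε ≤ p := (Nat.le_ceil _).trans (by exact_mod_cast (by omega))
      rw [div_le_iff₀ hε0] at h1
      calc _ ≤ 16 * (p : ℝ) ^ 2 * (1 / (p : ℝ) ^ 4) := by gcongr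
        _ = 16 / (p : ℝ) ^ 2 := by field_simp
        _ ≤ ε / 2 := by
          rw [div_le_div_iff₀ (by positivity) two_pos]
          nlinarith [mul_le_mul_of_nonneg_left hp0 (by positivity : 0 ≤ ε * p)]
    -- R was chosen so that the Chebyshev bound equals exactly half of the allowed error.
    have hnoise : M₂ ^ 2 * (3 * V * topSq m ξ / n) / (R * h / s / 2) ^ 2 = ε / 2 := by
      have hR2 : R ^ 2 = M₂ ^ 2 * (24 * V / ε) := by
        rw [hR, mul_pow, Real.sq_sqrt (by positivity)]
      have hx : (R * h / s / 2) ^ 2 = M₂ ^ 2 * (24 * V / ε) * h ^ 2 / n / 4 := by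
        rw [← hR2, ← hs2]; ring
      rw [hh2, hx]
      field_simp
      norm_num
    linarith

end Risk

/-! ### Combining the bounds. -/

theorem EquivUpTo.of_bounds {L x y v : ℝ} {τ : EReal} (hL : 0 ≤ L) (hx : (x : EReal) ≤ τ)
    (hy : τ ≤ (y : EReal)) (hyv : y ≤ L * v) (hvx : v ≤ L * x) : EquivUpTo L τ (v : EReal) := by
  constructor
  · rw [← EReal.coe_mul]
    exact hy.trans (EReal.coe_le_coe_iff.mpr hyv)
  · calc (v : EReal) ≤ ((L * x : ℝ) : EReal) := EReal.coe_le_coe_iff.mpr hvx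
      _ = (L : EReal) * x := EReal.coe_mul _ _
      _ ≤ _ := mul_le_mul_of_nonneg_left hx (EReal.coe_nonneg.mpr hL)

theorem EquivUpTo.coe {L x y : ℝ} (hxy : x ≤ L * y) (hyx : y ≤ L * x) :
    EquivUpTo L (x : EReal) (y : EReal) := by
  constructor <;> rw [← EReal.coe_mul] <;> exact EReal.coe_le_coe_iff.mpr ‹_›

theorem topNorm_mono {p : ℕ} {s t : ℝ} (h : s ≤ t) (ξ : Fin p → ℝ) :
    topNorm s ξ ≤ topNorm t ξ := by
  rw [topNorm_eq, topNorm_eq]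
  exact Real.sqrt_le_sqrt (topSq_mono (Nat.ceil_mono h) ξ)

theorem one_le_log_of_three_le {p : ℕ} (hp : 3 ≤ p) : 1 ≤ Real.log p := by
  rw [Real.le_log_iff_exp_le (by positivity)]
  have h1 : (3 : ℝ) ≤ p := by exact_mod_cast hp
  linarith [Real.exp_one_lt_three]

end LinTest

theorem mainTheorem4
    (M₁ M₂ α η γ Cs Cu : ℝ) (hM₁ : 1 < M₁) (hM₂ : 0 < M₂)
    (hα : 0 < α) (hη : 0 < η) (hαη : α + η < 1) (hγ : 0 ≤ γ) (hγ' : γ < 1 / 2) :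
    (∃ (C : ℝ) (r : ℝ) (N : ℕ), 0 < C ∧ 0 ≤ r ∧
      ∀ (n p ku k : ℕ) (ξ : Fin p → ℝ) (t₀ : ℝ),
        N ≤ n → N ≤ p → N ≤ ku →
        (ku : ℝ) ≤ Cs * (p : ℝ) ^ γ →
        (ku : ℝ) ≤ Cu * (√(n : ℝ) / Real.log p) →
        1 ≤ k → k ≤ ku →
        ξ ≠ 0 → (Antitone fun j => |ξ j|) →
        LinTest.EquivUpTo (C * Real.log p ^ r)
            (LinTest.tauAdap M₁ M₂ α η n ku k ξ t₀)
            ((LinTest.nu1 ku ξ / √(n : ℝ) : ℝ) : EReal) ∧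
          LinTest.EquivUpTo (C * Real.log p ^ r)
            ((LinTest.nu1 ku ξ / √(n : ℝ) : ℝ) : EReal)
            ((LinTest.topNorm ((ku : ℝ) ^ 2 * Real.log p) ξ / √(n : ℝ) : ℝ) : EReal)) ∧
    (∀ Cj : ℝ, ∃ (C : ℝ) (N : ℕ), 0 < C ∧
      ∀ (n p ku k : ℕ) (ξ : Fin p → ℝ) (t₀ : ℝ),
        N ≤ n → N ≤ p → N ≤ ku →
        (ku : ℝ) ≤ Cs * (p : ℝ) ^ γ →
        (ku : ℝ) ≤ Cu * (√(n : ℝ) / Real.log p) →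
        (ku : ℝ) ^ 2 * Real.log p ≤ Cj * (LinTest.j1 ku ξ : ℝ) →
        1 ≤ k → k ≤ ku →
        ξ ≠ 0 → (Antitone fun j => |ξ j|) →
        LinTest.EquivUpTo C
          (LinTest.tauAdap M₁ M₂ α η n ku k ξ t₀)
          ((LinTest.nu1 ku ξ / √(n : ℝ) : ℝ) : EReal)) := by
  obtain ⟨c, N₁, hc, hlow⟩ := LinTest.tauAdap_ge Cu hM₁ hM₂ hαη
  obtain ⟨D, N₂, hD, hup⟩ := LinTest.tauAdap_le Cu hM₁ hM₂ hα hη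
  -- One constant serves every comparison: 10/c for ν₁ against the lower bound, 4D for the upper
  -- bound against ν₁, and 10 for ν₁ against the norm. Each uses a single factor √(log p). The
  -- threshold 10 secures ku ≥ 8 and log p ≥ 1.
  refine ⟨⟨10 / c + 4 * D + 10, 1 / 2, N₁ + N₂ + 10, by positivity, by norm_num, ?_⟩,
    fun Cj => ⟨(4 * |Cj| + 2) / c + 2 * √(⌈Cj⌉₊ : ℝ) * D, N₁ + N₂ + 10, by positivity, ?_⟩⟩
  · intro n p ku k ξ t₀ hn hp hku _ hkU hk hkk hξ ha
    have hlog := LinTest.one_le_log_of_three_le (by omega : 3 ≤ p)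
    have hl := hlow n p ku k ξ t₀ (by omega) (by omega) hlog hkU hk hξ ha
    have hu := hup n p ku k ξ t₀ (by omega) (by omega) hkU hkk hξ ha
    have h1 := LinTest.topNorm_le_nu1 ku ξ
    have h2 := LinTest.nu1_le_topNorm hξ ha (by omega : 8 ≤ ku) hlog
    have h3 := LinTest.topNorm_mul_log_le ha ku hlog
    have h4 : LinTest.topNorm ((ku : ℝ) ^ 2) ξ ≤
        LinTest.topNorm ((ku : ℝ) ^ 2 * Real.log p) ξ :=
      LinTest.topNorm_mono (le_mul_of_one_le_right (sq_nonneg _) hlog) ξ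
    have h0 : 0 ≤ LinTest.topNorm ((ku : ℝ) ^ 2) ξ := Real.sqrt_nonneg _
    have hL1 : 1 ≤ √(Real.log p) := Real.one_le_sqrt.mpr hlog
    rw [← Real.sqrt_eq_rpow]
    set ν := LinTest.nu1 ku ξ
    set a := LinTest.topNorm ((ku : ℝ) ^ 2) ξ
    set b := LinTest.topNorm ((ku : ℝ) ^ 2 * Real.log p) ξ
    set l := √(Real.log p)
    have hν0 : 0 ≤ ν := by linarith
    have hb : b ≤ 4 * (l * ν) := by
      have : l * a ≤ l * (2 * ν) := by gcongr
      linarith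
    have hlν : 0 ≤ l * ν := by positivity
    have hla : 0 ≤ l * a := by positivity
    refine ⟨LinTest.EquivUpTo.of_bounds (by positivity) hl hu ?_ ?_, LinTest.EquivUpTo.coe ?_ ?_⟩
    · rw [← mul_div_assoc]
      refine div_le_div_of_nonneg_right ?_ (Real.sqrt_nonneg _)
      calc D * b ≤ D * (4 * (l * ν)) := by gcongr
        _ = 4 * D * (l * ν) := by ring
        _ ≤ (10 / c + 4 * D + 10) * (l * ν) := by
          gcongr
          have : 0 < 10 / c := by positivity
          linarith
        _ = _ := by ring
    · rw [← mul_div_assoc]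
      refine div_le_div_of_nonneg_right ?_ (Real.sqrt_nonneg _)
      calc ν ≤ 10 / c * c * (l * a) := by
            rw [div_mul_cancel₀ _ hc.ne']; linarith
        _ ≤ (10 / c + 4 * D + 10) * c * (l * a) := by gcongr; linarith
        _ = _ := by ring
    · rw [← mul_div_assoc]
      refine div_le_div_of_nonneg_right ?_ (Real.sqrt_nonneg _)
      calc ν ≤ 10 * (l * a) := by linarith
        _ ≤ (10 / c + 4 * D + 10) * (l * b) := by
          gcongr
          have : 0 < 10 / c := by positivity
          linarith
        _ = _ := by ring
    · rw [← mul_div_assoc]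
      refine div_le_div_of_nonneg_right ?_ (Real.sqrt_nonneg _)
      calc b ≤ 4 * (l * ν) := hb
        _ ≤ (10 / c + 4 * D + 10) * (l * ν) := by
          gcongr
          have : 0 < 10 / c := by positivity
          linarith
        _ = _ := by ring
  · intro n p ku k ξ t₀ hn hp hku _ hkU hj hk hkk hξ ha
    have hlog := LinTest.one_le_log_of_three_le (by omega : 3 ≤ p)
    have hl := hlow n p ku k ξ t₀ (by omega) (by omega) hlog hkU hk hξ ha
    have hu := hup n p ku k ξ t₀ (by omega) (by omega) hkU hkk hξ ha
    have h1 := LinTest.topNorm_le_nu1 ku ξ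
    have h2 := LinTest.nu1_le_topNorm_of_j1 hξ ha (by omega : 1 ≤ ku) hlog hj
    have h3 := LinTest.topNorm_mul_log_le_nu1 ha hj
    have h0 : 0 ≤ LinTest.topNorm ((ku : ℝ) ^ 2) ξ := Real.sqrt_nonneg _
    set ν := LinTest.nu1 ku ξ
    set a := LinTest.topNorm ((ku : ℝ) ^ 2) ξ
    set b := LinTest.topNorm ((ku : ℝ) ^ 2 * Real.log p) ξ
    have hν0 : 0 ≤ ν := by linarith
    refine LinTest.EquivUpTo.of_bounds (by positivity) hl hu ?_ ?_
    · rw [← mul_div_assoc]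
      refine div_le_div_of_nonneg_right ?_ (Real.sqrt_nonneg _)
      calc D * b ≤ D * (2 * √(⌈Cj⌉₊ : ℝ) * ν) := by gcongr
        _ = 2 * √(⌈Cj⌉₊ : ℝ) * D * ν := by ring
        _ ≤ _ := by
          gcongr
          have : 0 < (4 * |Cj| + 2) / c := by positivity
          linarith
    · rw [← mul_div_assoc]
      refine div_le_div_of_nonneg_right ?_ (Real.sqrt_nonneg _)
      calc ν ≤ (4 * |Cj| + 2) / c * c * a := by rwa [div_mul_cancel₀ _ hc.ne']
        _ ≤ ((4 * |Cj| + 2) / c + 2 * √(⌈Cj⌉₊ : ℝ) * D) * c * a := by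
          gcongr
          have : 0 ≤ 2 * √(⌈Cj⌉₊ : ℝ) * D := by positivity
          linarith
        _ = _ := by ring
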